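/- Let $x$, $h$, $n$ be independent complex random variables and, for $snr>0$, let $y=\sqrt{snr}\,h\,x+n$. Here $\mathcal{CN}(c,w)$ denotes the law of a complex random variable whose real and imaginary parts are independent real Gaussians with means $\mathrm{Re}\,c$, $\mathrm{Im}\,c$ and variance $w/2$ each. Assume $n\sim\mathcal{CN}(0,1)$ and $h\sim\mathcal{CN}(\mu,2\sigma^2)$ with $\mu\in\mathbb{C}$ and $\sigma>0$ (Rayleigh fading if $\mu=0$, Ricean fading if $\mu\neq 0$). Let $$mmse_h(snr)=E\left\{\left|hx-E\{hx\mid y,h\}\right|^2\,\middle|\,h\right\},\qquad \overline{mmse}(snr)=E_h\{mmse_h(snr)\}.$$ Then, as $snr\to+\infty$: 1. If $x$ is uniform on the unit circle ($\infty$-PSK), then $\overline{mmse}(snr)=\frac{1}{2\,snr}+O(snr^{-R})$ for every $R\in\,]1,2[$. 2. If $x$ is uniform on the real segment $[-\sqrt3,\sqrt3]$ ($\infty$-PAM), then $\overline{mmse}(snr)=\frac{1}{2\,snr}+O(snr^{-R})$ for every $R\in\,]1,\frac32[$. 3. If $x$ is uniform on the square $[-\sqrt{3/2},\sqrt{3/2}]\times[-\sqrt{3/2},\sqrt{3/2}]\subset\mathbb{C}$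 ($\infty$-QAM), then $\overline{mmse}(snr)=\frac{1}{snr}+O(snr^{-R})$ for every $R\in\,]1,\frac32[$. 4. If $x\sim\mathcal{CN}(0,1)$, put, for $m=0,1,2,\ldots$, $$g_m(z)=(z-m-2)^2\,\frac{\pi\, e^{-|\mu|^2/(2\sigma^2)}\,(2\sigma^2)^{1-z}\,\Gamma(2-z)\;{}_1F_1\!\left(2-z;1;\tfrac{|\mu|^2}{2\sigma^2}\right)}{\sin(\pi z)},$$ where ${}_1F_1(a;b;w)=\sum_{n\ge0}\frac{(a)_n}{(b)_n}\frac{w^n}{n!}$. The singularity of $g_m$ at $z=m+2$ is removable; let $g_m$ also denote the analytic extension to $z=m+2$. Then $$\overline{mmse}(snr)\sim\frac{1}{snr}+\frac{1}{snr^2}\sum_{m=0}^{+\infty}-\frac{1}{snr^m}\sum_{j=0}^{1}\frac{(-\log snr)^j}{j!\,(1-j)!}\;g_m^{(1-j)}(m+2).$$ Here $\sim$ means an asymptotic expansion with respect to the scale $\frac{1}{snr},\frac{\log snr}{snr^2},\frac{1}{snr^2},\frac{\log snr}{snr^3},\frac{1}{snr^3},\ldots$: each member of the scale is $o$ of the preceding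 one, and every partial sum along this scale approximates $\overline{mmse}(snr)$ up to $O$ of the next member. In particular, for every $M\ge0$ the sum of $\frac{1}{snr}$ and the terms $m=0,\ldots,M-1$ differs from $\overline{mmse}(snr)$ by $O\!\left(\frac{\log snr}{snr^{M+2}}\right)$. -/

import Mathlib

open MeasureTheory ProbabilityTheory Filter Topology Asymptotics

noncomputable section

namespace FadingMMSE

/-- The complex Gaussian law `CN(c, w)`: real and imaginary part are independent real Gaussians
with means `c.re`, `c.im` and variance `w / 2` each. -/
def complexNormal (c : ℂ) (w : ℝ) : Measure ℂ :=
  ((gaussianReal c.re (w / 2).toNNReal).prod (gaussianReal c.im (w / 2).toNNReal)).map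
    Complex.measurableEquivRealProd.symm

/-- Unit-power `∞`-PSK: the uniform law on the unit circle. -/
def inftyPSK : Measure ℂ :=
  (ProbabilityTheory.cond (volume : Measure ℝ) (Set.Ioc 0 (2 * Real.pi))).map
    (fun θ : ℝ => Complex.exp (θ * Complex.I))

/-- Unit-power `∞`-PAM: the uniform law on the real segment `[-√3, √3]`. -/
def inftyPAM : Measure ℂ :=
  (ProbabilityTheory.cond (volume : Measure ℝ) (Set.Icc (-√3) (√3))).map
    (fun x : ℝ => (x : ℂ))

/-- Unit-power `∞`-QAM: the uniform law on the square `[-√(3/2), √(3/2)]²`. -/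
def inftyQAM : Measure ℂ :=
  ProbabilityTheory.cond (volume : Measure ℂ)
    (Set.Icc (-√(3 / 2)) (√(3 / 2)) ×ℂ Set.Icc (-√(3 / 2)) (√(3 / 2)))

section Channel

variable {Ω : Type*} [MeasurableSpace Ω]

/-- The channel output `y = √snr · h · x + n`. -/
def output (X H N : Ω → ℂ) (snr : ℝ) (ω : Ω) : ℂ :=
  (√snr : ℂ) * H ω * X ω + N ω

/-- The conditional-mean estimate `E[h x | y, h]` of the noiseless output, by a receiver that
knows the channel output and the channel gain. -/
def estimate (P : Measure Ω) (X H N : Ω → ℂ) (snr : ℝ) : Ω → ℂ :=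
  P[fun ω => H ω * X ω |
    MeasurableSpace.comap (fun ω => (output X H N snr ω, H ω)) inferInstance]

/-- The conditional MMSE given the channel gain, as a random variable:
`mmse_h(snr) = E[ |h x - E[h x | y, h]|² | h ]`. -/
def condMMSE (P : Measure Ω) (X H N : Ω → ℂ) (snr : ℝ) : Ω → ℝ :=
  P[fun ω => ‖H ω * X ω - estimate P X H N snr ω‖ ^ 2 | MeasurableSpace.comap H inferInstance]

/-- The average MMSE: the expectation of `mmse_h(snr)` over the channel gain. -/
def avgMMSE (P : Measure Ω) (X H N : Ω → ℂ) (snr : ℝ) : ℝ :=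
  ∫ ω, condMMSE P X H N snr ω ∂P

/-- The model `y = √snr · h · x + n`: input `x`, gain `h` and noise `n` are independent complex
random variables, `n` has law `CN(0, 1)`, and `h` has law `CN(c, 2σ²)`
(Rayleigh fading for `c = 0`, Ricean fading for `c ≠ 0`). -/
structure IsRayleighRiceChannel (P : Measure Ω) (X H N : Ω → ℂ) (c : ℂ) (σ : ℝ) : Prop where
  measurable_input : Measurable X
  measurable_gain : Measurable H
  measurable_noise : Measurable N
  indep : iIndepFun ![X, H, N] P
  law_gain : P.map H = complexNormal c (2 * σ ^ 2)
  law_noise : P.map N = complexNormal 0 1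

end Channel

/-- The asymptotic expansion `f ~ ∑ aₙ φₙ` as `x → +∞`: the `φₙ` are continuous (on the positive
reals), each is `o` of its predecessor, and every partial sum approximates `f` up to `O` of the
first omitted `φ`. -/
def IsAsymptoticExpansion (f : ℝ → ℂ) (a : ℕ → ℂ) (φ : ℕ → ℝ → ℝ) : Prop :=
  (∀ n, ContinuousOn (φ n) (Set.Ioi 0)) ∧
  (∀ n, φ (n + 1) =o[atTop] φ n) ∧
  ∀ m, (fun x => f x - ∑ n ∈ Finset.range (m + 1), a n * (φ n x : ℂ)) =O[atTop] φ (m + 1)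

/-- Kummer's confluent hypergeometric series `₁F₁(a; b; z) = ∑ (a)ₙ / ((b)ₙ n!) zⁿ`. -/
def hypergeometric₁F₁ (a b z : ℂ) : ℂ :=
  ∑' n : ℕ, (ascPochhammer ℂ n).eval a / ((ascPochhammer ℂ n).eval b * (n.factorial : ℂ)) * z ^ n

/-- The function in braces,
`(z-m-2)² π e^{-|c|²/(2σ²)} (2σ²)^{1-z} Γ(2-z) ₁F₁(2-z; 1; |c|²/(2σ²)) / sin(πz)`,
meaningful for non-integer `z`. -/
def bracket (c : ℂ) (σ : ℝ) (m : ℕ) (z : ℂ) : ℂ :=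
  (z - m - 2) ^ 2 *
    (Real.pi * Complex.exp (-(‖c‖ ^ 2 / (2 * σ ^ 2) : ℝ)) * ((2 * σ ^ 2 : ℝ) : ℂ) ^ (1 - z) *
        Complex.Gamma (2 - z) * hypergeometric₁F₁ (2 - z) 1 ((‖c‖ ^ 2 / (2 * σ ^ 2) : ℝ) : ℂ) /
      Complex.sin (Real.pi * z))

/-- `bracket` with its removable singularity at `z = m + 2` removed. -/
def bracketExt (c : ℂ) (σ : ℝ) (m : ℕ) : ℂ → ℂ :=
  Function.update (bracket c σ m) (m + 2) (limUnder (𝓝[≠] ((m : ℂ) + 2)) (bracket c σ m))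

/-- The coefficient of `(log snr)^j / snr^(m+2)` in the expansion for a Gaussian input:
`-(-1)^j / (j! (1-j)!) · (d/dz)^(1-j) {…}` at `z = m + 2`. -/
def gaussCoeff (c : ℂ) (σ : ℝ) (m j : ℕ) : ℂ :=
  -((-1) ^ j / ((j.factorial : ℂ) * ((1 - j).factorial : ℂ)) *
    iteratedDeriv (1 - j) (bracketExt c σ m) (m + 2))

/-- The scale `1/s, log s/s², 1/s², log s/s³, 1/s³, …`: the entry `n + 1` is
`(log s)^j / s^(m+2)` with `m = n / 2` and `j = 1 - n % 2`. -/
def gaussScale : ℕ → ℝ → ℝ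
  | 0, s => 1 / s
  | n + 1, s => Real.log s ^ (1 - n % 2) / s ^ (n / 2 + 2)

/-- The coefficients along `gaussScale`. -/
def gaussCoeffSeq (c : ℂ) (σ : ℝ) : ℕ → ℂ
  | 0 => 1
  | n + 1 => gaussCoeff c σ (n / 2) (1 - n % 2)

end FadingMMSE

end

/-! The average MMSE is the least value of E|hx - f(y,h)|², so every explicit estimator f gives an
upper bound (`avgMMSE_le`). Lower bounds come from duality: if V is orthogonal to all functions of
(y,h), the error is at least E(2⟨hx,V⟩ - |V|²) (`le_avgMMSE`). The V used here are weighted scores: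
integration by parts in x against the Gaussian noise kernel makes their posterior mean vanish.
Optimising a multiplier of V at each gain yields a Bayesian Cramér-Rao bound (`score_le_avgMMSE`).
The bounds are then governed by one function, J(s) = E[1/(1+s|h|²)] (`gainTransform`), which is
O(s^(-a)) for every a < 1 (`gainTransform_le`).

For ∞-PSK the tangential score gives (1 - J(2s))/(2s) from below. Dividing y by h√s and making one
Newton step towards the circle gives (1/2 + K J(s))/s from above.

For ∞-PAM and ∞-QAM the upper bounds 1/(2s) and 1/s come from inverting the channel, taking a real
part for PAM. The uniform density jumps at the end points, so the score is weighted by 1 -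
(τ/L)^(2(m+1)). This costs a factor (1 - 1/(2m+3))², and the second moment of the weight's
derivative is at most m+1. Balancing 1/m against J(2s/(m+1)) with m of order √s produces the
exponent 3/2 (`isBigO_of_weight_bound`).

For a Gaussian input the Cramér-Rao bound meets the linear estimator, so the average MMSE equals (1
- J(s))/s exactly. Here J(s) = (1/s) ∫₀^∞ p(u)/(1/s+u) du with an explicit Bessel-type density p. If
p has Taylor coefficients b_k at 0, its Stieltjes transform expands as ∑ (-x)^j (f_j - b_j log x),
where f_j is the Hadamard finite part of ∫ p(u) u^(-j-1) du (`exists_stieltjes_expansion`). The same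
numbers b_j and f_j are the residue and the constant term at a = -j of the Mellin transform of p,
which is Γ(a) e^(-w) β^(a-1) ₁F₁(a;1;w) with β = 2σ² and w = |c|²/β. With a = 2 - z this is the
function in g_m. The factor π/sin(πz) adds a second simple pole with no constant term, whence
g_m(m+2) = -(-1)^m b_m and g_m'(m+2) = (-1)^m f_m (`exists_analytic_extension`). -/

namespace FadingMMSE

open scoped InnerProductSpace ComplexConjugate

/-! ### Conditional expectation as an orthogonal projection: primal and dual bounds. -/

section Projection

variable {Ω : Type*} {m m₀ : MeasurableSpace Ω} {P : Measure Ω}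

lemma integrable_inner_of_memLp_two {f g : Ω → ℂ} (hf : MemLp f 2 P) (hg : MemLp g 2 P) :
    Integrable (fun ω => ⟪f ω, g ω⟫_ℝ) P := by
  have h := hf.norm.integrable_mul hg.norm
  refine h.mono (hf.1.inner hg.1) (ae_of_all _ fun ω => ?_)
  simpa using abs_real_inner_le_norm (f ω) (g ω)

lemma integrable_norm_sq_of_memLp_two {f : Ω → ℂ} (hf : MemLp f 2 P) :
    Integrable (fun ω => ‖f ω‖ ^ 2) P :=
  (memLp_two_iff_integrable_sq_norm hf.1).1 hf

/-- The error of a conditional expectation is orthogonal to every square integrable function of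
the observation. -/
lemma integral_inner_condExp_sub_eq_zero [IsFiniteMeasure P] (hm : m ≤ m₀) {Z g : Ω → ℂ} (hZ : MemLp Z 2 P) (hg : MemLp g 2 P)
    (hgm : StronglyMeasurable[m] g) :
    ∫ ω, ⟪Z ω - (P[Z | m]) ω, g ω⟫_ℝ ∂P = 0 := by
  have h1 : Integrable Z P := hZ.integrable (by norm_num)
  have hc : MemLp (P[Z | m]) 2 P := hZ.condExp (by norm_num)
  have h2 := condExp_bilin_of_stronglyMeasurable_right (innerSL ℝ : ℂ →L[ℝ] ℂ →L[ℝ] ℝ) hgm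
    (integrable_inner_of_memLp_two hZ hg) h1
  have h3 := integral_condExp (μ := P) (f := fun ω => innerSL ℝ (Z ω) (g ω)) hm
  rw [integral_congr_ae h2] at h3
  change ∫ ω, ⟪(P[Z | m]) ω, g ω⟫_ℝ ∂P = ∫ ω, ⟪Z ω, g ω⟫_ℝ ∂P at h3
  simp_rw [inner_sub_left]
  rw [integral_sub (integrable_inner_of_memLp_two hZ hg) (integrable_inner_of_memLp_two hc hg), h3,
    sub_self]

/-- The conditional expectation minimises the mean square error. -/
lemma integral_norm_sub_condExp_sq_le [IsFiniteMeasure P] (hm : m ≤ m₀) {Z g : Ω → ℂ} (hZ : MemLp Z 2 P) (hg : MemLp g 2 P)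
    (hgm : StronglyMeasurable[m] g) :
    ∫ ω, ‖Z ω - (P[Z | m]) ω‖ ^ 2 ∂P ≤ ∫ ω, ‖Z ω - g ω‖ ^ 2 ∂P := by
  have hc : MemLp (P[Z | m]) 2 P := hZ.condExp (by norm_num)
  have horth := integral_inner_condExp_sub_eq_zero hm hZ (hc.sub hg)
    (stronglyMeasurable_condExp.sub hgm)
  have i1 : Integrable (fun ω => ‖Z ω - (P[Z | m]) ω‖ ^ 2) P :=
    integrable_norm_sq_of_memLp_two (hZ.sub hc)
  have i2 := integrable_norm_sq_of_memLp_two (hc.sub hg)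
  have i3 : Integrable (fun ω => ⟪Z ω - (P[Z | m]) ω, (P[Z | m] - g) ω⟫_ℝ) P :=
    integrable_inner_of_memLp_two (hZ.sub hc) (hc.sub hg)
  have i4 : Integrable (fun ω => ‖Z ω - (P[Z | m]) ω‖ ^ 2 +
      2 * ⟪Z ω - (P[Z | m]) ω, (P[Z | m] - g) ω⟫_ℝ) P := i1.add (i3.const_mul 2)
  have e : ∀ ω, ‖Z ω - g ω‖ ^ 2 = ‖Z ω - (P[Z | m]) ω‖ ^ 2 +
      2 * ⟪Z ω - (P[Z | m]) ω, (P[Z | m] - g) ω⟫_ℝ + ‖(P[Z | m] - g) ω‖ ^ 2 := fun ω => by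
    rw [← norm_add_sq_real]; simp
  simp_rw [e]
  rw [integral_add i4 i2, integral_add i1 (i3.const_mul 2),
    integral_const_mul, horth]
  have : 0 ≤ ∫ ω, ‖(P[Z | m] - g) ω‖ ^ 2 ∂P := integral_nonneg fun ω => by positivity
  linarith

/-- A Cauchy-Schwarz lower bound on the mean square error, for a score `V` orthogonal to the
conditional expectation. -/
lemma le_integral_norm_sub_condExp_sq [IsFiniteMeasure P] {Z V : Ω → ℂ} (hZ : MemLp Z 2 P) (hV : MemLp V 2 P)
    (horth : ∫ ω, ⟪(P[Z | m]) ω, V ω⟫_ℝ ∂P = 0) :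
    ∫ ω, (2 * ⟪Z ω, V ω⟫_ℝ - ‖V ω‖ ^ 2) ∂P ≤ ∫ ω, ‖Z ω - (P[Z | m]) ω‖ ^ 2 ∂P := by
  have hc : MemLp (P[Z | m]) 2 P := hZ.condExp (by norm_num)
  have i1 := integrable_norm_sq_of_memLp_two (hZ.sub hc)
  have i2 := integrable_norm_sq_of_memLp_two hV
  have i3 := integrable_inner_of_memLp_two hZ hV
  have i4 := integrable_inner_of_memLp_two hc hV
  have i5 : Integrable (fun ω => 2 * ⟪Z ω, V ω⟫_ℝ - ‖V ω‖ ^ 2) P := (i3.const_mul 2).sub i2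
  have h1 : ∫ ω, (2 * ⟪Z ω, V ω⟫_ℝ - ‖V ω‖ ^ 2) ∂P =
      ∫ ω, ((2 * ⟪Z ω, V ω⟫_ℝ - ‖V ω‖ ^ 2) - 2 * ⟪(P[Z | m]) ω, V ω⟫_ℝ) ∂P := by
    rw [integral_sub i5 (i4.const_mul 2), integral_const_mul, horth]
    simp
  rw [h1]
  refine integral_mono (i5.sub (i4.const_mul 2)) i1 fun ω => ?_
  have h := norm_sub_sq_real (Z ω - (P[Z | m]) ω) (V ω)
  rw [inner_sub_left] at h
  have h0 : 0 ≤ ‖Z ω - (P[Z | m]) ω - V ω‖ ^ 2 := by positivity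
  simp only
  simp only [Pi.sub_apply] at *
  linarith

end Projection

/-! ### Transfer of both bounds to the product law of gain, input and noise. -/

section Reduction

variable {Ω : Type*} [MeasurableSpace Ω] {P : Measure Ω} {X H N : Ω → ℂ} {c : ℂ} {σ : ℝ}

lemma avgMMSE_eq [IsProbabilityMeasure P] (hH : Measurable H) (s : ℝ) :
    avgMMSE P X H N s = ∫ ω, ‖H ω * X ω - estimate P X H N s ω‖ ^ 2 ∂P :=
  integral_condExp hH.comap_le

lemma IsRayleighRiceChannel.measurable_output (h : IsRayleighRiceChannel P X H N c σ) (s : ℝ) :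
    Measurable (output X H N s) :=
  ((h.measurable_gain.const_mul _).mul h.measurable_input).add h.measurable_noise

lemma IsRayleighRiceChannel.map_triple [IsProbabilityMeasure P] (h : IsRayleighRiceChannel P X H N c σ) :
    P.map (fun ω => (H ω, X ω, N ω)) =
      (complexNormal c (2 * σ ^ 2)).prod ((P.map X).prod (complexNormal 0 1)) := by
  have hm : ∀ i, Measurable (![X, H, N] i) := by
    intro i
    fin_cases i
    exacts [h.measurable_input, h.measurable_gain, h.measurable_noise]
  have h1 : IndepFun (fun ω => (X ω, N ω)) H P :=
    h.indep.indepFun_prodMk hm 0 2 1 (by decide) (by decide)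
  have h2 : IndepFun X N P := h.indep.indepFun (i := 0) (j := 2) (by decide)
  rw [(indepFun_iff_map_prod_eq_prod_map_map h.measurable_gain.aemeasurable
    (h.measurable_input.prodMk h.measurable_noise).aemeasurable).1 h1.symm,
    (indepFun_iff_map_prod_eq_prod_map_map h.measurable_input.aemeasurable
      h.measurable_noise.aemeasurable).1 h2, h.law_gain, h.law_noise]

lemma IsRayleighRiceChannel.measurable_triple (h : IsRayleighRiceChannel P X H N c σ) :
    Measurable (fun ω => (H ω, X ω, N ω)) :=
  h.measurable_gain.prodMk (h.measurable_input.prodMk h.measurable_noise)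

/-- The joint law of gain, input and noise. -/
noncomputable def channelLaw (μX : Measure ℂ) (c : ℂ) (σ : ℝ) : Measure (ℂ × ℂ × ℂ) :=
  (complexNormal c (2 * σ ^ 2)).prod (μX.prod (complexNormal 0 1))

lemma IsRayleighRiceChannel.integral_comp [IsProbabilityMeasure P] (h : IsRayleighRiceChannel P X H N c σ)
    {E : Type*} [NormedAddCommGroup E] [NormedSpace ℝ E] {F : ℂ × ℂ × ℂ → E}
    (hF : StronglyMeasurable F) :
    ∫ ω, F (H ω, X ω, N ω) ∂P = ∫ p, F p ∂(channelLaw (P.map X) c σ) := by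
  rw [channelLaw, ← h.map_triple, integral_map h.measurable_triple.aemeasurable
    hF.aestronglyMeasurable]

lemma IsRayleighRiceChannel.memLp_comp [IsProbabilityMeasure P] (h : IsRayleighRiceChannel P X H N c σ)
    {F : ℂ × ℂ × ℂ → ℂ} (hF : Measurable F) :
    MemLp (fun ω => F (H ω, X ω, N ω)) 2 P ↔ MemLp F 2 (channelLaw (P.map X) c σ) := by
  rw [channelLaw, ← h.map_triple, memLp_map_measure_iff hF.aestronglyMeasurable
    h.measurable_triple.aemeasurable]
  rfl

/-- Every estimator `f (y, h)` bounds the average MMSE from above. -/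
lemma IsRayleighRiceChannel.avgMMSE_le [IsProbabilityMeasure P] (h : IsRayleighRiceChannel P X H N c σ) (s : ℝ)
    (hZ : MemLp (fun p : ℂ × ℂ × ℂ => p.1 * p.2.1) 2 (channelLaw (P.map X) c σ))
    {f : ℂ × ℂ → ℂ} (hf : Measurable f)
    (hf2 : MemLp (fun p : ℂ × ℂ × ℂ => p.1 * p.2.1 - f ((√s : ℂ) * p.1 * p.2.1 + p.2.2, p.1)) 2
      (channelLaw (P.map X) c σ)) :
    avgMMSE P X H N s ≤
      ∫ p, ‖p.1 * p.2.1 - f ((√s : ℂ) * p.1 * p.2.1 + p.2.2, p.1)‖ ^ 2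
        ∂(channelLaw (P.map X) c σ) := by
  have hZ' := (h.memLp_comp (by fun_prop)).2 hZ
  have hE' := (h.memLp_comp (by fun_prop)).2 hf2
  have hf' : MemLp (fun ω => f (output X H N s ω, H ω)) 2 P := by
    convert hZ'.sub hE' using 1
    ext ω
    simp [output]
  have hmeas : Measurable (fun ω => (output X H N s ω, H ω)) :=
    (h.measurable_output s).prodMk h.measurable_gain
  have hb := integral_norm_sub_condExp_sq_le hmeas.comap_le hZ' hf'
    (hf.comp (comap_measurable _)).stronglyMeasurable
  rw [avgMMSE_eq h.measurable_gain]
  refine hb.trans_eq ?_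
  rw [← h.integral_comp (by fun_prop)]
  rfl

/-- Every score `V (h, x, n)` orthogonal to all functions of `(y, h)` bounds the average MMSE from
below. -/
lemma IsRayleighRiceChannel.le_avgMMSE [IsProbabilityMeasure P] (h : IsRayleighRiceChannel P X H N c σ) (s : ℝ)
    (hZ : MemLp (fun p : ℂ × ℂ × ℂ => p.1 * p.2.1) 2 (channelLaw (P.map X) c σ))
    {V : ℂ × ℂ × ℂ → ℂ} (hV : Measurable V) (hV2 : MemLp V 2 (channelLaw (P.map X) c σ))
    (horth : ∀ f : ℂ × ℂ → ℂ, Measurable f →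
      Integrable (fun p : ℂ × ℂ × ℂ => ⟪f ((√s : ℂ) * p.1 * p.2.1 + p.2.2, p.1), V p⟫_ℝ)
        (channelLaw (P.map X) c σ) →
      ∫ p, ⟪f ((√s : ℂ) * p.1 * p.2.1 + p.2.2, p.1), V p⟫_ℝ ∂(channelLaw (P.map X) c σ) = 0) :
    ∫ p, (2 * ⟪p.1 * p.2.1, V p⟫_ℝ - ‖V p‖ ^ 2) ∂(channelLaw (P.map X) c σ) ≤
      avgMMSE P X H N s := by
  have hZ' := (h.memLp_comp (by fun_prop)).2 hZ
  have hV' := (h.memLp_comp hV).2 hV2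
  have hc : MemLp (estimate P X H N s) 2 P := hZ'.condExp (by norm_num)
  have hcm : Measurable[MeasurableSpace.comap (fun ω => (output X H N s ω, H ω)) inferInstance]
    (estimate P X H N s) := stronglyMeasurable_condExp.measurable
  -- Doob-Dynkin: the estimate is a measurable function of (y, h), so orthogonality to such
  -- functions is all that V needs.
  obtain ⟨f, hf, hfe⟩ := hcm.exists_eq_measurable_comp
  have hfm : Measurable fun p : ℂ × ℂ × ℂ =>
      ⟪f ((√s : ℂ) * p.1 * p.2.1 + p.2.2, p.1), V p⟫_ℝ :=
    (hf.comp (by fun_prop)).inner hV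
  have hint := integrable_inner_of_memLp_two hc hV'
  have hint' : Integrable (fun p : ℂ × ℂ × ℂ =>
      ⟪f ((√s : ℂ) * p.1 * p.2.1 + p.2.2, p.1), V p⟫_ℝ) (channelLaw (P.map X) c σ) := by
    rw [channelLaw, ← h.map_triple, integrable_map_measure hfm.aestronglyMeasurable
      h.measurable_triple.aemeasurable]
    rw [hfe] at hint
    exact hint
  have h0 := horth f hf hint'
  rw [← h.integral_comp hfm.stronglyMeasurable] at h0
  rw [avgMMSE_eq h.measurable_gain]
  have hb := le_integral_norm_sub_condExp_sq
    (m := MeasurableSpace.comap (fun ω => (output X H N s ω, H ω)) inferInstance) hZ' hV' (by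
      rw [← h0]
      change ∫ ω, ⟪estimate P X H N s ω, _⟫_ℝ ∂P = _
      rw [hfe]
      rfl)
  refine le_trans (le_of_eq ?_) hb
  rw [← h.integral_comp]
  refine Measurable.stronglyMeasurable ?_
  exact (((by fun_prop : Measurable fun p : ℂ × ℂ × ℂ => p.1 * p.2.1).inner hV).const_mul 2).sub
    (hV.norm.pow_const 2)

end Reduction

/-! ### Moments, symmetry and density of complex Gaussian laws. -/

section ComplexNormal

instance (c : ℂ) (w : ℝ) : IsProbabilityMeasure (complexNormal c w) :=
  Measure.isProbabilityMeasure_map (MeasurableEquiv.measurable _).aemeasurable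

lemma integral_complexNormal {E : Type*} [NormedAddCommGroup E] [NormedSpace ℝ E] (c : ℂ) (w : ℝ)
    (F : ℂ → E) :
    ∫ z, F z ∂(complexNormal c w) = ∫ p : ℝ × ℝ, F (p.1 + p.2 * Complex.I)
      ∂((gaussianReal c.re (w / 2).toNNReal).prod (gaussianReal c.im (w / 2).toNNReal)) := by
  rw [complexNormal, integral_map_equiv]
  congr 1
  ext p
  congr 1
  apply Complex.ext <;> simp [Complex.measurableEquivRealProd]

lemma map_re_complexNormal (c : ℂ) (w : ℝ) :
    (complexNormal c w).map Complex.re = gaussianReal c.re (w / 2).toNNReal := by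
  rw [complexNormal, Measure.map_map Complex.measurable_re (MeasurableEquiv.measurable _)]
  exact Measure.fst_prod

lemma map_im_complexNormal (c : ℂ) (w : ℝ) :
    (complexNormal c w).map Complex.im = gaussianReal c.im (w / 2).toNNReal := by
  rw [complexNormal, Measure.map_map Complex.measurable_im (MeasurableEquiv.measurable _)]
  exact Measure.snd_prod

lemma memLp_re_complexNormal (c : ℂ) (w : ℝ) {p : ENNReal} (hp : p ≠ ⊤) :
    MemLp Complex.re p (complexNormal c w) := by
  have h := memLp_id_gaussianReal' (μ := c.re) (v := (w / 2).toNNReal) p hp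
  rw [← map_re_complexNormal, memLp_map_measure_iff (by fun_prop) (by fun_prop)] at h
  exact h

lemma memLp_im_complexNormal (c : ℂ) (w : ℝ) {p : ENNReal} (hp : p ≠ ⊤) :
    MemLp Complex.im p (complexNormal c w) := by
  have h := memLp_id_gaussianReal' (μ := c.im) (v := (w / 2).toNNReal) p hp
  rw [← map_im_complexNormal, memLp_map_measure_iff (by fun_prop) (by fun_prop)] at h
  exact h

lemma memLp_id_complexNormal (c : ℂ) (w : ℝ) {p : ENNReal} (hp : p ≠ ⊤) :
    MemLp (fun z : ℂ => z) p (complexNormal c w) := by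
  refine MemLp.of_le ((memLp_re_complexNormal c w hp).norm.add (memLp_im_complexNormal c w hp).norm)
    (by fun_prop) (ae_of_all _ fun z => ?_)
  simpa [abs_of_nonneg (add_nonneg (abs_nonneg z.re) (abs_nonneg z.im))] using
    Complex.norm_le_abs_re_add_abs_im z

lemma integrable_norm_pow_complexNormal (c : ℂ) (w : ℝ) (k : ℕ) :
    Integrable (fun z : ℂ => ‖z‖ ^ k) (complexNormal c w) :=
  (memLp_id_complexNormal c w (ENNReal.natCast_ne_top k)).integrable_norm_pow'

lemma integral_re_complexNormal (c : ℂ) (w : ℝ) : ∫ z, z.re ∂(complexNormal c w) = c.re := by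
  have h := integral_id_gaussianReal (μ := c.re) (v := (w / 2).toNNReal)
  rw [← map_re_complexNormal, integral_map (by fun_prop) (by fun_prop)] at h
  exact h

lemma integral_im_complexNormal (c : ℂ) (w : ℝ) : ∫ z, z.im ∂(complexNormal c w) = c.im := by
  have h := integral_id_gaussianReal (μ := c.im) (v := (w / 2).toNNReal)
  rw [← map_im_complexNormal, integral_map (by fun_prop) (by fun_prop)] at h
  exact h

lemma integral_sq_gaussianReal_zero (v : NNReal) : ∫ x, x ^ 2 ∂(gaussianReal 0 v) = v := by
  rw [← variance_id_gaussianReal (μ := 0) (v := v), variance_of_integral_eq_zero]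
  · rfl
  · fun_prop
  · exact integral_id_gaussianReal

lemma integral_re_sq_complexNormal {w : ℝ} (hw : 0 ≤ w) :
    ∫ z, z.re ^ 2 ∂(complexNormal 0 w) = w / 2 := by
  have h := integral_sq_gaussianReal_zero (w / 2).toNNReal
  rw [Real.coe_toNNReal _ (by positivity)] at h
  rw [← h, ← Complex.zero_re, ← map_re_complexNormal, integral_map (by fun_prop) (by fun_prop)]

lemma integral_im_sq_complexNormal {w : ℝ} (hw : 0 ≤ w) :
    ∫ z, z.im ^ 2 ∂(complexNormal 0 w) = w / 2 := by
  have h := integral_sq_gaussianReal_zero (w / 2).toNNReal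
  rw [Real.coe_toNNReal _ (by positivity)] at h
  rw [← h, ← Complex.zero_im, ← map_im_complexNormal, integral_map (by fun_prop) (by fun_prop)]

lemma integral_re_mul_im_complexNormal (c : ℂ) (w : ℝ) :
    ∫ z, z.re * z.im ∂(complexNormal c w) = c.re * c.im := by
  rw [integral_complexNormal]
  simp only [Complex.add_re, Complex.ofReal_re, Complex.mul_re, Complex.I_re, mul_zero,
    Complex.ofReal_im, Complex.I_im, mul_one, sub_self, add_zero, Complex.add_im, Complex.mul_im,
    zero_add]
  rw [integral_prod_mul (fun x : ℝ => x) (fun y : ℝ => y)]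
  rw [integral_id_gaussianReal, integral_id_gaussianReal]

lemma integrable_re_sq_complexNormal (c : ℂ) (w : ℝ) :
    Integrable (fun z : ℂ => z.re ^ 2) (complexNormal c w) :=
  (memLp_re_complexNormal c w (by norm_num)).integrable_sq

lemma integrable_im_sq_complexNormal (c : ℂ) (w : ℝ) :
    Integrable (fun z : ℂ => z.im ^ 2) (complexNormal c w) :=
  (memLp_im_complexNormal c w (by norm_num)).integrable_sq

lemma integrable_re_mul_im_complexNormal (c : ℂ) (w : ℝ) :
    Integrable (fun z : ℂ => z.re * z.im) (complexNormal c w) :=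
  (memLp_re_complexNormal c w (p := 2) (by norm_num)).integrable_mul
    (memLp_im_complexNormal c w (p := 2) (by norm_num))

lemma integral_norm_sq_complexNormal {w : ℝ} (hw : 0 ≤ w) :
    ∫ z, ‖z‖ ^ 2 ∂(complexNormal 0 w) = w := by
  simp_rw [← Complex.normSq_eq_norm_sq, Complex.normSq_apply, ← sq]
  rw [integral_add (integrable_re_sq_complexNormal 0 w) (integrable_im_sq_complexNormal 0 w),
    integral_re_sq_complexNormal hw, integral_im_sq_complexNormal hw]
  ring

lemma integral_id_complexNormal (c : ℂ) (w : ℝ) : ∫ z, z ∂(complexNormal c w) = c := by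
  have hi : Integrable (fun z : ℂ => z) (complexNormal c w) :=
    (memLp_id_complexNormal c w (p := 1) ENNReal.one_ne_top).integrable le_rfl
  apply Complex.ext
  · rw [← integral_re_complexNormal c w]
    exact (Complex.reCLM.integral_comp_comm hi).symm
  · rw [← integral_im_complexNormal c w]
    exact (Complex.imCLM.integral_comp_comm hi).symm

lemma integrable_sq_complexNormal (c : ℂ) (w : ℝ) :
    Integrable (fun z : ℂ => z ^ 2) (complexNormal c w) :=
  (integrable_norm_pow_complexNormal c w 2).mono (by fun_prop) (ae_of_all _ fun z => by simp)

lemma integral_sq_complexNormal {w : ℝ} (hw : 0 ≤ w) : ∫ z, z ^ 2 ∂(complexNormal 0 w) = 0 := by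
  have hi := integrable_sq_complexNormal 0 w
  apply Complex.ext
  · have h : ∫ z : ℂ, (z ^ 2).re ∂(complexNormal 0 w) = 0 := by
      simp_rw [sq, Complex.mul_re, ← sq]
      rw [integral_sub (integrable_re_sq_complexNormal 0 w) (integrable_im_sq_complexNormal 0 w),
        integral_re_sq_complexNormal hw, integral_im_sq_complexNormal hw, sub_self]
    rw [Complex.zero_re, ← h]
    exact (Complex.reCLM.integral_comp_comm hi).symm
  · have h : ∫ z : ℂ, (z ^ 2).im ∂(complexNormal 0 w) = 0 := by
      have e : ∀ z : ℂ, (z ^ 2).im = 2 * (z.re * z.im) := fun z => by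
        rw [sq, Complex.mul_im]; ring
      simp_rw [e]
      rw [integral_const_mul, integral_re_mul_im_complexNormal]
      simp
    rw [Complex.zero_im, ← h]
    exact (Complex.imCLM.integral_comp_comm hi).symm

/-- Integrals of odd functions against a centred complex Gaussian law vanish. -/
lemma integral_odd_complexNormal {w : ℝ} {F : ℂ → ℝ} (hF : ∀ z, F (-z) = -F z) :
    ∫ z, F z ∂(complexNormal 0 w) = 0 := by
  have hmap : (complexNormal 0 w).map (MeasurableEquiv.neg ℂ) = complexNormal 0 w := by
    rw [complexNormal, Measure.map_map (MeasurableEquiv.measurable _) (MeasurableEquiv.measurable _)]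
    have : (MeasurableEquiv.neg ℂ) ∘ Complex.measurableEquivRealProd.symm =
        Complex.measurableEquivRealProd.symm ∘ Prod.map (fun x : ℝ => -x) (fun x : ℝ => -x) := by
      ext p
      apply Complex.ext <;> simp [Complex.measurableEquivRealProd, MeasurableEquiv.neg]
    rw [this, ← Measure.map_map (MeasurableEquiv.measurable _) (by fun_prop),
      ← Measure.map_prod_map _ _ (by fun_prop) (by fun_prop), gaussianReal_map_neg,
      gaussianReal_map_neg]
    simp
  have h : ∫ z, F z ∂(complexNormal 0 w) = ∫ z, F (-z) ∂(complexNormal 0 w) := by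
    conv_lhs => rw [← hmap]
    rw [integral_map_equiv]
    rfl
  simp_rw [hF, integral_neg] at h
  linarith

/-- Supplies the weight exp(-|y - αx|²) of the posterior law of x given y at gain α; all
orthogonality relations are phrased with this kernel. -/
lemma complexNormal_zero_one :
    complexNormal 0 1 = (volume : Measure ℂ).withDensity
      (fun n => ENNReal.ofReal (Real.pi⁻¹ * Real.exp (-‖n‖ ^ 2))) := by
  have hv : ((1 : ℝ) / 2).toNNReal ≠ 0 := by simp
  rw [complexNormal, gaussianReal_of_var_ne_zero _ hv, gaussianReal_of_var_ne_zero _ hv,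
    prod_withDensity (measurable_gaussianPDF _ _) (measurable_gaussianPDF _ _)]
  ext A hA
  rw [Measure.map_apply (MeasurableEquiv.measurable _) hA, withDensity_apply _ hA,
    withDensity_apply _ (Complex.measurableEquivRealProd.symm.measurable hA),
    ← Complex.volume_preserving_equiv_real_prod.symm.setLIntegral_comp_preimage_emb
      (MeasurableEquiv.measurableEmbedding _)]
  refine lintegral_congr fun p => ?_
  rw [gaussianPDF_def, gaussianPDF_def]
  simp only
  rw [← ENNReal.ofReal_mul (gaussianPDFReal_nonneg _ _ _)]
  congr 1
  simp only [gaussianPDFReal, Complex.zero_re, Complex.zero_im, sub_zero,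
    Real.coe_toNNReal _ (by norm_num : (0 : ℝ) ≤ 1 / 2), mul_one_div_cancel (two_ne_zero' ℝ),
    ← Complex.normSq_eq_norm_sq, Complex.normSq_apply]
  have hpi : √(2 * Real.pi * (1 / 2)) = √Real.pi := by congr 1; ring
  rw [hpi]
  have : Real.pi⁻¹ = (√Real.pi)⁻¹ * (√Real.pi)⁻¹ := by
    rw [← mul_inv, Real.mul_self_sqrt Real.pi_pos.le]
  rw [this, mul_mul_mul_comm, ← Real.exp_add]
  congr 2
  simp [Complex.measurableEquivRealProd]
  ring

end ComplexNormal

/-! ### Scores with vanishing posterior mean are orthogonal to functions of the observation. -/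

section Orthogonality

/-- For fixed gain, a score whose posterior average vanishes is orthogonal to every function of
the channel output. -/
lemma integral_inner_prod_complexNormal_eq_zero (μX : Measure ℂ) [IsProbabilityMeasure μX] (α : ℂ)
    {φ : ℂ → ℂ} (hφ : Measurable φ) {V : ℂ × ℂ → ℂ} (hV : Measurable V)
    (hVi : ∀ y, Integrable (fun x => Real.exp (-‖y - α * x‖ ^ 2) • V (x, y - α * x)) μX)
    (hV0 : ∀ y, ∫ x, Real.exp (-‖y - α * x‖ ^ 2) • V (x, y - α * x) ∂μX = 0) :
    ∫ p, ⟪φ (α * p.1 + p.2), V p⟫_ℝ ∂(μX.prod (complexNormal 0 1)) = 0 := by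
  by_cases hint : Integrable (fun p : ℂ × ℂ => ⟪φ (α * p.1 + p.2), V p⟫_ℝ)
      (μX.prod (complexNormal 0 1))
  swap
  · exact integral_undef hint
  have hmeas : Measurable (fun p : ℂ × ℂ => ENNReal.ofReal (Real.pi⁻¹ * Real.exp (-‖p.2‖ ^ 2))) := by
    fun_prop
  have hlaw : μX.prod (complexNormal 0 1) = (μX.prod (volume : Measure ℂ)).withDensity
      (fun p => ENNReal.ofReal (Real.pi⁻¹ * Real.exp (-‖p.2‖ ^ 2))) := by
    rw [complexNormal_zero_one]
    exact prod_withDensity_right (by fun_prop)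
  have hpos : ∀ p : ℂ × ℂ, 0 ≤ Real.pi⁻¹ * Real.exp (-‖p.2‖ ^ 2) := fun p => by positivity
  -- The change of variables from noise n to output y = αx + n. Afterwards φ(y) does not depend on x
  -- and leaves the inner integral over x.
  have hshear : MeasurePreserving (fun p : ℂ × ℂ => (p.1, p.2 - α * p.1))
      (μX.prod volume) (μX.prod volume) :=
    (MeasurePreserving.id μX).skew_product (g := fun x y => y - α * x) (by fun_prop)
      (ae_of_all _ fun x => (measurePreserving_sub_right volume (α * x)).map_eq)
  have hFm : Measurable fun p : ℂ × ℂ =>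
      (Real.pi⁻¹ * Real.exp (-‖p.2‖ ^ 2)) • ⟪φ (α * p.1 + p.2), V p⟫_ℝ :=
    (by fun_prop : Measurable fun p : ℂ × ℂ => Real.pi⁻¹ * Real.exp (-‖p.2‖ ^ 2)).smul
      ((hφ.comp (by fun_prop)).inner hV)
  rw [hlaw, integrable_withDensity_iff_integrable_smul' hmeas (by simp)] at hint
  simp only [ENNReal.toReal_ofReal (hpos _)] at hint
  rw [hlaw, integral_withDensity_eq_integral_toReal_smul hmeas (by simp)]
  simp only [ENNReal.toReal_ofReal (hpos _)]
  have hint2 := hint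
  rw [← hshear.map_eq, integrable_map_measure hFm.aestronglyMeasurable
    hshear.measurable.aemeasurable] at hint2
  rw [← hshear.map_eq, integral_map hshear.measurable.aemeasurable hFm.aestronglyMeasurable]
  refine (integral_prod_symm _ hint2).trans ?_
  simp only [Function.comp_apply, add_sub_cancel]
  refine (integral_congr_ae (ae_of_all _ fun y => ?_)).trans (integral_zero' _ _)
  have e : ∀ x, (Real.pi⁻¹ * Real.exp (-‖y - α * x‖ ^ 2)) • ⟪φ y, V (x, y - α * x)⟫_ℝ =
      Real.pi⁻¹ * ⟪φ y, Real.exp (-‖y - α * x‖ ^ 2) • V (x, y - α * x)⟫_ℝ := fun x => by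
    rw [real_inner_smul_right, smul_eq_mul, mul_assoc]
  simp only [e, Pi.zero_apply]
  rw [integral_const_mul, integral_inner (hVi y), hV0 y, inner_zero_right, mul_zero]

/-- The receiver knows h, so Fubini reduces the claim to each fixed gain, with α = √s h. -/
lemma integral_inner_channelLaw_eq_zero (μX : Measure ℂ) [IsProbabilityMeasure μX] (c : ℂ) (σ s : ℝ)
    {V : ℂ × ℂ × ℂ → ℂ} (hV : Measurable V)
    (hVi : ∀ h y, Integrable (fun x => Real.exp (-‖y - (√s : ℂ) * h * x‖ ^ 2) •
      V (h, x, y - (√s : ℂ) * h * x)) μX)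
    (hV0 : ∀ h y, ∫ x, Real.exp (-‖y - (√s : ℂ) * h * x‖ ^ 2) •
      V (h, x, y - (√s : ℂ) * h * x) ∂μX = 0)
    (f : ℂ × ℂ → ℂ) (hf : Measurable f)
    (hint : Integrable (fun p : ℂ × ℂ × ℂ => ⟪f ((√s : ℂ) * p.1 * p.2.1 + p.2.2, p.1), V p⟫_ℝ)
        (channelLaw μX c σ)) :
    ∫ p, ⟪f ((√s : ℂ) * p.1 * p.2.1 + p.2.2, p.1), V p⟫_ℝ ∂(channelLaw μX c σ) = 0 := by
  rw [channelLaw] at hint ⊢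
  rw [integral_prod _ hint]
  refine (integral_congr_ae (ae_of_all _ fun h => ?_)).trans (integral_zero' _ _)
  exact integral_inner_prod_complexNormal_eq_zero μX ((√s : ℂ) * h)
    (φ := fun y => f (y, h)) (hf.comp (by fun_prop)) (V := fun q => V (h, q.1, q.2))
    (hV.comp (by fun_prop)) (hVi h) (hV0 h)

end Orthogonality

/-! ### The Bayesian Cramér-Rao bound for scores that are real-affine in the noise. -/

section Score

lemma memLp_two_mul_prod {α β : Type*} [MeasurableSpace α] [MeasurableSpace β] {μ : Measure α}
    {ν : Measure β} [SFinite μ] [SFinite ν] {F : α → ℂ} {G : β → ℂ} (hF : MemLp F 2 μ)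
    (hG : MemLp G 2 ν) : MemLp (fun p : α × β => F p.1 * G p.2) 2 (μ.prod ν) := by
  refine (memLp_two_iff_integrable_sq_norm (hF.1.comp_fst.mul hG.1.comp_snd)).2 ?_
  refine ((integrable_norm_sq_of_memLp_two hF).mul_prod
    (integrable_norm_sq_of_memLp_two hG)).congr (ae_of_all _ fun p => ?_)
  simp [mul_pow]

lemma memLp_two_channelLaw {μX : Measure ℂ} [IsProbabilityMeasure μX] (c : ℂ) (σ : ℝ)
    {F G K : ℂ → ℂ} (hF : MemLp F 2 (complexNormal c (2 * σ ^ 2))) (hG : MemLp G 2 μX)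
    (hK : MemLp K 2 (complexNormal 0 1)) :
    MemLp (fun p : ℂ × ℂ × ℂ => F p.1 * (G p.2.1 * K p.2.2)) 2 (channelLaw μX c σ) :=
  memLp_two_mul_prod hF (memLp_two_mul_prod hG hK)

lemma memLp_two_gain_mul_input {μX : Measure ℂ} [IsProbabilityMeasure μX] (c : ℂ) (σ : ℝ)
    (hX : MemLp (fun x : ℂ => x) 2 μX) :
    MemLp (fun p : ℂ × ℂ × ℂ => p.1 * p.2.1) 2 (channelLaw μX c σ) := by
  have h := memLp_two_channelLaw c σ (memLp_id_complexNormal c (2 * σ ^ 2) (by norm_num)) hX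
    (memLp_const (1 : ℂ))
  simpa using h

/-- The quadratic form `2 ⟪h x, V⟫ - ‖V‖²`, averaged over input and noise at a fixed gain. -/
lemma integral_score_fixed_gain {μX : Measure ℂ} [IsProbabilityMeasure μX] {a p q : ℂ → ℂ}
    (hX : MemLp (fun x : ℂ => x) 2 μX) (ha : MemLp a 2 μX) (hp : MemLp p 2 μX) (hq : MemLp q 2 μX)
    (l : ℝ) (h α : ℂ) :
    ∫ z, (2 * ⟪h * z.1, l * h * (a z.1 + p z.1 * conj z.2 * α + q z.1 * z.2 * conj α)⟫_ℝ -
      ‖l * h * (a z.1 + p z.1 * conj z.2 * α + q z.1 * z.2 * conj α)‖ ^ 2)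
        ∂(μX.prod (complexNormal 0 1)) =
      ‖h‖ ^ 2 * (2 * l * ∫ x, ⟪x, a x⟫_ℝ ∂μX - l ^ 2 * (∫ x, ‖a x‖ ^ 2 ∂μX +
        ‖α‖ ^ 2 * ∫ x, (‖p x‖ ^ 2 + ‖q x‖ ^ 2) ∂μX)) := by
  set γ := complexNormal 0 1
  have hn : Integrable (fun n : ℂ => n) γ :=
    (memLp_id_complexNormal 0 1 (p := 1) ENNReal.one_ne_top).integrable le_rfl
  have hn2 := integrable_sq_complexNormal 0 1
  have hnn := integrable_norm_pow_complexNormal 0 1 2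
  -- Independence kills every cross term of the expanded quadratic form, because the means of n, of
  -- its conjugate and of n² all vanish for circular noise.
  have zero : ∀ {F G : ℂ → ℂ}, Integrable F μX → Integrable G γ → ∫ n, G n ∂γ = 0 →
      Integrable (fun z : ℂ × ℂ => (F z.1 * G z.2).re) (μX.prod γ) ∧
        ∫ z, (F z.1 * G z.2).re ∂(μX.prod γ) = 0 := fun {F G} hF hG h0 => by
    have hi := hF.mul_prod hG
    refine ⟨hi.re, ?_⟩
    rw [← Complex.zero_re, ← mul_zero (∫ x, F x ∂μX), ← h0, ← integral_prod_mul]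
    exact Complex.reCLM.integral_comp_comm hi
  have mul2 : ∀ {f g : ℂ → ℂ}, MemLp f 2 μX → MemLp g 2 μX →
      Integrable (fun x => conj (f x) * g x) μX := fun hf hg => by
    refine (hf.star).integrable_mul hg
  have i0 : ∫ n, n ∂γ = 0 := integral_id_complexNormal 0 1
  have i0' : ∫ n, conj n ∂γ = 0 := by
    rw [integral_conj, i0, map_zero]
  have i02 : ∫ n, n ^ 2 ∂γ = 0 := integral_sq_complexNormal zero_le_one
  have hnc : Integrable (fun n : ℂ => conj n) γ :=
    (memLp_one_iff_integrable.2 hn).star.integrable le_rfl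
  obtain ⟨j1, e1⟩ := zero ((mul2 hX hp).mul_const α) hnc i0'
  obtain ⟨j2, e2⟩ := zero ((mul2 hX hq).mul_const (conj α)) hn i0
  obtain ⟨j3, e3⟩ := zero ((mul2 ha hp).mul_const α) hnc i0'
  obtain ⟨j4, e4⟩ := zero ((mul2 ha hq).mul_const (conj α)) hn i0
  obtain ⟨j5, e5⟩ := zero ((mul2 hp hq).mul_const (conj α ^ 2)) hn2 i02
  have k1 : Integrable (fun z : ℂ × ℂ => ⟪z.1, a z.1⟫_ℝ) (μX.prod γ) :=
    (integrable_inner_of_memLp_two hX ha).comp_fst γ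
  have k2 : Integrable (fun z : ℂ × ℂ => ‖a z.1‖ ^ 2) (μX.prod γ) :=
    (integrable_norm_sq_of_memLp_two ha).comp_fst γ
  have k3' : Integrable (fun x : ℂ => ‖p x‖ ^ 2 + ‖q x‖ ^ 2) μX :=
    (integrable_norm_sq_of_memLp_two hp).add (integrable_norm_sq_of_memLp_two hq)
  have k3 : Integrable (fun z : ℂ × ℂ => (‖p z.1‖ ^ 2 + ‖q z.1‖ ^ 2) * ‖z.2‖ ^ 2) (μX.prod γ) :=
    k3'.mul_prod hnn
  have v1 : ∫ z : ℂ × ℂ, ⟪z.1, a z.1⟫_ℝ ∂(μX.prod γ) = ∫ x, ⟪x, a x⟫_ℝ ∂μX := by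
    rw [integral_fun_fst (fun x => ⟪x, a x⟫_ℝ)]; simp
  have v2 : ∫ z : ℂ × ℂ, ‖a z.1‖ ^ 2 ∂(μX.prod γ) = ∫ x, ‖a x‖ ^ 2 ∂μX := by
    rw [integral_fun_fst (fun x => ‖a x‖ ^ 2)]; simp
  have v3 : ∫ z : ℂ × ℂ, (‖p z.1‖ ^ 2 + ‖q z.1‖ ^ 2) * ‖z.2‖ ^ 2 ∂(μX.prod γ) =
      ∫ x, (‖p x‖ ^ 2 + ‖q x‖ ^ 2) ∂μX := by
    rw [integral_prod_mul (fun x => ‖p x‖ ^ 2 + ‖q x‖ ^ 2) (fun n : ℂ => ‖n‖ ^ 2),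
      integral_norm_sq_complexNormal zero_le_one, mul_one]
  have key : ∀ z : ℂ × ℂ,
      (2 * ⟪h * z.1, l * h * (a z.1 + p z.1 * conj z.2 * α + q z.1 * z.2 * conj α)⟫_ℝ -
      ‖l * h * (a z.1 + p z.1 * conj z.2 * α + q z.1 * z.2 * conj α)‖ ^ 2) =
      ‖h‖ ^ 2 * (2 * l * (⟪z.1, a z.1⟫_ℝ + (conj z.1 * p z.1 * α * conj z.2).re +
        (conj z.1 * q z.1 * conj α * z.2).re) -
        l ^ 2 * (‖a z.1‖ ^ 2 + ‖α‖ ^ 2 * ((‖p z.1‖ ^ 2 + ‖q z.1‖ ^ 2) * ‖z.2‖ ^ 2) +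
          2 * ((conj (a z.1) * p z.1 * α * conj z.2).re + (conj (a z.1) * q z.1 * conj α * z.2).re +
            (conj (p z.1) * q z.1 * conj α ^ 2 * z.2 ^ 2).re))) := fun z => by
    simp only [← Complex.normSq_eq_norm_sq, Complex.normSq_apply]
    simp only [Complex.inner, sq,
      Complex.mul_re, Complex.mul_im, Complex.add_re, Complex.add_im, Complex.conj_re,
      Complex.conj_im, Complex.ofReal_re, Complex.ofReal_im]
    ring
  simp_rw [key]
  rw [integral_const_mul]
  congr 1
  have I1 : Integrable (fun z : ℂ × ℂ => ⟪z.1, a z.1⟫_ℝ + (conj z.1 * p z.1 * α * conj z.2).re)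
      (μX.prod γ) := k1.add j1
  have I2 : Integrable (fun z : ℂ × ℂ => ⟪z.1, a z.1⟫_ℝ + (conj z.1 * p z.1 * α * conj z.2).re +
        (conj z.1 * q z.1 * conj α * z.2).re) (μX.prod γ) := I1.add j2
  have I3 : Integrable (fun z : ℂ × ℂ => (conj (a z.1) * p z.1 * α * conj z.2).re +
      (conj (a z.1) * q z.1 * conj α * z.2).re) (μX.prod γ) := j3.add j4
  have I4 : Integrable (fun z : ℂ × ℂ => (conj (a z.1) * p z.1 * α * conj z.2).re +
      (conj (a z.1) * q z.1 * conj α * z.2).re +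
            (conj (p z.1) * q z.1 * conj α ^ 2 * z.2 ^ 2).re) (μX.prod γ) := I3.add j5
  have I5 : Integrable (fun z : ℂ × ℂ => ‖a z.1‖ ^ 2 +
      ‖α‖ ^ 2 * ((‖p z.1‖ ^ 2 + ‖q z.1‖ ^ 2) * ‖z.2‖ ^ 2)) (μX.prod γ) := k2.add (k3.const_mul _)
  have I6 : Integrable (fun z : ℂ × ℂ => ‖a z.1‖ ^ 2 +
      ‖α‖ ^ 2 * ((‖p z.1‖ ^ 2 + ‖q z.1‖ ^ 2) * ‖z.2‖ ^ 2) +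
      2 * ((conj (a z.1) * p z.1 * α * conj z.2).re + (conj (a z.1) * q z.1 * conj α * z.2).re +
            (conj (p z.1) * q z.1 * conj α ^ 2 * z.2 ^ 2).re)) (μX.prod γ) :=
    I5.add (I4.const_mul 2)
  rw [integral_sub (I2.const_mul _) (I6.const_mul _), integral_const_mul,
    integral_const_mul, integral_add I5 (I4.const_mul 2), integral_const_mul, integral_add I1 j2,
    integral_add k1 j1, integral_add I3 j5, integral_add j3 j4,
    integral_add k2 (k3.const_mul _), integral_const_mul, e1, e2, e3, e4, e5, v1, v2, v3]
  ring

/-- The kernel absorbs the linear growth in the noise: r exp(-r²) ≤ 1, so integrability of a, p, q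
suffices for every α and y. -/
lemma integrable_score {μX : Measure ℂ} [IsProbabilityMeasure μX] {a p q : ℂ → ℂ}
    (ham : Measurable a) (hpm : Measurable p) (hqm : Measurable q)
    (ha : MemLp a 2 μX) (hp : MemLp p 2 μX) (hq : MemLp q 2 μX) (α y : ℂ) :
    Integrable (fun x => Real.exp (-‖y - α * x‖ ^ 2) •
      (a x + p x * conj (y - α * x) * α + q x * (y - α * x) * conj α)) μX := by
  have ha1 : Integrable a μX := ha.integrable (by norm_num)
  have hp1 : Integrable p μX := hp.integrable (by norm_num)
  have hq1 : Integrable q μX := hq.integrable (by norm_num)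
  have hcm : Measurable (starRingEnd ℂ) := Complex.continuous_conj.measurable
  refine (ha1.norm.add ((hp1.norm.add hq1.norm).mul_const ‖α‖)).mono' ?_ (ae_of_all _ fun x => ?_)
  · have h1 : Measurable fun x => y - α * x := by fun_prop
    have h2 : Measurable fun x => Real.exp (-‖y - α * x‖ ^ 2) := by fun_prop
    exact (h2.smul ((ham.add ((hpm.mul (hcm.comp h1)).mul_const _)).add
      ((hqm.mul h1).mul_const _))).aestronglyMeasurable
  · set r := ‖y - α * x‖ with hr
    have hr0 : 0 ≤ r := norm_nonneg _
    have h1 : Real.exp (-r ^ 2) ≤ 1 := Real.exp_le_one_iff.2 (by nlinarith)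
    have h2 : Real.exp (-r ^ 2) * r ≤ 1 := by
      rw [Real.exp_neg, inv_mul_le_iff₀ (Real.exp_pos _), mul_one]
      nlinarith [Real.add_one_le_exp (r ^ 2), sq_nonneg (r - 1)]
    have h3 : ‖a x + p x * conj (y - α * x) * α + q x * (y - α * x) * conj α‖ ≤
        ‖a x‖ + (‖p x‖ + ‖q x‖) * ‖α‖ * r := by
      refine (norm_add₃_le).trans (le_of_eq ?_)
      simp only [norm_mul, RCLike.norm_conj, ← hr]
      ring
    rw [norm_smul, Real.norm_of_nonneg (Real.exp_pos _).le]
    calc Real.exp (-r ^ 2) * ‖a x + p x * conj (y - α * x) * α + q x * (y - α * x) * conj α‖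
        ≤ Real.exp (-r ^ 2) * (‖a x‖ + (‖p x‖ + ‖q x‖) * ‖α‖ * r) := by gcongr
      _ = Real.exp (-r ^ 2) * ‖a x‖ + (Real.exp (-r ^ 2) * r) * ((‖p x‖ + ‖q x‖) * ‖α‖) := by ring
      _ ≤ 1 * ‖a x‖ + 1 * ((‖p x‖ + ‖q x‖) * ‖α‖) := by gcongr
      _ = _ := by simp

variable {Ω : Type*} [MeasurableSpace Ω] {P : Measure Ω} {X H N : Ω → ℂ} {c : ℂ} {σ : ℝ}

/-- A Bayesian Cramér-Rao bound on the average MMSE. The functions `a`, `p`, `q` describe the score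
`a x + p x * conj n * α + q x * n * conj α` at gain `α = √s h`. -/
lemma IsRayleighRiceChannel.score_le_avgMMSE [IsProbabilityMeasure P]
    (hch : IsRayleighRiceChannel P X H N c σ)
    {a p q : ℂ → ℂ} (hX : MemLp (fun x : ℂ => x) 2 (P.map X))
    (ham : Measurable a) (hpm : Measurable p) (hqm : Measurable q)
    (ha : MemLp a 2 (P.map X)) (hp : MemLp p 2 (P.map X)) (hq : MemLp q 2 (P.map X))
    (h0 : ∀ α y : ℂ, ∫ x, Real.exp (-‖y - α * x‖ ^ 2) •
      (a x + p x * conj (y - α * x) * α + q x * (y - α * x) * conj α) ∂(P.map X) = 0)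
    {A B C s : ℝ} (hs : 0 < s) (hA : ∫ x, ⟪x, a x⟫_ℝ ∂(P.map X) = A)
    (hB : ∫ x, ‖a x‖ ^ 2 ∂(P.map X) ≤ B) (hB0 : 0 < B)
    (hC : ∫ x, (‖p x‖ ^ 2 + ‖q x‖ ^ 2) ∂(P.map X) ≤ C) :
    ∫ h, A ^ 2 * (‖h‖ ^ 2 / (B + s * ‖h‖ ^ 2 * C)) ∂(complexNormal c (2 * σ ^ 2)) ≤
      avgMMSE P X H N s := by
  have : IsProbabilityMeasure (P.map X) :=
    Measure.isProbabilityMeasure_map hch.measurable_input.aemeasurable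
  have hC0 : 0 ≤ C := le_trans (integral_nonneg fun x => by positivity) hC
  have hden : ∀ h : ℂ, 0 < B + s * ‖h‖ ^ 2 * C := fun h => by positivity
  -- This l(h) maximises 2lA - l²(B + s|h|²C), and the maximum is A²/(B + s|h|²C). Since it is
  -- bounded by |A|/B, V stays square integrable.
  set l : ℂ → ℝ := fun h => A / (B + s * ‖h‖ ^ 2 * C) with hl
  have hlm : Measurable l := by fun_prop
  have hlb : ∀ h, ‖l h‖ ≤ |A| / B := fun h => by
    rw [hl, Real.norm_eq_abs, abs_div, abs_of_pos (hden h)]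
    gcongr
    have : 0 ≤ s * ‖h‖ ^ 2 * C := by positivity
    linarith
  set V : ℂ × ℂ × ℂ → ℂ := fun z => (l z.1 : ℂ) * z.1 * (a z.2.1 +
    p z.2.1 * conj z.2.2 * ((√s : ℂ) * z.1) + q z.2.1 * z.2.2 * conj ((√s : ℂ) * z.1)) with hVdef
  have hcont : Continuous (starRingEnd ℂ) := Complex.continuous_conj
  have hVm : Measurable V := by
    refine Measurable.mul (by fun_prop) (Measurable.add (Measurable.add (by fun_prop) ?_) ?_)
    · exact ((hpm.comp (by fun_prop)).mul (hcont.measurable.comp (by fun_prop))).mul (by fun_prop)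
    · exact ((hqm.comp (by fun_prop)).mul (by fun_prop)).mul (hcont.measurable.comp (by fun_prop))
  have hu : MemLp (fun h : ℂ => (l h : ℂ) * h) 2 (complexNormal c (2 * σ ^ 2)) := by
    refine MemLp.of_le_mul (c := |A| / B) (memLp_id_complexNormal c (2 * σ ^ 2) (by norm_num))
      (by fun_prop) (ae_of_all _ fun h => ?_)
    rw [norm_mul, Complex.norm_real]
    gcongr
    exact hlb h
  have hsq : MemLp (fun h : ℂ => h * h) 2 (complexNormal c (2 * σ ^ 2)) := by
    rw [memLp_two_iff_integrable_sq_norm (by fun_prop)]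
    refine (integrable_norm_pow_complexNormal c (2 * σ ^ 2) 4).congr (ae_of_all _ fun h => ?_)
    simp only [norm_mul]; ring
  have hv : MemLp (fun h : ℂ => (l h : ℂ) * h * ((√s : ℂ) * h)) 2
      (complexNormal c (2 * σ ^ 2)) := by
    refine MemLp.of_le_mul (c := |A| / B * √s) hsq (by fun_prop) (ae_of_all _ fun h => ?_)
    simp only [norm_mul, Complex.norm_real]
    rw [Real.norm_of_nonneg (Real.sqrt_nonneg s)]
    calc ‖l h‖ * ‖h‖ * (√s * ‖h‖) = ‖l h‖ * (√s * (‖h‖ * ‖h‖)) := by ring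
      _ ≤ |A| / B * (√s * (‖h‖ * ‖h‖)) := by gcongr; exact hlb h
      _ = _ := by ring
  have hv' : MemLp (fun h : ℂ => (l h : ℂ) * h * conj ((√s : ℂ) * h)) 2
      (complexNormal c (2 * σ ^ 2)) := by
    refine hv.of_le ?_ (ae_of_all _ fun h => ?_)
    · exact ((by fun_prop : Measurable fun h : ℂ => (l h : ℂ) * h).mul
        (hcont.measurable.comp (by fun_prop))).aestronglyMeasurable
    · simp
  have hn : MemLp (fun n : ℂ => n) 2 (complexNormal 0 1) := memLp_id_complexNormal 0 1 (by norm_num)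
  have hV2 : MemLp V 2 (channelLaw (P.map X) c σ) := by
    have := ((memLp_two_channelLaw c σ hu ha (memLp_const (1 : ℂ))).add
      (memLp_two_channelLaw c σ hv hp hn.star)).add (memLp_two_channelLaw c σ hv' hq hn)
    convert this using 1
    ext z
    simp only [hVdef, Pi.add_apply, Pi.star_apply, mul_one, RCLike.star_def]
    ring
  have hZ := memLp_two_gain_mul_input (μX := P.map X) c σ hX
  have key := hch.le_avgMMSE s hZ hVm hV2
    (integral_inner_channelLaw_eq_zero (P.map X) c σ s hVm (fun h y => ?_) (fun h y => ?_))
  · refine le_trans ?_ key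
    have hint : Integrable (fun z : ℂ × ℂ × ℂ => 2 * ⟪z.1 * z.2.1, V z⟫_ℝ - ‖V z‖ ^ 2)
        (channelLaw (P.map X) c σ) :=
      ((integrable_inner_of_memLp_two hZ hV2).const_mul 2).sub (integrable_norm_sq_of_memLp_two hV2)
    rw [channelLaw] at hint ⊢
    rw [integral_prod _ hint]
    have hint' := hint.integral_prod_left
    have hfix : ∀ h : ℂ, ∫ z : ℂ × ℂ, (2 * ⟪h * z.1, V (h, z)⟫_ℝ - ‖V (h, z)‖ ^ 2)
        ∂((P.map X).prod (complexNormal 0 1)) = ‖h‖ ^ 2 * (2 * l h * A - l h ^ 2 *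
          (∫ x, ‖a x‖ ^ 2 ∂(P.map X) + s * ‖h‖ ^ 2 *
            ∫ x, (‖p x‖ ^ 2 + ‖q x‖ ^ 2) ∂(P.map X))) := fun h => by
      have := integral_score_fixed_gain hX ha hp hq (l h) h ((√s : ℂ) * h)
      rw [hA, norm_mul, mul_pow, Complex.norm_real, Real.norm_eq_abs, sq_abs, Real.sq_sqrt hs.le]
        at this
      exact this
    simp only [hfix] at hint' ⊢
    refine integral_mono_of_nonneg (ae_of_all _ fun h => ?_) hint' (ae_of_all _ fun h => ?_)
    · have := hden h
      simp only [Pi.zero_apply]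
      positivity
    · have e : A ^ 2 * (‖h‖ ^ 2 / (B + s * ‖h‖ ^ 2 * C)) =
          ‖h‖ ^ 2 * (2 * l h * A - l h ^ 2 * (B + s * ‖h‖ ^ 2 * C)) := by
        have := (hden h).ne'
        simp only [hl]
        field_simp
        ring
      simp only
      rw [e]
      gcongr
  · have e : ∀ x, Real.exp (-‖y - (√s : ℂ) * h * x‖ ^ 2) • V (h, x, y - (√s : ℂ) * h * x) =
        ((l h : ℂ) * h) * (Real.exp (-‖y - (√s : ℂ) * h * x‖ ^ 2) •
          (a x + p x * conj (y - (√s : ℂ) * h * x) * ((√s : ℂ) * h) +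
            q x * (y - (√s : ℂ) * h * x) * conj ((√s : ℂ) * h))) := fun x => by
      simp only [hVdef, Complex.real_smul]; ring
    simp only [e]
    exact (integrable_score ham hpm hqm ha hp hq _ y).const_mul _
  · have e : ∀ x, Real.exp (-‖y - (√s : ℂ) * h * x‖ ^ 2) • V (h, x, y - (√s : ℂ) * h * x) =
        ((l h : ℂ) * h) * (Real.exp (-‖y - (√s : ℂ) * h * x‖ ^ 2) •
          (a x + p x * conj (y - (√s : ℂ) * h * x) * ((√s : ℂ) * h) +
            q x * (y - (√s : ℂ) * h * x) * conj ((√s : ℂ) * h))) := fun x => by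
      simp only [hVdef, Complex.real_smul]; ring
    simp only [e]
    rw [integral_const_mul, h0, mul_zero]

end Score

/-! ### Upper bounds from a pointwise majorant of an estimator's error. -/

section UpperBound

variable {Ω : Type*} [MeasurableSpace Ω] {P : Measure Ω} {X H N : Ω → ℂ} {c : ℂ} {σ : ℝ}

lemma ae_channelLaw_of_ae_input {μX : Measure ℂ} [IsProbabilityMeasure μX] {p : ℂ → Prop}
    (hp : ∀ᵐ x ∂μX, p x) : ∀ᵐ z ∂(channelLaw μX c σ), p z.2.1 :=
  Measure.quasiMeasurePreserving_snd.ae (Measure.quasiMeasurePreserving_fst.ae hp)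

/-- A single integrable majorant Q serves twice: it makes the estimation error square integrable,
and its mean at fixed gain gives the bound. The primed form averages over input and noise jointly,
as the Gaussian input requires; the unprimed one asks for a noise average bounded for almost every
x. -/
lemma IsRayleighRiceChannel.avgMMSE_le_integral_bound' [IsProbabilityMeasure P]
    (hch : IsRayleighRiceChannel P X H N c σ) (hX : MemLp (fun x : ℂ => x) 2 (P.map X)) (s : ℝ)
    {f : ℂ × ℂ → ℂ} (hf : Measurable f) {Q : ℂ → ℂ → ℂ → ℝ}
    (hQ : Integrable (fun z : ℂ × ℂ × ℂ => Q z.1 z.2.1 z.2.2) (channelLaw (P.map X) c σ))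
    (hb : ∀ᵐ x ∂(P.map X), ∀ h n, ‖h * x - f ((√s : ℂ) * h * x + n, h)‖ ^ 2 ≤ Q h x n)
    {q : ℂ → ℝ} (hq : Integrable q (complexNormal c (2 * σ ^ 2)))
    (hbq : ∀ h, Integrable (fun w : ℂ × ℂ => Q h w.1 w.2) ((P.map X).prod (complexNormal 0 1)) →
      ∫ w : ℂ × ℂ, Q h w.1 w.2 ∂((P.map X).prod (complexNormal 0 1)) ≤ q h) :
    avgMMSE P X H N s ≤ ∫ h, q h ∂(complexNormal c (2 * σ ^ 2)) := by
  have : IsProbabilityMeasure (P.map X) :=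
    Measure.isProbabilityMeasure_map hch.measurable_input.aemeasurable
  have hm : Measurable fun z : ℂ × ℂ × ℂ =>
      z.1 * z.2.1 - f ((√s : ℂ) * z.1 * z.2.1 + z.2.2, z.1) :=
    Measurable.sub (by fun_prop) (hf.comp (by fun_prop))
  have hb' : ∀ᵐ z ∂(channelLaw (P.map X) c σ),
      ‖z.1 * z.2.1 - f ((√s : ℂ) * z.1 * z.2.1 + z.2.2, z.1)‖ ^ 2 ≤ Q z.1 z.2.1 z.2.2 := by
    filter_upwards [ae_channelLaw_of_ae_input (c := c) (σ := σ) hb] with z hz using hz _ _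
  have hE : MemLp (fun z : ℂ × ℂ × ℂ =>
      z.1 * z.2.1 - f ((√s : ℂ) * z.1 * z.2.1 + z.2.2, z.1)) 2 (channelLaw (P.map X) c σ) := by
    rw [memLp_two_iff_integrable_sq_norm hm.aestronglyMeasurable]
    refine hQ.mono' (by fun_prop) ?_
    filter_upwards [hb'] with z hz
    rwa [Real.norm_of_nonneg (by positivity)]
  refine (hch.avgMMSE_le s (memLp_two_gain_mul_input c σ hX) hf hE).trans ?_
  refine (integral_mono_ae (integrable_norm_sq_of_memLp_two hE) hQ hb').trans ?_
  rw [channelLaw] at hQ ⊢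
  rw [integral_prod _ hQ]
  refine integral_mono_ae hQ.integral_prod_left hq ?_
  filter_upwards [hQ.prod_right_ae] with h hh
  exact hbq h hh

lemma IsRayleighRiceChannel.avgMMSE_le_integral_bound [IsProbabilityMeasure P]
    (hch : IsRayleighRiceChannel P X H N c σ) (hX : MemLp (fun x : ℂ => x) 2 (P.map X)) (s : ℝ)
    {f : ℂ × ℂ → ℂ} (hf : Measurable f) {Q : ℂ → ℂ → ℂ → ℝ}
    (hQ : Integrable (fun z : ℂ × ℂ × ℂ => Q z.1 z.2.1 z.2.2) (channelLaw (P.map X) c σ))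
    (hb : ∀ᵐ x ∂(P.map X), ∀ h n, ‖h * x - f ((√s : ℂ) * h * x + n, h)‖ ^ 2 ≤ Q h x n)
    {q : ℂ → ℝ} (hq : Integrable q (complexNormal c (2 * σ ^ 2)))
    (hbq : ∀ h, ∀ᵐ x ∂(P.map X), ∫ n, Q h x n ∂(complexNormal 0 1) ≤ q h) :
    avgMMSE P X H N s ≤ ∫ h, q h ∂(complexNormal c (2 * σ ^ 2)) := by
  have : IsProbabilityMeasure (P.map X) :=
    Measure.isProbabilityMeasure_map hch.measurable_input.aemeasurable
  refine hch.avgMMSE_le_integral_bound' hX s hf hQ hb hq fun h hh => ?_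
  rw [integral_prod _ hh]
  refine (integral_mono_ae hh.integral_prod_left (integrable_const (q h)) (hbq h)).trans ?_
  simp

end UpperBound

/-! ### The function E[1/(1+s|h|²)] and its decay. -/

section Laplace

/-- `∫ g / (1 + s f) = ∫₀^∞ e^{-y} (∫ g e^{-s y f}) dy`. -/
lemma integral_div_one_add_mul {α : Type*} [MeasurableSpace α] {ν : Measure α} [SFinite ν]
    {f g : α → ℝ} (hf : Measurable f) (hf0 : ∀ x, 0 ≤ f x) (hg : Integrable g ν) {s : ℝ}
    (hs : 0 ≤ s) :
    ∫ x, g x / (1 + s * f x) ∂ν =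
      ∫ y in Set.Ioi (0 : ℝ), Real.exp (-y) * ∫ x, g x * Real.exp (-(s * y) * f x) ∂ν := by
  have h1 : ∀ x, g x / (1 + s * f x) =
      ∫ y in Set.Ioi (0 : ℝ), Real.exp (-y) * (g x * Real.exp (-(s * y) * f x)) := fun x => by
    have hpos : 0 < 1 + s * f x := by have := mul_nonneg hs (hf0 x); linarith
    have e : ∀ y : ℝ, Real.exp (-y) * (g x * Real.exp (-(s * y) * f x)) =
        g x * Real.exp (-(1 + s * f x) * y) := fun y => by
      rw [mul_left_comm, ← Real.exp_add]; congr 2; ring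
    simp_rw [e]
    rw [integral_const_mul, integral_exp_mul_Ioi (by linarith)]
    rw [mul_zero, Real.exp_zero, neg_div_neg_eq, mul_one_div]
  simp_rw [h1]
  rw [integral_integral_swap]
  · simp_rw [integral_const_mul]
  · have hi : Integrable (fun z : α × ℝ => g z.1 * Real.exp (-z.2))
        (ν.prod (volume.restrict (Set.Ioi 0))) :=
      hg.mul_prod (by simpa [IntegrableOn] using exp_neg_integrableOn_Ioi 0 one_pos)
    have hpos : ∀ᵐ z ∂(ν.prod (volume.restrict (Set.Ioi (0 : ℝ)))), 0 < z.2 :=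
      Measure.quasiMeasurePreserving_snd.ae (ae_restrict_mem measurableSet_Ioi)
    refine hi.mono ?_ ?_
    · refine AEStronglyMeasurable.mul (by fun_prop) (hg.1.comp_fst.mul ?_)
      exact Measurable.aestronglyMeasurable (by fun_prop)
    · filter_upwards [hpos] with z hz
      simp only [Function.uncurry, norm_mul, Real.norm_eq_abs, Real.abs_exp]
      have : Real.exp (-(s * z.2) * f z.1) ≤ 1 :=
        Real.exp_le_one_iff.2 (by have := mul_nonneg (mul_nonneg hs hz.le) (hf0 z.1); linarith)
      have h0 : 0 ≤ |g z.1| * Real.exp (-z.2) := by positivity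
      nlinarith

lemma integral_exp_neg_sq_gaussianReal (m : ℝ) {v : NNReal} (hv : v ≠ 0) {l : ℝ} (hl : 0 ≤ l) :
    ∫ x, Real.exp (-l * x ^ 2) ∂(gaussianReal m v) =
      (√(1 + 2 * l * v))⁻¹ * Real.exp (-l * m ^ 2 / (1 + 2 * l * v)) := by
  have hv0 : (0 : ℝ) < v := by positivity
  have hd : 0 < 1 + 2 * l * (v : ℝ) := by positivity
  rw [integral_gaussianReal_eq_integral_smul hv]
  have e : ∀ x, gaussianPDFReal m v x • Real.exp (-l * x ^ 2) =
      (√(2 * Real.pi * v))⁻¹ * Real.exp (-l * m ^ 2 / (1 + 2 * l * v)) *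
        Real.exp (-((1 + 2 * l * v) / (2 * v)) * (x - m / (1 + 2 * l * v)) ^ 2) := fun x => by
    rw [gaussianPDFReal, smul_eq_mul, mul_assoc _ (Real.exp _), mul_assoc _ (Real.exp _),
      ← Real.exp_add, ← Real.exp_add]
    congr 2
    field_simp
    ring
  simp_rw [e]
  rw [integral_const_mul, integral_sub_right_eq_self
    (fun x => Real.exp (-((1 + 2 * l * v) / (2 * v)) * x ^ 2)), integral_gaussian]
  have e2 : √(Real.pi / ((1 + 2 * l * v) / (2 * v))) = √(2 * Real.pi * v) * (√(1 + 2 * l * v))⁻¹ := by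
    rw [← Real.sqrt_inv, ← Real.sqrt_mul (by positivity)]
    congr 1
    field_simp
  rw [e2]
  have : √(2 * Real.pi * v) ≠ 0 := by positivity
  field_simp

lemma integral_exp_neg_norm_sq_complexNormal (c : ℂ) {w : ℝ} (hw : 0 < w) {l : ℝ} (hl : 0 ≤ l) :
    ∫ h, Real.exp (-l * ‖h‖ ^ 2) ∂(complexNormal c w) =
      (1 + l * w)⁻¹ * Real.exp (-l * ‖c‖ ^ 2 / (1 + l * w)) := by
  have hv : (w / 2).toNNReal ≠ 0 := by simpa using hw
  rw [integral_complexNormal]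
  have e : ∀ p : ℝ × ℝ, Real.exp (-l * ‖(p.1 + p.2 * Complex.I : ℂ)‖ ^ 2) =
      Real.exp (-l * p.1 ^ 2) * Real.exp (-l * p.2 ^ 2) := fun p => by
    rw [← Real.exp_add, ← Complex.normSq_eq_norm_sq, Complex.normSq_add_mul_I]
    ring_nf
  simp_rw [e]
  rw [integral_prod_mul (fun x : ℝ => Real.exp (-l * x ^ 2)) (fun x : ℝ => Real.exp (-l * x ^ 2)),
    integral_exp_neg_sq_gaussianReal _ hv hl, integral_exp_neg_sq_gaussianReal _ hv hl,
    Real.coe_toNNReal _ (by positivity), mul_mul_mul_comm, ← Real.exp_add, ← mul_inv]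
  have e1 : 1 + 2 * l * (w / 2) = 1 + l * w := by ring
  rw [e1, Real.mul_self_sqrt (by positivity), ← Complex.normSq_eq_norm_sq, Complex.normSq_apply]
  ring_nf

/-- The mean of `1 / (1 + s |h|²)` over the channel gain. -/
noncomputable def gainTransform (c : ℂ) (σ s : ℝ) : ℝ :=
  ∫ h, 1 / (1 + s * ‖h‖ ^ 2) ∂(complexNormal c (2 * σ ^ 2))

lemma integrable_gainTransform (c : ℂ) (σ : ℝ) {s : ℝ} (hs : 0 ≤ s) :
    Integrable (fun h : ℂ => 1 / (1 + s * ‖h‖ ^ 2)) (complexNormal c (2 * σ ^ 2)) := by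
  refine (integrable_const (1 : ℝ)).mono (Measurable.aestronglyMeasurable (by fun_prop))
    (ae_of_all _ fun h => ?_)
  have : 0 ≤ s * ‖h‖ ^ 2 := by positivity
  rw [Real.norm_of_nonneg (by positivity), norm_one, div_le_one (by positivity)]
  linarith

lemma gainTransform_nonneg (c : ℂ) (σ : ℝ) {s : ℝ} (hs : 0 ≤ s) : 0 ≤ gainTransform c σ s :=
  integral_nonneg fun h => by positivity

/-- Writing 1/(1+t) as a Laplace integral leaves only the Laplace transform of |h|², which is
explicit for a Gaussian gain. No formula for the law of |h|² is needed here. -/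
lemma gainTransform_eq (c : ℂ) {σ : ℝ} (hσ : 0 < σ) {s : ℝ} (hs : 0 ≤ s) :
    gainTransform c σ s = ∫ y in Set.Ioi (0 : ℝ), Real.exp (-y) *
      ((1 + s * y * (2 * σ ^ 2))⁻¹ *
        Real.exp (-(s * y) * ‖c‖ ^ 2 / (1 + s * y * (2 * σ ^ 2)))) := by
  rw [gainTransform, integral_div_one_add_mul (by fun_prop) (fun h => by positivity)
    (integrable_const (1 : ℝ)) hs]
  refine setIntegral_congr_fun measurableSet_Ioi fun y hy => ?_
  have hy0 : 0 ≤ s * y := mul_nonneg hs (le_of_lt hy)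
  simp only [one_mul]
  rw [integral_exp_neg_norm_sq_complexNormal c (by positivity) hy0]

/-- `E[1 / (1 + s |h|²)] = O(s^{-a})` for every `a < 1`. -/
lemma gainTransform_le (c : ℂ) {σ : ℝ} (hσ : 0 < σ) {a : ℝ} (ha : a ∈ Set.Ioo (0 : ℝ) 1) :
    ∃ K : ℝ, 0 ≤ K ∧ ∀ s : ℝ, 0 < s → gainTransform c σ s ≤ K * s ^ (-a) := by
  refine ⟨(2 * σ ^ 2) ^ (-a) * Real.Gamma (1 - a), ?_, fun s hs => ?_⟩
  · have := Real.Gamma_pos_of_pos (sub_pos.2 ha.2)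
    positivity
  have hG : IntegrableOn (fun y : ℝ => Real.exp (-y) * y ^ ((1 - a) - 1)) (Set.Ioi 0) :=
    Real.GammaIntegral_convergent (sub_pos.2 ha.2)
  rw [gainTransform_eq c hσ hs.le, Real.Gamma_eq_integral (sub_pos.2 ha.2),
    ← integral_const_mul, ← integral_mul_const]
  refine integral_mono_of_nonneg ?_ ((hG.const_mul _).mul_const _) ?_
  · filter_upwards [ae_restrict_mem measurableSet_Ioi] with y hy
    have : (0 : ℝ) < y := hy
    simp only [Pi.zero_apply]
    positivity
  · filter_upwards [ae_restrict_mem measurableSet_Ioi] with y hy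
    have hy0 : (0 : ℝ) < y := hy
    have hx0 : 0 < s * y * (2 * σ ^ 2) := by positivity
    have h1 : Real.exp (-(s * y) * ‖c‖ ^ 2 / (1 + s * y * (2 * σ ^ 2))) ≤ 1 := by
      rw [Real.exp_le_one_iff, neg_mul, neg_div, neg_nonpos]
      positivity
    -- From t^a ≤ 1 + t for 0 < a < 1. The integral of exp(-y) y^(-a) is then Γ(1-a), finite
    -- precisely because a < 1.
    have h2 : (1 + s * y * (2 * σ ^ 2))⁻¹ ≤ (s * y * (2 * σ ^ 2)) ^ (-a) := by
      rw [Real.rpow_neg hx0.le]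
      refine inv_anti₀ (by positivity) ?_
      rcases le_total (s * y * (2 * σ ^ 2)) 1 with h | h
      · exact (Real.rpow_le_one hx0.le h ha.1.le).trans (by linarith)
      · calc (s * y * (2 * σ ^ 2)) ^ a ≤ (s * y * (2 * σ ^ 2)) ^ (1 : ℝ) :=
              Real.rpow_le_rpow_of_exponent_le h ha.2.le
          _ ≤ _ := by rw [Real.rpow_one]; linarith
    calc Real.exp (-y) * ((1 + s * y * (2 * σ ^ 2))⁻¹ *
          Real.exp (-(s * y) * ‖c‖ ^ 2 / (1 + s * y * (2 * σ ^ 2))))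
        ≤ Real.exp (-y) * ((s * y * (2 * σ ^ 2)) ^ (-a) * 1) := by gcongr
      _ = (2 * σ ^ 2) ^ (-a) * (Real.exp (-y) * y ^ ((1 - a) - 1)) * s ^ (-a) := by
        rw [Real.mul_rpow (by positivity) (by positivity), Real.mul_rpow hs.le hy0.le,
          show (1 - a) - 1 = -a by ring]
        ring

/-- Partial fractions in |h|²: this turns every Cramér-Rao bound below into an expression in
`gainTransform`. -/
lemma integral_norm_sq_div_gain (c : ℂ) (σ : ℝ) {s b d : ℝ} (hs : 0 < s) (hb : 0 < b)
    (hd : 0 < d) :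
    ∫ h, ‖h‖ ^ 2 / (b + s * ‖h‖ ^ 2 * d) ∂(complexNormal c (2 * σ ^ 2)) =
      1 / (s * d) * (1 - gainTransform c σ (s * d / b)) := by
  have e : ∀ h : ℂ, ‖h‖ ^ 2 / (b + s * ‖h‖ ^ 2 * d) =
      1 / (s * d) * (1 - 1 / (1 + s * d / b * ‖h‖ ^ 2)) := fun h => by
    have : 0 < b + s * ‖h‖ ^ 2 * d := by positivity
    have : 0 < b + s * d * ‖h‖ ^ 2 := by positivity
    field_simp
    ring
  simp_rw [e]
  rw [integral_const_mul, integral_sub (integrable_const _)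
    (integrable_gainTransform c σ (by positivity)), gainTransform]
  simp

end Laplace

/-! ### Integration by parts against the Gaussian kernel on the line. -/

section Kernel

lemma hasDerivAt_exp_neg_norm_sq (y α : ℂ) {x : ℝ → ℂ} {x' : ℂ} {τ : ℝ} (hx : HasDerivAt x x' τ) :
    HasDerivAt (fun τ => Real.exp (-‖y - α * x τ‖ ^ 2))
      (Real.exp (-‖y - α * x τ‖ ^ 2) * (2 * (conj (y - α * x τ) * (α * x')).re)) τ := by
  have h := (((hx.const_mul α).const_sub y).norm_sq.neg).exp
  refine h.congr_deriv ?_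
  simp only [Pi.neg_apply]
  rw [Complex.inner, neg_mul, Complex.neg_re, mul_comm (α * x')]
  ring

lemma integral_cond_Icc {E : Type*} [NormedAddCommGroup E] [NormedSpace ℝ E] {a b : ℝ} (hab : a < b)
    (f : ℝ → E) : ∫ x, f x ∂(cond (volume : Measure ℝ) (Set.Icc a b)) =
      (b - a)⁻¹ • ∫ x in a..b, f x := by
  rw [ProbabilityTheory.cond, integral_smul_measure, intervalIntegral.integral_of_le hab.le,
    integral_Icc_eq_integral_Ioc, Real.volume_Icc, ENNReal.toReal_inv,
    ENNReal.toReal_ofReal (sub_nonneg.2 hab.le)]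

lemma integral_cond_Ioc {E : Type*} [NormedAddCommGroup E] [NormedSpace ℝ E] {a b : ℝ} (hab : a < b)
    (f : ℝ → E) : ∫ x, f x ∂(cond (volume : Measure ℝ) (Set.Ioc a b)) =
      (b - a)⁻¹ • ∫ x in a..b, f x := by
  rw [ProbabilityTheory.cond, integral_smul_measure, intervalIntegral.integral_of_le hab.le,
    Real.volume_Ioc, ENNReal.toReal_inv, ENNReal.toReal_ofReal (sub_nonneg.2 hab.le)]

/-- A pair `(r, g)` with `∫ (r ψ + g ψ') dν = 0` for all Gaussian kernels `ψ`. -/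
def SteinPair (ν : Measure ℝ) (r g : ℝ → ℝ) : Prop :=
  ∀ u v : ℂ, ∫ τ, Real.exp (-‖u - v * τ‖ ^ 2) *
    (r τ + g τ * (2 * (conj (u - v * τ) * v).re)) ∂ν = 0

lemma hasDerivAt_mul_kernel (u v : ℂ) {g : ℝ → ℝ} {r τ : ℝ} (hg : HasDerivAt g r τ) :
    HasDerivAt (fun τ : ℝ => g τ * Real.exp (-‖u - v * τ‖ ^ 2))
      (Real.exp (-‖u - v * τ‖ ^ 2) * (r + g τ * (2 * (conj (u - v * τ) * v).re))) τ := by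
  have h := hg.mul (hasDerivAt_exp_neg_norm_sq u v (Complex.ofRealCLM.hasDerivAt (x := τ)))
  refine h.congr_deriv ?_
  simp only [Complex.ofRealCLM_apply, Complex.ofReal_one, mul_one]
  ring

/-- The integrand is the derivative of g times the kernel, and the boundary terms vanish with g. For
g = 1 they would survive, which is why a weight is needed. -/
lemma steinPair_uniform {L : ℝ} (hL : 0 < L) {r g : ℝ → ℝ} (hg : ∀ τ, HasDerivAt g (r τ) τ)
    (hr : Continuous r) (h1 : g L = 0) (h2 : g (-L) = 0) :
    SteinPair (cond (volume : Measure ℝ) (Set.Icc (-L) L)) r g := fun u v => by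
  have hgc : Continuous g := continuous_iff_continuousAt.2 fun τ => (hg τ).continuousAt
  rw [integral_cond_Icc (by linarith), intervalIntegral.integral_eq_sub_of_hasDerivAt
    (fun τ _ => hasDerivAt_mul_kernel u v (hg τ)), h1, h2]
  · simp
  · refine Continuous.intervalIntegrable ?_ _ _
    fun_prop

/-- For a Gaussian prior the density exp(-τ²) itself plays the role of the vanishing weight, so g =
1 is allowed and r is the usual score -2τ. -/
lemma steinPair_gaussian : SteinPair (gaussianReal 0 (1 / 2 : ℝ).toNNReal) (fun τ => -2 * τ)
    (fun _ => 1) := fun u v => by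
  have hv : (1 / 2 : ℝ).toNNReal ≠ 0 := by simp
  rw [integral_gaussianReal_eq_integral_smul hv]
  set C := (√Real.pi)⁻¹
  have hpdf : ∀ x, gaussianPDFReal 0 (1 / 2 : ℝ).toNNReal x = C * Real.exp (-x ^ 2) := fun x => by
    rw [gaussianPDFReal, Real.coe_toNNReal _ (by norm_num)]
    rw [show 2 * Real.pi * (1 / 2) = Real.pi by ring, show (2 : ℝ) * (1 / 2) = 1 by norm_num,
      sub_zero, div_one]
  have hder : ∀ x : ℝ, HasDerivAt (fun τ : ℝ => Real.exp (-τ ^ 2) * Real.exp (-‖u - v * τ‖ ^ 2))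
      (Real.exp (-‖u - v * x‖ ^ 2) * (Real.exp (-x ^ 2) * (-2 * x) +
        Real.exp (-x ^ 2) * (2 * (conj (u - v * x) * v).re))) x := fun x => by
    refine hasDerivAt_mul_kernel u v ?_
    have := ((hasDerivAt_pow 2 x).neg).exp
    refine this.congr_deriv ?_
    norm_num
  have e : ∀ x : ℝ, gaussianPDFReal 0 (1 / 2 : ℝ).toNNReal x • (Real.exp (-‖u - v * x‖ ^ 2) *
      (-2 * x + 1 * (2 * (conj (u - v * x) * v).re))) = C * (Real.exp (-‖u - v * x‖ ^ 2) *
      (Real.exp (-x ^ 2) * (-2 * x) + Real.exp (-x ^ 2) * (2 * (conj (u - v * x) * v).re))) :=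
    fun x => by rw [hpdf, smul_eq_mul]; ring
  simp_rw [e]
  have g0 : Integrable (fun x : ℝ => Real.exp (-x ^ 2)) := by
    simpa using integrable_exp_neg_mul_sq one_pos
  have g1 : Integrable (fun x : ℝ => x * Real.exp (-x ^ 2)) := by
    simpa using integrable_mul_exp_neg_mul_sq one_pos
  have hle : ∀ x : ℝ, Real.exp (-‖u - v * x‖ ^ 2) ≤ 1 := fun x =>
    Real.exp_le_one_iff.2 (by have := sq_nonneg ‖u - v * x‖; linarith)
  rw [integral_const_mul, integral_eq_zero_of_hasDerivAt_of_integrable hder, mul_zero]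
  · refine ((g1.norm.const_mul (2 * (1 + ‖v‖ * ‖v‖))).add
      (g0.const_mul (2 * (‖u‖ * ‖v‖)))).mono' (by fun_prop) (ae_of_all _ fun x => ?_)
    have h3 : |(conj (u - v * x) * v).re| ≤ (‖u‖ + ‖v‖ * |x|) * ‖v‖ := by
      refine (Complex.abs_re_le_norm _).trans ?_
      rw [norm_mul, RCLike.norm_conj]
      gcongr
      refine (norm_sub_le _ _).trans ?_
      simp
    have hE := Real.exp_pos (-x ^ 2)
    rw [← mul_add, Real.norm_eq_abs, abs_mul, abs_mul, Real.abs_exp, Real.abs_exp]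
    calc _ ≤ 1 * (Real.exp (-x ^ 2) * (2 * |x| + 2 * ((‖u‖ + ‖v‖ * |x|) * ‖v‖))) := by
          gcongr
          · exact hle x
          · refine (abs_add_le _ _).trans ?_
            rw [abs_mul, abs_mul]
            rw [abs_neg, abs_two]
            gcongr
      _ = _ := by
        simp only [Pi.add_apply, Real.norm_eq_abs, abs_mul, Real.abs_exp]
        ring
  · refine g0.mono' (by fun_prop) (ae_of_all _ fun x => ?_)
    rw [Real.norm_of_nonneg (by positivity)]
    have hE := Real.exp_pos (-x ^ 2)
    nlinarith [hle x]

end Kernel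

/-! ### Inputs with independent, identically distributed real and imaginary parts. -/

section Square

/-- The law of `ξ + i η` for independent `ξ, η` of law `ν`. -/
noncomputable def squareLaw (ν : Measure ℝ) : Measure ℂ :=
  (ν.prod ν).map Complex.measurableEquivRealProd.symm

lemma integral_squareLaw {E : Type*} [NormedAddCommGroup E] [NormedSpace ℝ E] (ν : Measure ℝ)
    (F : ℂ → E) : ∫ z, F z ∂(squareLaw ν) = ∫ p : ℝ × ℝ, F (p.1 + p.2 * Complex.I) ∂(ν.prod ν) := by
  rw [squareLaw, integral_map_equiv]
  congr 1
  ext p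
  congr 1
  apply Complex.ext <;> simp [Complex.measurableEquivRealProd]

variable {ν : Measure ℝ} [IsProbabilityMeasure ν]

lemma map_re_squareLaw : (squareLaw ν).map Complex.re = ν := by
  rw [squareLaw, Measure.map_map Complex.measurable_re (MeasurableEquiv.measurable _)]
  refine Eq.trans ?_ (Measure.fst_prod (μ := ν) (ν := ν))
  rfl

lemma map_im_squareLaw : (squareLaw ν).map Complex.im = ν := by
  rw [squareLaw, Measure.map_map Complex.measurable_im (MeasurableEquiv.measurable _)]
  refine Eq.trans ?_ (Measure.snd_prod (μ := ν) (ν := ν))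
  rfl

lemma memLp_comp_re_squareLaw {f : ℝ → ℝ} (hf : MemLp f 2 ν) :
    MemLp (fun z : ℂ => f z.re) 2 (squareLaw ν) := by
  have hf' := hf
  rw [← map_re_squareLaw (ν := ν)] at hf'
  exact hf'.comp_of_map Complex.measurable_re.aemeasurable

lemma memLp_comp_im_squareLaw {f : ℝ → ℝ} (hf : MemLp f 2 ν) :
    MemLp (fun z : ℂ => f z.im) 2 (squareLaw ν) := by
  have hf' := hf
  rw [← map_im_squareLaw (ν := ν)] at hf'
  exact hf'.comp_of_map Complex.measurable_im.aemeasurable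

lemma integral_comp_re_squareLaw {f : ℝ → ℝ} (hf : Measurable f) :
    ∫ z, f z.re ∂(squareLaw ν) = ∫ τ, f τ ∂ν := by
  conv_rhs => rw [← map_re_squareLaw (ν := ν)]
  rw [integral_map Complex.measurable_re.aemeasurable hf.aestronglyMeasurable]

lemma integral_comp_im_squareLaw {f : ℝ → ℝ} (hf : Measurable f) :
    ∫ z, f z.im ∂(squareLaw ν) = ∫ τ, f τ ∂ν := by
  conv_rhs => rw [← map_im_squareLaw (ν := ν)]
  rw [integral_map Complex.measurable_im.aemeasurable hf.aestronglyMeasurable]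

lemma memLp_id_squareLaw (h : MemLp (fun τ : ℝ => τ) 2 ν) :
    MemLp (fun z : ℂ => z) 2 (squareLaw ν) := by
  refine MemLp.of_le ((memLp_comp_re_squareLaw h).norm.add (memLp_comp_im_squareLaw h).norm)
    (by fun_prop) (ae_of_all _ fun z => ?_)
  simpa [abs_of_nonneg (add_nonneg (abs_nonneg z.re) (abs_nonneg z.im))] using
    Complex.norm_le_abs_re_add_abs_im z

lemma memLp_ofReal {α : Type*} [MeasurableSpace α] {μ : Measure α} {f : α → ℝ} {p : ENNReal}
    (h : MemLp f p μ) : MemLp (fun x => (f x : ℂ)) p μ :=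
  Complex.ofRealCLM.comp_memLp' h

lemma integrable_of_integrable_add_I_mul {α : Type*} [MeasurableSpace α] {μ : Measure α}
    {f g : α → ℝ} (h : Integrable (fun x => (f x : ℂ) + Complex.I * (g x : ℂ)) μ) :
    Integrable f μ ∧ Integrable g μ :=
  ⟨h.re.congr (ae_of_all _ fun x => by simp), h.im.congr (ae_of_all _ fun x => by simp)⟩

/-- The real part of the score is the one-dimensional score in the direction α with the imaginary
part of x frozen; the imaginary part is the one in the direction iα with the real part frozen. Each
vanishes by Fubini and the Stein identity. -/
lemma integral_score_squareLaw_eq_zero {r g : ℝ → ℝ} (hS : SteinPair ν r g) (α y : ℂ)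
    (hi : Integrable (fun x : ℂ => Real.exp (-‖y - α * x‖ ^ 2) •
      ((r x.re + Complex.I * r x.im : ℂ) + (g x.re - g x.im : ℂ) * conj (y - α * x) * α +
        (g x.re + g x.im : ℂ) * (y - α * x) * conj α)) (squareLaw ν)) :
    ∫ x : ℂ, Real.exp (-‖y - α * x‖ ^ 2) •
      ((r x.re + Complex.I * r x.im : ℂ) + (g x.re - g x.im : ℂ) * conj (y - α * x) * α +
        (g x.re + g x.im : ℂ) * (y - α * x) * conj α) ∂(squareLaw ν) = 0 := by
  have e : ∀ x : ℂ, Real.exp (-‖y - α * x‖ ^ 2) •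
      ((r x.re + Complex.I * r x.im : ℂ) + (g x.re - g x.im : ℂ) * conj (y - α * x) * α +
        (g x.re + g x.im : ℂ) * (y - α * x) * conj α) =
      ((Real.exp (-‖y - α * x‖ ^ 2) *
        (r x.re + g x.re * (2 * (conj (y - α * x) * α).re)) : ℝ) : ℂ) +
      Complex.I * ((Real.exp (-‖y - α * x‖ ^ 2) *
        (r x.im + g x.im * (2 * (conj (y - α * x) * (α * Complex.I)).re)) : ℝ) : ℂ) := fun x => by
    generalize y - α * x = n
    generalize Real.exp (-‖n‖ ^ 2) = E
    rw [Complex.real_smul]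
    apply Complex.ext <;>
    · simp only [Complex.add_re, Complex.add_im, Complex.sub_re, Complex.sub_im, Complex.mul_re,
        Complex.mul_im, Complex.ofReal_re, Complex.ofReal_im, Complex.I_re, Complex.I_im,
        Complex.conj_re, Complex.conj_im]
      ring
  simp only [e] at hi ⊢
  obtain ⟨hire, hiim⟩ := integrable_of_integrable_add_I_mul hi
  rw [integral_add hire.ofReal (hiim.ofReal.const_mul _), integral_const_mul]
  have hprod : ∀ F : ℂ → ℝ, Integrable F (squareLaw ν) → Integrable
      (fun z : ℝ × ℝ => F (z.1 + z.2 * Complex.I)) (ν.prod ν) := fun F hF => by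
    rw [squareLaw, integrable_map_equiv] at hF
    convert hF using 1
    ext z
    simp only [Function.comp_apply]
    congr 1
    apply Complex.ext <;> simp [Complex.measurableEquivRealProd]
  have hre0 : ∫ x : ℂ, Real.exp (-‖y - α * x‖ ^ 2) *
      (r x.re + g x.re * (2 * (conj (y - α * x) * α).re)) ∂(squareLaw ν) = 0 := by
    rw [integral_squareLaw, integral_prod_symm _ (hprod _ hire)]
    refine (integral_congr_ae (ae_of_all _ fun η => ?_)).trans (integral_zero' _ _)
    refine Eq.trans ?_ (hS (y - α * (η * Complex.I)) α)
    refine integral_congr_ae (ae_of_all _ fun τ => ?_)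
    have e1 : y - α * (τ + η * Complex.I) = y - α * (η * Complex.I) - α * τ := by ring
    simp only [e1]
    simp
  have him0 : ∫ x : ℂ, Real.exp (-‖y - α * x‖ ^ 2) *
      (r x.im + g x.im * (2 * (conj (y - α * x) * (α * Complex.I)).re)) ∂(squareLaw ν) = 0 := by
    rw [integral_squareLaw, integral_prod _ (hprod _ hiim)]
    refine (integral_congr_ae (ae_of_all _ fun η => ?_)).trans (integral_zero' _ _)
    refine Eq.trans ?_ (hS (y - α * η) (α * Complex.I))
    refine integral_congr_ae (ae_of_all _ fun τ => ?_)
    have e1 : y - α * (η + τ * Complex.I) = y - α * η - α * Complex.I * τ := by ring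
    simp only [e1]
    simp
  rw [integral_complex_ofReal, integral_complex_ofReal, hre0, him0]
  simp

variable {Ω : Type*} [MeasurableSpace Ω] {P : Measure Ω} {X H N : Ω → ℂ} {c : ℂ} {σ : ℝ}

/-- The Bayesian Cramér-Rao bound for an input with independent real and imaginary part. -/
lemma IsRayleighRiceChannel.square_le_avgMMSE [IsProbabilityMeasure P]
    (hch : IsRayleighRiceChannel P X H N c σ) (hlaw : P.map X = squareLaw ν)
    (hν : MemLp (fun τ : ℝ => τ) 2 ν) {r g : ℝ → ℝ} (hrm : Measurable r) (hgm : Measurable g)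
    (hr : MemLp r 2 ν) (hg : MemLp g 2 ν) (hS : SteinPair ν r g)
    {A B D s : ℝ} (hs : 0 < s) (hA : ∫ τ, τ * r τ ∂ν = A) (hB : ∫ τ, r τ ^ 2 ∂ν ≤ B) (hB0 : 0 < B)
    (hD : ∫ τ, g τ ^ 2 ∂ν ≤ D) (hD0 : 0 < D) :
    A ^ 2 / (s * D) * (1 - gainTransform c σ (2 * s * D / B)) ≤ avgMMSE P X H N s := by
  have hrr := memLp_comp_re_squareLaw hr
  have hri := memLp_comp_im_squareLaw hr
  have hgr := memLp_comp_re_squareLaw hg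
  have hgi := memLp_comp_im_squareLaw hg
  have hxr := memLp_comp_re_squareLaw hν
  have hxi := memLp_comp_im_squareLaw hν
  have hX := memLp_id_squareLaw hν
  have : IsProbabilityMeasure (squareLaw ν) :=
    Measure.isProbabilityMeasure_map (MeasurableEquiv.measurable _).aemeasurable
  rw [← hlaw] at hX
  set a : ℂ → ℂ := fun x => (r x.re : ℂ) + Complex.I * (r x.im : ℂ) with ha
  set p : ℂ → ℂ := fun x => (g x.re : ℂ) - (g x.im : ℂ) with hp
  set q : ℂ → ℂ := fun x => (g x.re : ℂ) + (g x.im : ℂ) with hq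
  have ham : Measurable a := by fun_prop
  have hpm : Measurable p := by fun_prop
  have hqm : Measurable q := by fun_prop
  have ha2 : MemLp a 2 (squareLaw ν) := (memLp_ofReal hrr).add ((memLp_ofReal hri).const_mul Complex.I)
  have hp2 : MemLp p 2 (squareLaw ν) := (memLp_ofReal hgr).sub (memLp_ofReal hgi)
  have hq2 : MemLp q 2 (squareLaw ν) := (memLp_ofReal hgr).add (memLp_ofReal hgi)
  have hsc := integrable_score ham hpm hqm ha2 hp2 hq2
  -- Two coordinates double A and B. For C, the identity (u-v)² + (u+v)² = 2(u²+v²) gives a factor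
  -- 2, and the two coordinates another.
  have key := hch.score_le_avgMMSE hX ham hpm hqm (by rw [hlaw]; exact ha2)
    (by rw [hlaw]; exact hp2) (by rw [hlaw]; exact hq2)
    (A := 2 * A) (B := 2 * B) (C := 4 * D) ?_ hs ?_ ?_ (by positivity) ?_
  · rw [integral_const_mul, integral_norm_sq_div_gain c σ hs (by positivity) (by positivity)] at key
    refine le_trans (le_of_eq ?_) key
    have e : 2 * s * D / B = s * (4 * D) / (2 * B) := by field_simp; ring
    rw [e]
    field_simp
    ring
  · intro α y
    rw [hlaw]
    exact integral_score_squareLaw_eq_zero hS α y (hsc α y)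
  · rw [hlaw]
    have e : ∀ x : ℂ, ⟪x, a x⟫_ℝ = x.re * r x.re + x.im * r x.im := fun x => by
      rw [Complex.inner]
      simp only [ha, Complex.mul_re, Complex.add_re, Complex.add_im, Complex.mul_im,
        Complex.ofReal_re, Complex.ofReal_im, Complex.I_re, Complex.I_im, Complex.conj_re,
        Complex.conj_im]
      ring
    simp_rw [e]
    have j1 : Integrable (fun x : ℂ => x.re * r x.re) (squareLaw ν) := hxr.integrable_mul hrr
    have j2 : Integrable (fun x : ℂ => x.im * r x.im) (squareLaw ν) := hxi.integrable_mul hri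
    rw [integral_add j1 j2,
      integral_comp_re_squareLaw (f := fun τ => τ * r τ) (by fun_prop),
      integral_comp_im_squareLaw (f := fun τ => τ * r τ) (by fun_prop), hA]
    ring
  · rw [hlaw]
    have e : ∀ x : ℂ, ‖a x‖ ^ 2 = r x.re ^ 2 + r x.im ^ 2 := fun x => by
      rw [← Complex.normSq_eq_norm_sq, ha, Complex.normSq_apply]
      simp
      ring
    simp_rw [e]
    rw [integral_add hrr.integrable_sq hri.integrable_sq,
      integral_comp_re_squareLaw (f := fun τ => r τ ^ 2) (by fun_prop),
      integral_comp_im_squareLaw (f := fun τ => r τ ^ 2) (by fun_prop)]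
    linarith
  · rw [hlaw]
    have e : ∀ x : ℂ, ‖p x‖ ^ 2 + ‖q x‖ ^ 2 = 2 * (g x.re ^ 2 + g x.im ^ 2) := fun x => by
      simp only [hp, hq, ← Complex.ofReal_sub, ← Complex.ofReal_add, Complex.norm_real,
        Real.norm_eq_abs, sq_abs]
      ring
    simp_rw [e]
    rw [integral_const_mul, integral_add hgr.integrable_sq hgi.integrable_sq,
      integral_comp_re_squareLaw (f := fun τ => g τ ^ 2) (by fun_prop),
      integral_comp_im_squareLaw (f := fun τ => g τ ^ 2) (by fun_prop)]
    linarith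

end Square

/-! ### Real inputs. -/

section Line

variable {ν : Measure ℝ}
  {Ω : Type*} [MeasurableSpace Ω] {P : Measure Ω} {X H N : Ω → ℂ} {c : ℂ} {σ : ℝ}

lemma memLp_map_ofReal {f : ℂ → ℂ} (hf : Measurable f) (h : MemLp (fun τ : ℝ => f τ) 2 ν) :
    MemLp f 2 (ν.map (fun x : ℝ => (x : ℂ))) :=
  (memLp_map_measure_iff hf.aestronglyMeasurable Complex.measurable_ofReal.aemeasurable).2 h

/-- The Bayesian Cramér-Rao bound for a real input. -/
lemma IsRayleighRiceChannel.line_le_avgMMSE [IsProbabilityMeasure P] [IsProbabilityMeasure ν]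
    (hch : IsRayleighRiceChannel P X H N c σ) (hlaw : P.map X = ν.map (fun x : ℝ => (x : ℂ)))
    (hν : MemLp (fun τ : ℝ => τ) 2 ν) {r g : ℝ → ℝ} (hrm : Measurable r) (hgm : Measurable g)
    (hr : MemLp r 2 ν) (hg : MemLp g 2 ν) (hS : SteinPair ν r g)
    {A B D s : ℝ} (hs : 0 < s) (hA : ∫ τ, τ * r τ ∂ν = A) (hB : ∫ τ, r τ ^ 2 ∂ν ≤ B) (hB0 : 0 < B)
    (hD : ∫ τ, g τ ^ 2 ∂ν ≤ D) (hD0 : 0 < D) :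
    A ^ 2 / (2 * s * D) * (1 - gainTransform c σ (2 * s * D / B)) ≤ avgMMSE P X H N s := by
  have hgm' : Measurable fun x : ℂ => (g x.re : ℂ) := by fun_prop
  have hrm' : Measurable fun x : ℂ => (r x.re : ℂ) := by fun_prop
  have hX : MemLp (fun x : ℂ => x) 2 (P.map X) := by
    rw [hlaw]; exact memLp_map_ofReal measurable_id (memLp_ofReal hν)
  have hr2 : MemLp (fun x : ℂ => (r x.re : ℂ)) 2 (P.map X) := by
    rw [hlaw]; exact memLp_map_ofReal hrm' (memLp_ofReal hr)
  have hg2 : MemLp (fun x : ℂ => (g x.re : ℂ)) 2 (P.map X) := by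
    rw [hlaw]; exact memLp_map_ofReal hgm' (memLp_ofReal hg)
  have hI : ∀ {E : Type} [NormedAddCommGroup E] [NormedSpace ℝ E] (F : ℂ → E),
      ∫ x, F x ∂(P.map X) = ∫ τ : ℝ, F τ ∂ν := fun F => by
    rw [hlaw, Complex.isometry_ofReal.isClosedEmbedding.measurableEmbedding.integral_map]
  have key := hch.score_le_avgMMSE hX hrm' hgm' hgm' hr2 hg2 hg2
    (A := A) (B := B) (C := 2 * D) ?_ hs ?_ ?_ hB0 ?_
  · rw [integral_const_mul, integral_norm_sq_div_gain c σ hs hB0 (by positivity)] at key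
    refine le_trans (le_of_eq ?_) key
    rw [show s * (2 * D) = 2 * s * D by ring]
    ring
  · intro α y
    rw [hI]
    have e : ∀ τ : ℝ, Real.exp (-‖y - α * τ‖ ^ 2) •
        ((r (τ : ℂ).re : ℂ) + (g (τ : ℂ).re : ℂ) * conj (y - α * τ) * α +
          (g (τ : ℂ).re : ℂ) * (y - α * τ) * conj α) =
        ((Real.exp (-‖y - α * τ‖ ^ 2) *
          (r τ + g τ * (2 * (conj (y - α * τ) * α).re)) : ℝ) : ℂ) := fun τ => by
      generalize y - α * τ = n
      generalize Real.exp (-‖n‖ ^ 2) = E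
      rw [Complex.real_smul, Complex.ofReal_re]
      apply Complex.ext <;>
      · simp only [Complex.add_re, Complex.add_im, Complex.mul_re,
          Complex.mul_im, Complex.ofReal_re, Complex.ofReal_im,
          Complex.conj_re, Complex.conj_im]
        ring
    simp_rw [e]
    rw [integral_complex_ofReal, hS y α, Complex.ofReal_zero]
  · rw [hI, ← hA]
    refine integral_congr_ae (ae_of_all _ fun τ => ?_)
    simp [Complex.inner, mul_comm]
  · rw [hI]
    simpa using hB
  · rw [hI]
    have e : ∀ τ : ℝ, ‖(g (τ : ℂ).re : ℂ)‖ ^ 2 + ‖(g (τ : ℂ).re : ℂ)‖ ^ 2 = 2 * g τ ^ 2 := fun τ => by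
      simp; ring
    simp_rw [e]
    rw [integral_const_mul]
    linarith

end Line

/-! ### Polynomial weights on an interval and the resulting lower bounds. -/

section Uniform

/-- The uniform law on `[-L, L]`. -/
noncomputable abbrev uniformLaw (L : ℝ) : Measure ℝ :=
  ProbabilityTheory.cond (volume : Measure ℝ) (Set.Icc (-L) L)

lemma isProbabilityMeasure_uniformLaw {L : ℝ} (hL : 0 < L) : IsProbabilityMeasure (uniformLaw L) := by
  refine cond_isProbabilityMeasure_of_finite ?_ ?_ <;> rw [Real.volume_Icc]
  · simp [hL]
  · simp

lemma ae_uniformLaw (L : ℝ) : ∀ᵐ τ ∂(uniformLaw L), τ ∈ Set.Icc (-L) L :=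
  ae_cond_mem measurableSet_Icc

lemma memLp_uniformLaw {L : ℝ} (hL : 0 < L) {f : ℝ → ℝ} (hf : Continuous f) :
    MemLp f 2 (uniformLaw L) := by
  have := isProbabilityMeasure_uniformLaw hL
  obtain ⟨C, hC⟩ := isCompact_Icc.exists_bound_of_continuousOn (s := Set.Icc (-L) L) hf.continuousOn
  refine MemLp.of_bound hf.aestronglyMeasurable C ?_
  filter_upwards [ae_uniformLaw L] with τ hτ using hC τ hτ

lemma integral_pow_uniformLaw {L : ℝ} (hL : 0 < L) (k : ℕ) :
    ∫ τ, τ ^ (2 * k) ∂(uniformLaw L) = L ^ (2 * k) / (2 * k + 1) := by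
  rw [integral_cond_Icc (by linarith), integral_pow, smul_eq_mul]
  have e : (-L) ^ (2 * k + 1) = -L ^ (2 * k + 1) := Odd.neg_pow ⟨k, rfl⟩ L
  rw [e]
  push_cast
  field_simp
  ring

/-- A smooth weight on `[-L, L]` vanishing at the end points. -/
noncomputable def weight (L : ℝ) (m : ℕ) (τ : ℝ) : ℝ := 1 - τ ^ (2 * (m + 1)) / L ^ (2 * (m + 1))

/-- The derivative of `weight`. -/
noncomputable def weightDeriv (L : ℝ) (m : ℕ) (τ : ℝ) : ℝ :=
  -((2 * (m + 1)) * τ ^ (2 * m + 1) / L ^ (2 * (m + 1)))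

lemma continuous_weight (L : ℝ) (m : ℕ) : Continuous (weight L m) := by
  unfold weight; fun_prop

lemma continuous_weightDeriv (L : ℝ) (m : ℕ) : Continuous (weightDeriv L m) := by
  unfold weightDeriv; fun_prop

lemma hasDerivAt_weight (L : ℝ) (m : ℕ) (τ : ℝ) :
    HasDerivAt (weight L m) (weightDeriv L m τ) τ := by
  have h := ((hasDerivAt_pow (2 * (m + 1)) τ).div_const (L ^ (2 * (m + 1)))).const_sub 1
  refine h.congr_deriv ?_
  simp [weightDeriv, show 2 * (m + 1) - 1 = 2 * m + 1 by omega]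

lemma steinPair_weight {L : ℝ} (hL : 0 < L) (m : ℕ) :
    SteinPair (uniformLaw L) (weightDeriv L m) (weight L m) := by
  refine steinPair_uniform hL (hasDerivAt_weight L m) (continuous_weightDeriv L m) ?_ ?_
  · rw [weight, div_self (by positivity), sub_self]
  · rw [weight, Even.neg_pow ⟨m + 1, by ring⟩, div_self (by positivity), sub_self]

lemma integral_mul_weightDeriv {L : ℝ} (hL : 0 < L) (m : ℕ) :
    ∫ τ, τ * weightDeriv L m τ ∂(uniformLaw L) = -((2 * (m + 1)) / (2 * (m + 1) + 1)) := by
  have e : ∀ τ, τ * weightDeriv L m τ =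
      -((2 * (m + 1)) / L ^ (2 * (m + 1))) * τ ^ (2 * (m + 1)) := fun τ => by
    rw [weightDeriv, show 2 * (m + 1) = (2 * m + 1) + 1 by ring, pow_succ τ]
    ring
  simp_rw [e]
  rw [integral_const_mul, integral_pow_uniformLaw hL]
  push_cast
  field_simp

/-- The integral is 4(m+1)²/(L²(4m+3)), growing linearly in m as the weight steepens near the end
points. The threshold 4/3 is what m = 0 requires; it covers both L² = 3 and L² = 3/2. -/
lemma integral_weightDeriv_sq_le {L : ℝ} (hL : 0 < L) (hL2 : 4 / 3 ≤ L ^ 2) (m : ℕ) :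
    ∫ τ, weightDeriv L m τ ^ 2 ∂(uniformLaw L) ≤ m + 1 := by
  have e : ∀ τ, weightDeriv L m τ ^ 2 =
      ((2 * (m + 1)) / L ^ (2 * (m + 1))) ^ 2 * τ ^ (2 * (2 * m + 1)) := fun τ => by
    rw [weightDeriv, neg_sq, mul_div_right_comm, mul_pow, ← pow_mul τ, mul_comm (2 * m + 1) 2]
  simp_rw [e]
  rw [integral_const_mul, integral_pow_uniformLaw hL]
  have e2 : ((2 * ((m : ℝ) + 1)) / L ^ (2 * (m + 1))) ^ 2 *
      (L ^ (2 * (2 * m + 1)) / (2 * ((2 * m + 1 : ℕ) : ℝ) + 1)) =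
      4 * (m + 1) ^ 2 / (L ^ 2 * (4 * m + 3)) := by
    have : (L ^ (2 * (m + 1))) ^ 2 = L ^ (2 * (2 * m + 1)) * L ^ 2 := by ring
    rw [div_pow, this]
    push_cast
    field_simp
    ring
  rw [e2, div_le_iff₀ (by positivity)]
  have hm : (0 : ℝ) ≤ m := m.cast_nonneg
  have : 4 / 3 * (4 * (m : ℝ) + 3) ≤ L ^ 2 * (4 * m + 3) := by gcongr
  nlinarith

lemma integral_weight_sq_le {L : ℝ} (hL : 0 < L) (m : ℕ) :
    ∫ τ, weight L m τ ^ 2 ∂(uniformLaw L) ≤ 1 := by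
  have := isProbabilityMeasure_uniformLaw hL
  have h : ∫ τ, weight L m τ ^ 2 ∂(uniformLaw L) ≤ ∫ _, (1 : ℝ) ∂(uniformLaw L) := by
    refine integral_mono_ae (memLp_uniformLaw hL (continuous_weight L m)).integrable_sq
      (integrable_const _) ?_
    filter_upwards [ae_uniformLaw L] with τ hτ
    have h1 : τ ^ (2 * (m + 1)) ≤ L ^ (2 * (m + 1)) := by
      rw [pow_mul, pow_mul]
      exact pow_le_pow_left₀ (sq_nonneg τ) (sq_le_sq' hτ.1 hτ.2) _
    have h2 : 0 ≤ τ ^ (2 * (m + 1)) := by rw [pow_mul]; positivity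
    have h3 : 0 ≤ τ ^ (2 * (m + 1)) / L ^ (2 * (m + 1)) := by positivity
    have h4 : τ ^ (2 * (m + 1)) / L ^ (2 * (m + 1)) ≤ 1 := (div_le_one (by positivity)).2 h1
    simp only [weight]
    nlinarith
  simpa using h

/-- Normalised area on a square is a product measure, so ∞-QAM falls under the bound for independent
coordinates. -/
lemma inftyQAM_eq : inftyQAM = squareLaw (uniformLaw (√(3 / 2))) := by
  set S := Set.Icc (-√(3 / 2)) (√(3 / 2)) with hS
  have hSm : MeasurableSet S := measurableSet_Icc
  have hpre : Complex.measurableEquivRealProd.symm ⁻¹' (S ×ℂ S) = S ×ˢ S := by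
    ext p
    simp [Complex.measurableEquivRealProd, Complex.mem_reProdIm]
  have hmp := Complex.volume_preserving_equiv_real_prod.symm
  have hSS : MeasurableSet (S ×ℂ S) := by
    rw [← Complex.measurableEquivRealProd.symm.measurableSet_preimage, hpre]
    exact hSm.prod hSm
  ext A hA
  rw [inftyQAM, squareLaw, cond_apply hSS, MeasurableEquiv.map_apply, ← hmp.measure_preimage_equiv,
    ← hmp.measure_preimage_equiv, Set.preimage_inter, hpre, uniformLaw, ProbabilityTheory.cond,
    Measure.prod_smul_left, Measure.prod_smul_right, Measure.prod_restrict, Measure.smul_apply,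
    Measure.smul_apply, Measure.restrict_apply (Complex.measurableEquivRealProd.symm.measurable hA),
    ← Measure.volume_eq_prod, smul_eq_mul, smul_eq_mul, ← mul_assoc, Set.inter_comm]
  congr 1
  rw [Measure.volume_eq_prod, Measure.prod_prod, ENNReal.mul_inv] <;> simp [hS]

variable {Ω : Type*} [MeasurableSpace Ω] {P : Measure Ω} {X H N : Ω → ℂ} {c : ℂ} {σ : ℝ}

lemma IsRayleighRiceChannel.le_avgMMSE_inftyPAM [IsProbabilityMeasure P]
    (hch : IsRayleighRiceChannel P X H N c σ) (hlaw : P.map X = inftyPAM) {s : ℝ} (hs : 0 < s)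
    (m : ℕ) :
    (2 * (m + 1) / (2 * (m + 1) + 1)) ^ 2 / (2 * s) * (1 - gainTransform c σ (2 * s / (m + 1))) ≤
      avgMMSE P X H N s := by
  have hL : 0 < √(3 : ℝ) := by positivity
  have := isProbabilityMeasure_uniformLaw hL
  have h := hch.line_le_avgMMSE (ν := uniformLaw (√3)) hlaw (memLp_uniformLaw hL continuous_id)
    (continuous_weightDeriv _ m).measurable (continuous_weight _ m).measurable
    (memLp_uniformLaw hL (continuous_weightDeriv _ m)) (memLp_uniformLaw hL (continuous_weight _ m))
    (steinPair_weight hL m) hs (integral_mul_weightDeriv hL m)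
    (integral_weightDeriv_sq_le hL (by rw [Real.sq_sqrt] <;> norm_num) m) (by positivity)
    (integral_weight_sq_le hL m) one_pos
  simpa only [neg_sq, mul_one] using h

lemma IsRayleighRiceChannel.le_avgMMSE_inftyQAM [IsProbabilityMeasure P]
    (hch : IsRayleighRiceChannel P X H N c σ) (hlaw : P.map X = inftyQAM) {s : ℝ} (hs : 0 < s)
    (m : ℕ) :
    (2 * (m + 1) / (2 * (m + 1) + 1)) ^ 2 / s * (1 - gainTransform c σ (2 * s / (m + 1))) ≤
      avgMMSE P X H N s := by
  have hL : 0 < √(3 / 2 : ℝ) := by positivity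
  have := isProbabilityMeasure_uniformLaw hL
  have h := hch.square_le_avgMMSE (ν := uniformLaw (√(3 / 2))) (hlaw.trans inftyQAM_eq)
    (memLp_uniformLaw hL continuous_id)
    (continuous_weightDeriv _ m).measurable (continuous_weight _ m).measurable
    (memLp_uniformLaw hL (continuous_weightDeriv _ m)) (memLp_uniformLaw hL (continuous_weight _ m))
    (steinPair_weight hL m) hs (integral_mul_weightDeriv hL m)
    (integral_weightDeriv_sq_le hL (by rw [Real.sq_sqrt] <;> norm_num) m) (by positivity)
    (integral_weight_sq_le hL m) one_pos
  simpa only [neg_sq, mul_one] using h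

lemma IsRayleighRiceChannel.le_avgMMSE_gaussian [IsProbabilityMeasure P]
    (hch : IsRayleighRiceChannel P X H N c σ) (hlaw : P.map X = complexNormal 0 1) {s : ℝ}
    (hs : 0 < s) : 1 / s * (1 - gainTransform c σ s) ≤ avgMMSE P X H N s := by
  have hid := memLp_id_gaussianReal' (μ := 0) (v := (1 / 2 : ℝ).toNNReal) 2 (by norm_num)
  have hsq : ∫ τ, τ ^ 2 ∂(gaussianReal 0 (1 / 2 : ℝ).toNNReal) = 1 / 2 := by
    rw [integral_sq_gaussianReal_zero, Real.coe_toNNReal _ (by norm_num)]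
  -- With variance 1/2, A = -2·(1/2) = -1 and B = 4·(1/2) = 2, so the argument 2sD/B of the
  -- transform is exactly s.
  have h := hch.square_le_avgMMSE (ν := gaussianReal 0 (1 / 2 : ℝ).toNNReal) hlaw hid
    (r := fun τ => -2 * τ) (g := fun _ => 1) (by fun_prop) (by fun_prop) (hid.const_mul (-2))
    (memLp_const 1) steinPair_gaussian (A := -1) (B := 2) (D := 1) hs ?_ ?_ two_pos ?_ one_pos
  · simpa using h
  · have e : ∀ τ : ℝ, τ * (-2 * τ) = -2 * τ ^ 2 := fun τ => by ring
    simp_rw [e]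
    rw [integral_const_mul, hsq]; norm_num
  · have e : ∀ τ : ℝ, (-2 * τ) ^ 2 = 4 * τ ^ 2 := fun τ => by ring
    simp_rw [e]
    rw [integral_const_mul, hsq]; norm_num
  · simp

end Uniform

/-! ### Upper bounds from channel inversion and from the linear estimator. -/

section Upper

variable {Ω : Type*} [MeasurableSpace Ω] {P : Measure Ω} {X H N : Ω → ℂ} {c : ℂ} {σ : ℝ}

lemma integrable_noise_channelLaw {μX : Measure ℂ} [IsProbabilityMeasure μX] {F : ℂ → ℝ}
    (hF : Integrable F (complexNormal 0 1)) :
    Integrable (fun z : ℂ × ℂ × ℂ => F z.2.2) (channelLaw μX c σ) :=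
  (hF.comp_snd μX).comp_snd (complexNormal c (2 * σ ^ 2))

/-- The estimator y/√s of hx has error -n/√s, whatever the input law. -/
lemma IsRayleighRiceChannel.avgMMSE_le_one_div [IsProbabilityMeasure P]
    (hch : IsRayleighRiceChannel P X H N c σ) (hX : MemLp (fun x : ℂ => x) 2 (P.map X)) {s : ℝ}
    (hs : 0 < s) : avgMMSE P X H N s ≤ 1 / s := by
  have : IsProbabilityMeasure (P.map X) :=
    Measure.isProbabilityMeasure_map hch.measurable_input.aemeasurable
  have h := hch.avgMMSE_le_integral_bound hX s (f := fun z => z.1 / (√s : ℂ)) (by fun_prop)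
    (Q := fun _ _ n => 1 / s * ‖n‖ ^ 2) (q := fun _ => 1 / s)
    (integrable_noise_channelLaw ((integrable_norm_pow_complexNormal 0 1 2).const_mul _))
    (ae_of_all _ fun x h n => le_of_eq ?_) (integrable_const _)
    (fun h => ae_of_all _ fun x => le_of_eq ?_)
  · simpa using h
  · have h0 : (√s : ℂ) ≠ 0 := by simpa using (Real.sqrt_pos.2 hs).ne'
    have e : h * x - ((√s : ℂ) * h * x + n) / (√s : ℂ) = -(n / (√s : ℂ)) := by field_simp; ring
    rw [e, norm_neg, norm_div, Complex.norm_real, div_pow, Real.norm_eq_abs, sq_abs,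
      Real.sq_sqrt hs.le]
    ring
  · rw [integral_const_mul, integral_norm_sq_complexNormal zero_le_one, mul_one]

lemma integral_re_mul_sq_complexNormal (ζ : ℂ) :
    ∫ n, (ζ * n).re ^ 2 ∂(complexNormal 0 1) = ‖ζ‖ ^ 2 / 2 := by
  have e : ∀ n : ℂ, (ζ * n).re ^ 2 = ζ.re ^ 2 * n.re ^ 2 + ζ.im ^ 2 * n.im ^ 2 +
      -(2 * ζ.re * ζ.im) * (n.re * n.im) := fun n => by rw [Complex.mul_re]; ring
  simp_rw [e]
  have i1 := (integrable_re_sq_complexNormal 0 1).const_mul (ζ.re ^ 2)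
  have i2 := (integrable_im_sq_complexNormal 0 1).const_mul (ζ.im ^ 2)
  have i3 := (integrable_re_mul_im_complexNormal 0 1).const_mul (-(2 * ζ.re * ζ.im))
  have i4 : Integrable (fun n : ℂ => ζ.re ^ 2 * n.re ^ 2 + ζ.im ^ 2 * n.im ^ 2)
    (complexNormal 0 1) := i1.add i2
  rw [integral_add i4 i3, integral_add i1 i2, integral_const_mul, integral_const_mul,
    integral_const_mul, integral_re_sq_complexNormal zero_le_one,
    integral_im_sq_complexNormal zero_le_one, integral_re_mul_im_complexNormal,
    ← Complex.normSq_eq_norm_sq, Complex.normSq_apply]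
  simp
  ring

/-- Since x is real, projecting the inverted channel output to its real part discards half of the
noise power. -/
lemma IsRayleighRiceChannel.avgMMSE_le_inftyPAM [IsProbabilityMeasure P]
    (hch : IsRayleighRiceChannel P X H N c σ) (hlaw : P.map X = inftyPAM) {s : ℝ}
    (hs : 0 < s) : avgMMSE P X H N s ≤ 1 / (2 * s) := by
  have : IsProbabilityMeasure (P.map X) :=
    Measure.isProbabilityMeasure_map hch.measurable_input.aemeasurable
  have hL : 0 < √(3 : ℝ) := by positivity
  have hX : MemLp (fun x : ℂ => x) 2 (P.map X) := by
    rw [hlaw]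
    exact memLp_map_ofReal (ν := uniformLaw (√3)) measurable_id
      (memLp_ofReal (memLp_uniformLaw hL continuous_id))
  have hreal : ∀ᵐ x : ℂ ∂(P.map X), ∃ τ : ℝ, x = (τ : ℂ) := by
    rw [hlaw, inftyPAM]
    have hemb := Complex.isometry_ofReal.isClosedEmbedding.measurableEmbedding
    exact hemb.ae_map_iff.2 (ae_of_all (uniformLaw (√3)) fun τ => ⟨τ, rfl⟩)
  set ζ : ℂ → ℂ := fun h => (h * (√s : ℂ))⁻¹ with hζ
  set Q : ℂ → ℂ → ℂ → ℝ := fun h _ n => ‖h‖ ^ 2 * (ζ h * n).re ^ 2 with hQ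
  -- An equality except at h = 0, where the inverse is 0 by convention; there hx = 0 is estimated
  -- without error.
  have hnorm : ∀ h, ‖h‖ ^ 2 * ‖ζ h‖ ^ 2 ≤ 1 / s := fun h => by
    rcases eq_or_ne h 0 with rfl | h0
    · simp [hs.le]
    · have : ‖h‖ ≠ 0 := by simpa using h0
      rw [hζ, norm_inv, norm_mul, Complex.norm_real, Real.norm_eq_abs, inv_pow, mul_pow, sq_abs,
        Real.sq_sqrt hs.le]
      apply le_of_eq
      field_simp
  have h := hch.avgMMSE_le_integral_bound hX s
    (f := fun z => z.2 * (((z.2 * (√s : ℂ))⁻¹ * z.1).re : ℂ)) (by fun_prop)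
    (Q := Q) (q := fun _ => 1 / (2 * s)) ?_ ?_ (integrable_const _)
    (fun h => ae_of_all _ fun x => ?_)
  · simpa using h
  · refine (integrable_noise_channelLaw (μX := P.map X)
      ((integrable_norm_pow_complexNormal 0 1 2).const_mul (1 / s))).mono'
      (Measurable.aestronglyMeasurable (by fun_prop)) (ae_of_all _ fun z => ?_)
    rw [Real.norm_of_nonneg (by positivity)]
    have h1 : (ζ z.1 * z.2.2).re ^ 2 ≤ ‖ζ z.1 * z.2.2‖ ^ 2 := by
      rw [← sq_abs]
      gcongr
      exact Complex.abs_re_le_norm _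
    calc ‖z.1‖ ^ 2 * (ζ z.1 * z.2.2).re ^ 2 ≤ ‖z.1‖ ^ 2 * ‖ζ z.1 * z.2.2‖ ^ 2 := by gcongr
      _ = (‖z.1‖ ^ 2 * ‖ζ z.1‖ ^ 2) * ‖z.2.2‖ ^ 2 := by rw [norm_mul]; ring
      _ ≤ 1 / s * ‖z.2.2‖ ^ 2 := by gcongr; exact hnorm _
  · filter_upwards [hreal] with x hx h n
    obtain ⟨τ, rfl⟩ := hx
    rcases eq_or_ne h 0 with rfl | h0
    · simp [hQ]
    · have hs0 : (√s : ℂ) ≠ 0 := by simpa using (Real.sqrt_pos.2 hs).ne'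
      have e : (h * (√s : ℂ))⁻¹ * ((√s : ℂ) * h * τ + n) = τ + ζ h * n := by
        simp only [hζ]; field_simp
      simp only [hQ, e, Complex.add_re, Complex.ofReal_re, Complex.ofReal_add]
      rw [mul_add, sub_add_cancel_left, norm_neg, norm_mul, Complex.norm_real, mul_pow,
        Real.norm_eq_abs, sq_abs]
  · simp only [hQ]
    rw [integral_const_mul, integral_re_mul_sq_complexNormal]
    calc ‖h‖ ^ 2 * (‖ζ h‖ ^ 2 / 2) = ‖h‖ ^ 2 * ‖ζ h‖ ^ 2 / 2 := by ring
      _ ≤ 1 / s / 2 := by gcongr; exact hnorm h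
      _ = 1 / (2 * s) := by field_simp

/-- Uses the posterior mean h·√s·conj(h)·y/(1+s|h|²). Its error is h(x - √s conj(h) n)/(1+s|h|²), of
mean square |h|²/(1+s|h|²) at fixed gain, so this upper bound coincides with the Cramér-Rao bound.
-/
lemma IsRayleighRiceChannel.avgMMSE_le_gaussian [IsProbabilityMeasure P]
    (hch : IsRayleighRiceChannel P X H N c σ) (hlaw : P.map X = complexNormal 0 1) {s : ℝ}
    (hs : 0 < s) : avgMMSE P X H N s ≤ 1 / s * (1 - gainTransform c σ s) := by
  have hX : MemLp (fun x : ℂ => x) 2 (P.map X) := by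
    rw [hlaw]; exact memLp_id_complexNormal 0 1 (by norm_num)
  have : IsProbabilityMeasure (P.map X) :=
    Measure.isProbabilityMeasure_map hch.measurable_input.aemeasurable
  have hval := integral_norm_sq_div_gain c σ hs one_pos one_pos
  rw [mul_one, div_one] at hval
  rw [← hval]
  have hden : ∀ h : ℂ, 0 < 1 + s * ‖h‖ ^ 2 := fun h => by positivity
  have hq : Integrable (fun h : ℂ => ‖h‖ ^ 2 / (1 + s * ‖h‖ ^ 2 * 1))
      (complexNormal c (2 * σ ^ 2)) := by
    refine (integrable_norm_pow_complexNormal c (2 * σ ^ 2) 2).mono'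
      (Measurable.aestronglyMeasurable (by fun_prop)) (ae_of_all _ fun h => ?_)
    rw [mul_one, Real.norm_of_nonneg (by positivity)]
    exact div_le_self (by positivity) (by have : 0 ≤ s * ‖h‖ ^ 2 := by positivity
                                          linarith)
  set a : ℂ → ℝ := fun h => ‖h‖ ^ 2 / (1 + s * ‖h‖ ^ 2) ^ 2 with ha
  have ham : Measurable a := by fun_prop
  have hs2 : (√s : ℂ) * (√s : ℂ) = s := by
    rw [← Complex.ofReal_mul, Real.mul_self_sqrt hs.le]
  have herr : ∀ h x n : ℂ, ‖h * x - h * ((√s : ℂ) * conj h * ((√s : ℂ) * h * x + n) /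
      ((1 + s * ‖h‖ ^ 2 : ℝ) : ℂ))‖ ^ 2 = a h * ‖x - (√s : ℂ) * conj h * n‖ ^ 2 := fun h x n => by
    have h1 : ((1 + s * ‖h‖ ^ 2 : ℝ) : ℂ) ≠ 0 := by exact_mod_cast (hden h).ne'
    have h2 : h * conj h = (‖h‖ ^ 2 : ℂ) := by rw [Complex.mul_conj']
    have e : h * x - h * ((√s : ℂ) * conj h * ((√s : ℂ) * h * x + n) /
        ((1 + s * ‖h‖ ^ 2 : ℝ) : ℂ)) =
        h / ((1 + s * ‖h‖ ^ 2 : ℝ) : ℂ) * (x - (√s : ℂ) * conj h * n) := by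
      rw [mul_div_assoc', div_mul_eq_mul_div, eq_div_iff h1, sub_mul, div_mul_cancel₀ _ h1]
      push_cast
      rw [← h2, ← hs2]
      ring
    rw [e, norm_mul, mul_pow, norm_div, div_pow, Complex.norm_real, Real.norm_of_nonneg (hden h).le]
  -- A crude majorant whose only purpose is integrability.
  have hQb : ∀ h x n : ℂ, a h * ‖x - (√s : ℂ) * conj h * n‖ ^ 2 ≤
      2 * ‖h‖ ^ 2 * ‖x‖ ^ 2 + 2 * s * ‖h‖ ^ 4 * ‖n‖ ^ 2 := fun h x n => by
    have h1 : a h ≤ ‖h‖ ^ 2 := div_le_self (by positivity) (one_le_pow₀ (by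
      have : 0 ≤ s * ‖h‖ ^ 2 := by positivity
      linarith))
    have h2 : ‖x - (√s : ℂ) * conj h * n‖ ^ 2 ≤ 2 * ‖x‖ ^ 2 + 2 * s * ‖h‖ ^ 2 * ‖n‖ ^ 2 := by
      have h3 := norm_sub_le x ((√s : ℂ) * conj h * n)
      have h4 : ‖(√s : ℂ) * conj h * n‖ ^ 2 = s * ‖h‖ ^ 2 * ‖n‖ ^ 2 := by
        rw [norm_mul, norm_mul, RCLike.norm_conj, Complex.norm_real, Real.norm_eq_abs, mul_pow,
          mul_pow, sq_abs, Real.sq_sqrt hs.le]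
      have h5 := norm_nonneg (x - (√s : ℂ) * conj h * n)
      nlinarith [sq_nonneg (‖x‖ - ‖(√s : ℂ) * conj h * n‖)]
    calc a h * ‖x - (√s : ℂ) * conj h * n‖ ^ 2
        ≤ ‖h‖ ^ 2 * (2 * ‖x‖ ^ 2 + 2 * s * ‖h‖ ^ 2 * ‖n‖ ^ 2) := by gcongr
      _ = _ := by ring
  have hcm : Measurable (starRingEnd ℂ) := Complex.continuous_conj.measurable
  refine hch.avgMMSE_le_integral_bound' hX s
    (f := fun z => z.2 * ((√s : ℂ) * conj z.2 * z.1 / ((1 + s * ‖z.2‖ ^ 2 : ℝ) : ℂ))) ?_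
    (Q := fun h x n => a h * ‖x - (√s : ℂ) * conj h * n‖ ^ 2) ?_
    (ae_of_all _ fun x h n => (herr h x n).le) hq ?_
  · exact measurable_snd.mul ((((hcm.comp measurable_snd).const_mul _).mul measurable_fst).div
      (by fun_prop))
  · have i1 : Integrable (fun z : ℂ × ℂ × ℂ => 2 * ‖z.1‖ ^ 2 * ‖z.2.1‖ ^ 2)
        (channelLaw (P.map X) c σ) :=
      ((integrable_norm_pow_complexNormal c (2 * σ ^ 2) 2).const_mul 2).mul_prod
        (g := fun w : ℂ × ℂ => ‖w.1‖ ^ 2)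
        ((integrable_norm_sq_of_memLp_two hX).comp_fst (complexNormal 0 1))
    have i2 : Integrable (fun z : ℂ × ℂ × ℂ => 2 * s * ‖z.1‖ ^ 4 * ‖z.2.2‖ ^ 2)
        (channelLaw (P.map X) c σ) :=
      ((integrable_norm_pow_complexNormal c (2 * σ ^ 2) 4).const_mul (2 * s)).mul_prod
        (g := fun w : ℂ × ℂ => ‖w.2‖ ^ 2)
        ((integrable_norm_pow_complexNormal 0 1 2).comp_snd (P.map X))
    refine (i1.add i2).mono' ?_ (ae_of_all _ fun z => ?_)
    · refine Measurable.aestronglyMeasurable ((ham.comp measurable_fst).mul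
        (Measurable.pow_const (Measurable.norm ?_) 2))
      exact Measurable.sub (by fun_prop)
        (((hcm.comp measurable_fst).const_mul _).mul (by fun_prop))
    · rw [Real.norm_of_nonneg (by positivity)]
      exact hQb _ _ _
  · intro h _
    rw [hlaw]
    have i1 := (integrable_norm_pow_complexNormal 0 1 2).comp_fst (complexNormal 0 1)
    have i2 := ((integrable_norm_pow_complexNormal 0 1 2).comp_snd
      (complexNormal 0 1)).const_mul (s * ‖h‖ ^ 2)
    have hid : Integrable (fun n : ℂ => n) (complexNormal 0 1) :=
      (memLp_id_complexNormal 0 1 (p := 1) ENNReal.one_ne_top).integrable le_rfl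
    have hconj : Integrable (fun n : ℂ => conj n) (complexNormal 0 1) :=
      (memLp_one_iff_integrable.2 hid).star.integrable le_rfl
    have i3' := hconj.mul_prod (hid.const_mul ((√s : ℂ) * conj h))
    have i3 := i3'.re
    simp only [RCLike.re_to_complex] at i3
    have v3 : ∫ w : ℂ × ℂ, (conj w.1 * ((√s : ℂ) * conj h * w.2)).re
        ∂((complexNormal 0 1).prod (complexNormal 0 1)) = 0 := by
      refine (Complex.reCLM.integral_comp_comm i3').trans ?_
      rw [integral_prod_mul (fun x : ℂ => conj x) (fun n : ℂ => (√s : ℂ) * conj h * n),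
        integral_const_mul, integral_id_complexNormal]
      simp
    have e : ∀ w : ℂ × ℂ, a h * ‖w.1 - (√s : ℂ) * conj h * w.2‖ ^ 2 =
        a h * (‖w.1‖ ^ 2 + s * ‖h‖ ^ 2 * ‖w.2‖ ^ 2 -
          2 * (conj w.1 * ((√s : ℂ) * conj h * w.2)).re) := fun w => by
      rw [norm_sub_sq_real, Complex.inner, mul_comm (conj w.1), norm_mul ((√s : ℂ) * conj h),
        norm_mul (√s : ℂ), RCLike.norm_conj, Complex.norm_real, Real.norm_eq_abs, mul_pow, mul_pow,
        sq_abs, Real.sq_sqrt hs.le]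
      ring
    have i4 : Integrable (fun w : ℂ × ℂ => ‖w.1‖ ^ 2 + s * ‖h‖ ^ 2 * ‖w.2‖ ^ 2)
      ((complexNormal 0 1).prod (complexNormal 0 1)) := i1.add i2
    simp_rw [e]
    rw [integral_const_mul, integral_sub i4 (i3.const_mul 2), integral_add i1 i2,
      integral_const_mul, integral_const_mul, v3, integral_fun_fst (fun x : ℂ => ‖x‖ ^ 2),
      integral_fun_snd (fun x : ℂ => ‖x‖ ^ 2), integral_norm_sq_complexNormal zero_le_one]
    simp only [probReal_univ, one_smul, mul_zero, sub_zero, mul_one, ha]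
    apply le_of_eq
    have := (hden h).ne'
    field_simp

end Upper

/-! ### The tangential score on the circle and a Newton projection step. -/

section Circle

variable {Ω : Type*} [MeasurableSpace Ω] {P : Measure Ω} {X H N : Ω → ℂ} {c : ℂ} {σ : ℝ}

lemma integral_inftyPSK {E : Type*} [NormedAddCommGroup E] [NormedSpace ℝ E] {F : ℂ → E}
    (hF : StronglyMeasurable F) :
    ∫ x, F x ∂inftyPSK = (2 * Real.pi)⁻¹ • ∫ θ in (0 : ℝ)..(2 * Real.pi),
      F (Complex.exp (θ * Complex.I)) := by
  rw [inftyPSK, integral_map (by fun_prop) hF.aestronglyMeasurable,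
    integral_cond_Ioc Real.two_pi_pos, sub_zero]

lemma ae_norm_inftyPSK : ∀ᵐ x ∂inftyPSK, ‖x‖ = 1 := by
  rw [inftyPSK, ae_map_iff (by fun_prop) (measurableSet_eq_fun (by fun_prop) (by fun_prop))]
  exact ae_of_all _ fun θ => Complex.norm_exp_ofReal_mul_I θ

instance : IsProbabilityMeasure inftyPSK := by
  have : IsProbabilityMeasure (ProbabilityTheory.cond (volume : Measure ℝ)
      (Set.Ioc 0 (2 * Real.pi))) := by
    refine cond_isProbabilityMeasure_of_finite ?_ ?_ <;> rw [Real.volume_Ioc]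
    · simp [Real.pi_pos]
    · exact ENNReal.ofReal_ne_top
  exact Measure.isProbabilityMeasure_map (by fun_prop)

lemma memLp_inftyPSK {f : ℂ → ℂ} (hf : Measurable f) {C : ℝ} (hC : ∀ x, ‖x‖ = 1 → ‖f x‖ ≤ C) :
    MemLp f 2 inftyPSK := by
  refine MemLp.of_bound hf.aestronglyMeasurable C ?_
  filter_upwards [ae_norm_inftyPSK] with x hx using hC x hx

/-- On the circle the integrand is the θ-derivative of the kernel times the tangent vector
i·exp(iθ), so periodicity makes its integral vanish without any weight. This is why ∞-PSK has a
better rate than ∞-PAM. -/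
lemma integral_score_inftyPSK (α y : ℂ) : ∫ x, Real.exp (-‖y - α * x‖ ^ 2) •
    (-x + -(x ^ 2) * conj (y - α * x) * α + 1 * (y - α * x) * conj α) ∂inftyPSK = 0 := by
  have hcm : Measurable (starRingEnd ℂ) := Complex.continuous_conj.measurable
  rw [integral_inftyPSK]
  swap
  · have h1 : Measurable fun x => y - α * x := by fun_prop
    have h2 : Measurable fun x => Real.exp (-‖y - α * x‖ ^ 2) := by fun_prop
    exact (h2.smul ((Measurable.add (by fun_prop) (((by fun_prop : Measurable fun x : ℂ =>
      -(x ^ 2)).mul (hcm.comp h1)).mul_const _)).add ((h1.const_mul _).mul_const _))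
      ).stronglyMeasurable
  set e : ℝ → ℂ := fun θ => Complex.exp (θ * Complex.I) with he
  have hed : ∀ θ, HasDerivAt e (e θ * Complex.I) θ := fun θ => by
    have h := ((Complex.ofRealCLM.hasDerivAt (x := θ)).mul_const Complex.I).cexp
    refine h.congr_deriv ?_
    simp [he]
  have hec : Continuous e := by fun_prop
  have hF : ∀ θ, HasDerivAt (fun θ => Real.exp (-‖y - α * e θ‖ ^ 2) • (Complex.I * e θ))
      (Real.exp (-‖y - α * e θ‖ ^ 2) • (-(e θ) + -(e θ ^ 2) * conj (y - α * e θ) * α +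
        1 * (y - α * e θ) * conj α)) θ := fun θ => by
    have h := (hasDerivAt_exp_neg_norm_sq y α (hed θ)).smul ((hed θ).const_mul Complex.I)
    refine h.congr_deriv ?_
    have h1 : conj (e θ) * e θ = 1 := by
      rw [Complex.conj_mul', Complex.norm_exp_ofReal_mul_I]; simp
    generalize e θ = x at h1 ⊢
    have h2 : ((2 * (conj (y - α * x) * (α * (x * Complex.I))).re : ℝ) : ℂ) =
        conj (y - α * x) * (α * (x * Complex.I)) +
          (y - α * x) * (conj α * (conj x * -Complex.I)) := by
      have := Complex.add_conj (conj (y - α * x) * (α * (x * Complex.I)))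
      push_cast at this ⊢
      rw [← this]
      simp only [map_mul, Complex.conj_conj, Complex.conj_I]
    generalize y - α * x = n at h2 ⊢
    simp only [Complex.real_smul, Complex.ofReal_mul (Real.exp _), h2]
    have hI := Complex.I_mul_I
    linear_combination (Complex.exp (0:ℂ) * 0 + ((Real.exp (-‖n‖ ^ 2) : ℝ) : ℂ) *
      (x + x ^ 2 * conj n * α - n * conj α * conj x * x)) * hI +
      ((Real.exp (-‖n‖ ^ 2) : ℝ) : ℂ) * n * conj α * h1
  have hcont : Continuous fun θ => Real.exp (-‖y - α * e θ‖ ^ 2) •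
      (-(e θ) + -(e θ ^ 2) * conj (y - α * e θ) * α + 1 * (y - α * e θ) * conj α) := by
    have h1 : Continuous fun θ => y - α * e θ := by fun_prop
    have h2 := Complex.continuous_conj.comp h1
    have h3 : Continuous fun θ => conj (y - α * e θ) := h2
    fun_prop
  rw [intervalIntegral.integral_eq_sub_of_hasDerivAt (fun θ _ => hF θ)
    (hcont.intervalIntegrable _ _)]
  have h0 : e (2 * Real.pi) = e 0 := by
    simp only [he]; push_cast; rw [Complex.exp_two_pi_mul_I]; simp
  rw [h0, sub_self, smul_zero]

lemma IsRayleighRiceChannel.le_avgMMSE_inftyPSK [IsProbabilityMeasure P]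
    (hch : IsRayleighRiceChannel P X H N c σ) (hlaw : P.map X = inftyPSK) {s : ℝ} (hs : 0 < s) :
    1 / (2 * s) * (1 - gainTransform c σ (2 * s)) ≤ avgMMSE P X H N s := by
  have hX : MemLp (fun x : ℂ => x) 2 (P.map X) := by
    rw [hlaw]; exact memLp_inftyPSK measurable_id (C := 1) fun x hx => hx.le
  have h := hch.score_le_avgMMSE hX (a := fun x => -x) (p := fun x => -(x ^ 2)) (q := fun _ => 1)
    (by fun_prop) (by fun_prop) (by fun_prop) hX.neg
    (by rw [hlaw]; exact memLp_inftyPSK (by fun_prop) (C := 1) fun x hx => by simp [hx])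
    (memLp_const_iff (by norm_num) (by norm_num) |>.2 (Or.inr (by rw [hlaw]; simp)))
    (by rw [hlaw]; exact integral_score_inftyPSK)
    (A := -1) (B := 1) (C := 2) hs ?_ ?_ one_pos ?_
  · rw [integral_const_mul, integral_norm_sq_div_gain c σ hs one_pos two_pos] at h
    refine le_trans (le_of_eq ?_) h
    rw [mul_comm s 2]
    norm_num
  · rw [hlaw]
    have : ∀ᵐ x ∂inftyPSK, ⟪x, -x⟫_ℝ = -1 := by
      filter_upwards [ae_norm_inftyPSK] with x hx
      rw [inner_neg_right, real_inner_self_eq_norm_sq, hx]; norm_num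
    rw [integral_congr_ae this]; simp
  · rw [hlaw]
    have : ∀ᵐ x ∂inftyPSK, ‖-x‖ ^ 2 = 1 := by
      filter_upwards [ae_norm_inftyPSK] with x hx
      rw [norm_neg, hx]; norm_num
    rw [integral_congr_ae this]; simp
  · rw [hlaw]
    have : ∀ᵐ x ∂inftyPSK, ‖-(x ^ 2)‖ ^ 2 + ‖(1 : ℂ)‖ ^ 2 = 2 := by
      filter_upwards [ae_norm_inftyPSK] with x hx
      rw [norm_neg, norm_pow, hx]; norm_num
    rw [integral_congr_ae this]; simp

/-- One Newton step towards the projection onto the unit circle. -/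
lemma norm_one_sub_newton_sq_le (w : ℂ) :
    ‖1 - (1 + w) * ((3 - ‖1 + w‖ ^ 2) / 2 : ℝ)‖ ^ 2 ≤
      w.im ^ 2 - 2 * w.re * w.im ^ 2 + 10 * (‖w‖ ^ 4 + ‖w‖ ^ 6) := by
  set a := w.re with ha
  set b := w.im with hb
  have h1 : ‖w‖ ^ 2 = a ^ 2 + b ^ 2 := by
    rw [← Complex.normSq_eq_norm_sq, Complex.normSq_apply]; ring
  have h2 : ‖1 + w‖ ^ 2 = 1 + 2 * a + (a ^ 2 + b ^ 2) := by
    rw [← Complex.normSq_eq_norm_sq, Complex.normSq_apply]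
    simp only [Complex.add_re, Complex.add_im, Complex.one_re, Complex.one_im, ← ha, ← hb]; ring
  have h4 : ‖w‖ ^ 4 = (a ^ 2 + b ^ 2) ^ 2 := by rw [← h1]; ring
  have h6 : ‖w‖ ^ 6 = (a ^ 2 + b ^ 2) ^ 3 := by rw [← h1]; ring
  rw [h2, h4, h6, ← Complex.normSq_eq_norm_sq, Complex.normSq_apply]
  simp only [Complex.sub_re, Complex.sub_im, Complex.mul_re, Complex.mul_im, Complex.add_re,
    Complex.add_im, Complex.one_re, Complex.one_im, Complex.ofReal_re, Complex.ofReal_im, ← ha, ← hb]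
  set m := a ^ 2 + b ^ 2 with hm
  have hA : 0 ≤ a ^ 2 := sq_nonneg a
  have hB : 0 ≤ b ^ 2 := sq_nonneg b
  have hm0 : 0 ≤ m := by positivity
  have ham : a ^ 2 ≤ m := by linarith
  have hbm : b ^ 2 ≤ m := by linarith
  have t1 : (m / 2 + a ^ 2 + a * m / 2) ^ 2 ≤ 3 * ((m / 2) ^ 2 + (a ^ 2) ^ 2 + (a * m / 2) ^ 2) := by
    nlinarith [sq_nonneg (m / 2 - a ^ 2), sq_nonneg (m / 2 - a * m / 2),
      sq_nonneg (a ^ 2 - a * m / 2)]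
  have t2 : (a ^ 2) ^ 2 ≤ m ^ 2 := by gcongr
  have t3 : a ^ 2 * m ^ 2 ≤ m * m ^ 2 := by gcongr
  have t4 : b ^ 2 * (a * m) ≤ m * ((1 + m) / 2 * m) := by
    have : a ≤ (1 + m) / 2 := by nlinarith [sq_nonneg (a - 1)]
    have : a * m ≤ (1 + m) / 2 * m := by gcongr
    have h0 : 0 ≤ (1 + m) / 2 * m := by positivity
    nlinarith
  have t5 : b ^ 2 * m ^ 2 ≤ m * m ^ 2 := by gcongr
  have t6 : 0 ≤ b ^ 2 * b ^ 2 := by positivity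
  have t7 : 0 ≤ m ^ 3 := by positivity
  -- The Newton step removes the radial error a to first order. What remains up to third order is b²
  -- - 2ab²; the fourth-order term b²(a² - m) = -b⁴ is dropped by sign, and all others are bounded
  -- by powers of m.
  have key : (1 - ((1 + a) * ((3 - (1 + 2 * a + m)) / 2) - (0 + b) * 0)) *
      (1 - ((1 + a) * ((3 - (1 + 2 * a + m)) / 2) - (0 + b) * 0)) +
      (0 - ((1 + a) * 0 + (0 + b) * ((3 - (1 + 2 * a + m)) / 2))) *
      (0 - ((1 + a) * 0 + (0 + b) * ((3 - (1 + 2 * a + m)) / 2))) =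
      (m / 2 + a ^ 2 + a * m / 2) ^ 2 + (b ^ 2 - 2 * a * b ^ 2) + b ^ 2 * (a ^ 2 - m) +
        b ^ 2 * (a * m) + b ^ 2 * m ^ 2 / 4 := by ring
  have t8 : b ^ 2 * (a ^ 2 - m) = -(b ^ 2 * b ^ 2) := by rw [hm]; ring
  rw [key, t8]
  nlinarith

end Circle

/-! ### The upper bound for inputs on the circle. -/

section CircleUpper

variable {Ω : Type*} [MeasurableSpace Ω] {P : Measure Ω} {X H N : Ω → ℂ} {c : ℂ} {σ : ℝ}

/-- The mean of the error bound of `norm_one_sub_newton_sq_le` under Gaussian noise. -/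
lemma integral_newton_bound (κ : ℂ) :
    ∫ n, ((κ * n).im ^ 2 - 2 * (κ * n).re * (κ * n).im ^ 2 +
      10 * (‖κ * n‖ ^ 4 + ‖κ * n‖ ^ 6)) ∂(complexNormal 0 1) =
      ‖κ‖ ^ 2 / 2 + 10 * (‖κ‖ ^ 4 * ∫ n, ‖n‖ ^ 4 ∂(complexNormal 0 1) +
        ‖κ‖ ^ 6 * ∫ n, ‖n‖ ^ 6 ∂(complexNormal 0 1)) := by
  have hpow : ∀ k : ℕ, Integrable (fun n : ℂ => ‖κ * n‖ ^ k) (complexNormal 0 1) := fun k => by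
    refine ((integrable_norm_pow_complexNormal 0 1 k).const_mul (‖κ‖ ^ k)).congr
      (ae_of_all _ fun n => ?_)
    simp only [norm_mul, mul_pow]
  have i1 : Integrable (fun n : ℂ => (κ * n).im ^ 2) (complexNormal 0 1) := by
    refine (hpow 2).mono' (Measurable.aestronglyMeasurable (by fun_prop)) (ae_of_all _ fun n => ?_)
    rw [Real.norm_of_nonneg (by positivity), ← sq_abs]
    gcongr
    exact Complex.abs_im_le_norm _
  have i2 : Integrable (fun n : ℂ => 2 * (κ * n).re * (κ * n).im ^ 2) (complexNormal 0 1) := by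
    refine ((hpow 3).const_mul 2).mono' (Measurable.aestronglyMeasurable (by fun_prop))
      (ae_of_all _ fun n => ?_)
    rw [norm_mul, norm_mul, norm_pow, Real.norm_eq_abs, Real.norm_eq_abs, Real.norm_eq_abs, abs_two]
    calc 2 * |(κ * n).re| * |(κ * n).im| ^ 2 ≤ 2 * ‖κ * n‖ * ‖κ * n‖ ^ 2 := by
          gcongr
          · exact Complex.abs_re_le_norm _
          · exact Complex.abs_im_le_norm _
      _ = _ := by ring
  have i3 : Integrable (fun n : ℂ => 10 * (‖κ * n‖ ^ 4 + ‖κ * n‖ ^ 6)) (complexNormal 0 1) :=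
    ((hpow 4).add (hpow 6)).const_mul 10
  have i4 : Integrable (fun n : ℂ => (κ * n).im ^ 2 - 2 * (κ * n).re * (κ * n).im ^ 2)
    (complexNormal 0 1) := i1.sub i2
  have e1 : ∀ n : ℂ, (κ * n).im ^ 2 = (-Complex.I * κ * n).re ^ 2 := fun n => by
    rw [mul_assoc]; simp
  -- The cubic term was kept exact because it is odd and averages to zero; an absolute bound on it
  -- would leave an error of order |κ|³ and spoil the exponent.
  rw [integral_add i4 i3, integral_sub i1 i2, integral_odd_complexNormal
    (F := fun n => 2 * (κ * n).re * (κ * n).im ^ 2) (fun z => by simp; ring), integral_const_mul,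
    integral_add (hpow 4) (hpow 6)]
  simp_rw [e1, integral_re_mul_sq_complexNormal, norm_mul, mul_pow, integral_const_mul]
  simp

/-- Here t = s|h|², and t⁻¹ ≤ 2/(1+t) for t ≥ 1 brings the remainder into the form whose gain
average is `gainTransform`. -/
lemma newton_bound_le {s t M M' : ℝ} (hs : 0 < s) (ht : 1 ≤ t) (hM : 0 ≤ M) (hM' : 0 ≤ M') :
    s⁻¹ * t * (t⁻¹ / 2 + 10 * (t⁻¹ ^ 2 * M + t⁻¹ ^ 3 * M')) ≤
      1 / s * (1 / 2 + (20 * (M + M') + 1) * (1 / (1 + t))) := by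
  have ht0 : 0 < t := by linarith
  have e1 : s⁻¹ * t * (t⁻¹ / 2 + 10 * (t⁻¹ ^ 2 * M + t⁻¹ ^ 3 * M')) =
      1 / s * (1 / 2 + 10 * (t⁻¹ * M + t⁻¹ * (t⁻¹ * M'))) := by field_simp
  have hti : t⁻¹ ≤ 1 := inv_le_one_of_one_le₀ ht
  have hti0 : 0 < t⁻¹ := inv_pos.2 ht0
  have h2 : t⁻¹ ≤ 2 * (1 / (1 + t)) := by
    rw [inv_eq_one_div, mul_one_div, div_le_div_iff₀ ht0 (by positivity)]; linarith
  have h3 : t⁻¹ * M' ≤ M' := mul_le_of_le_one_left hM' hti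
  rw [e1]
  refine mul_le_mul_of_nonneg_left ?_ (by positivity)
  have h4 : 10 * (t⁻¹ * M + t⁻¹ * (t⁻¹ * M')) ≤ t⁻¹ * (10 * (M + M')) := by
    have := mul_le_mul_of_nonneg_left h3 hti0.le
    linarith
  have h5 : t⁻¹ * (10 * (M + M')) ≤ 2 * (1 / (1 + t)) * (10 * (M + M')) :=
    mul_le_mul_of_nonneg_right h2 (by positivity)
  have h6 : 0 ≤ 1 / (1 + t) := by positivity
  linarith

/-- When s|h|² ≥ 1 the inverted output is moved one Newton step towards the circle, which removes
the radial half of the noise. The Newton step is unsafe for weak gains, so there plain inversion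
with error 1/s is kept; such gains are rare enough to be charged to J(s). -/
lemma IsRayleighRiceChannel.exists_avgMMSE_le_inftyPSK [IsProbabilityMeasure P]
    (hch : IsRayleighRiceChannel P X H N c σ) (hlaw : P.map X = inftyPSK) :
    ∃ K : ℝ, 0 ≤ K ∧ ∀ s : ℝ, 0 < s →
      avgMMSE P X H N s ≤ 1 / s * (1 / 2 + K * gainTransform c σ s) := by
  set M4 := ∫ n, ‖n‖ ^ 4 ∂(complexNormal 0 1) with hM4
  set M6 := ∫ n, ‖n‖ ^ 6 ∂(complexNormal 0 1) with hM6
  have hM40 : 0 ≤ M4 := integral_nonneg fun n => by positivity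
  have hM60 : 0 ≤ M6 := integral_nonneg fun n => by positivity
  -- The first summand covers the Newton remainder. The 1 covers t < 1, where 1 ≤ 1/2 + 1/(1+t).
  refine ⟨20 * (M4 + M6) + 1, by positivity, fun s hs => ?_⟩
  have hX : MemLp (fun x : ℂ => x) 2 (P.map X) := by
    rw [hlaw]; exact memLp_inftyPSK measurable_id (C := 1) fun x hx => hx.le
  have : IsProbabilityMeasure (P.map X) :=
    Measure.isProbabilityMeasure_map hch.measurable_input.aemeasurable
  have hnorm : ∀ᵐ x ∂(P.map X), ‖x‖ = 1 := by rw [hlaw]; exact ae_norm_inftyPSK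
  have hcm : Measurable (starRingEnd ℂ) := Complex.continuous_conj.measurable
  set ζ : ℂ → ℂ := fun h => (h * (√s : ℂ))⁻¹ with hζ
  have hζm : Measurable ζ := by fun_prop
  have hζn : ∀ h, ‖ζ h‖ ^ 2 = (s * ‖h‖ ^ 2)⁻¹ := fun h => by
    rw [hζ, norm_inv, norm_mul, Complex.norm_real, Real.norm_eq_abs, inv_pow, mul_pow, sq_abs,
        Real.sq_sqrt hs.le, mul_comm]
  set f : ℂ × ℂ → ℂ := fun z => if 1 ≤ s * ‖z.2‖ ^ 2 then
    z.2 * (ζ z.2 * z.1 * ((3 - ‖ζ z.2 * z.1‖ ^ 2) / 2 : ℝ)) else z.2 * (ζ z.2 * z.1) with hf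
  have hset : MeasurableSet {h : ℂ | 1 ≤ s * ‖h‖ ^ 2} :=
    measurableSet_le measurable_const (by fun_prop)
  have hfm : Measurable f := by
    refine Measurable.ite (measurable_snd hset) ?_ ?_ <;> fun_prop
  set B : ℂ → ℝ := fun w => w.im ^ 2 - 2 * w.re * w.im ^ 2 + 10 * (‖w‖ ^ 4 + ‖w‖ ^ 6) with hB
  have hBm : Measurable B := by fun_prop
  set Q : ℂ → ℂ → ℂ → ℝ := fun h x n => if 1 ≤ s * ‖h‖ ^ 2 then ‖h‖ ^ 2 * B (conj x * ζ h * n) else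
    1 / s * ‖n‖ ^ 2 with hQ
  have hQm : Measurable fun z : ℂ × ℂ × ℂ => Q z.1 z.2.1 z.2.2 := by
    refine Measurable.ite (measurable_fst hset) ?_ (by fun_prop)
    refine Measurable.mul (by fun_prop) (hBm.comp (Measurable.mul (Measurable.mul ?_ ?_) ?_))
    · exact hcm.comp (by fun_prop)
    · fun_prop
    · fun_prop
  have hq : Integrable (fun h : ℂ => 1 / s * (1 / 2 + (20 * (M4 + M6) + 1) * (1 / (1 + s * ‖h‖ ^ 2))))
      (complexNormal c (2 * σ ^ 2)) :=
    ((integrable_const (1 / 2)).add ((integrable_gainTransform c σ hs.le).const_mul _)).const_mul _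
  have hqv : ∫ h, 1 / s * (1 / 2 + (20 * (M4 + M6) + 1) * (1 / (1 + s * ‖h‖ ^ 2)))
      ∂(complexNormal c (2 * σ ^ 2)) = 1 / s * (1 / 2 + (20 * (M4 + M6) + 1) * gainTransform c σ s) := by
    rw [integral_const_mul, integral_add (integrable_const _)
      ((integrable_gainTransform c σ hs.le).const_mul _), integral_const_mul, gainTransform]
    simp
  rw [← hqv]
  refine hch.avgMMSE_le_integral_bound hX s hfm (Q := Q) ?_ ?_ hq fun h => ?_
  · have hpoly : Integrable (fun n : ℂ => 1 / s * (‖n‖ ^ 2 + 2 * ‖n‖ ^ 3 +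
        10 * (‖n‖ ^ 4 + ‖n‖ ^ 6))) (complexNormal 0 1) :=
      (((integrable_norm_pow_complexNormal 0 1 2).add
        ((integrable_norm_pow_complexNormal 0 1 3).const_mul 2)).add
        (((integrable_norm_pow_complexNormal 0 1 4).add
          (integrable_norm_pow_complexNormal 0 1 6)).const_mul 10)).const_mul _
    refine (integrable_noise_channelLaw (μX := P.map X) hpoly).mono' hQm.aestronglyMeasurable ?_
    filter_upwards [ae_channelLaw_of_ae_input (c := c) (σ := σ) hnorm] with z hz
    set n := z.2.2
    by_cases ht : 1 ≤ s * ‖z.1‖ ^ 2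
    · have hw : ‖conj z.2.1 * ζ z.1 * n‖ ^ 2 = (s * ‖z.1‖ ^ 2)⁻¹ * ‖n‖ ^ 2 := by
        rw [norm_mul, norm_mul, RCLike.norm_conj, hz, one_mul, mul_pow, hζn]
      have hzz : ‖z.1‖ ^ 2 = s⁻¹ * (s * ‖z.1‖ ^ 2) := by field_simp
      set t := s * ‖z.1‖ ^ 2 with htdef
      set w := conj z.2.1 * ζ z.1 * n
      have ht0 : 0 < t := by linarith
      have hwn : ‖w‖ ≤ ‖n‖ := by
        refine (pow_le_pow_iff_left₀ (norm_nonneg _) (norm_nonneg _) two_ne_zero).1 ?_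
        rw [hw]
        exact mul_le_of_le_one_left (by positivity) (inv_le_one_of_one_le₀ ht)
      have hBb : |B w| ≤ ‖w‖ ^ 2 * (1 + 2 * ‖n‖ + 10 * (‖n‖ ^ 2 + ‖n‖ ^ 4)) := by
        have b1 : w.im ^ 2 ≤ ‖w‖ ^ 2 := by
          rw [← sq_abs]; gcongr; exact Complex.abs_im_le_norm w
        have b2 : |2 * w.re * w.im ^ 2| ≤ 2 * ‖n‖ * ‖w‖ ^ 2 := by
          rw [abs_mul, abs_mul, abs_two, abs_of_nonneg (sq_nonneg w.im)]
          gcongr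
          exact (Complex.abs_re_le_norm w).trans hwn
        have b3 : ‖w‖ ^ 4 ≤ ‖w‖ ^ 2 * ‖n‖ ^ 2 := by
          calc ‖w‖ ^ 4 = ‖w‖ ^ 2 * ‖w‖ ^ 2 := by ring
            _ ≤ _ := by gcongr
        have b4 : ‖w‖ ^ 6 ≤ ‖w‖ ^ 2 * ‖n‖ ^ 4 := by
          calc ‖w‖ ^ 6 = ‖w‖ ^ 2 * ‖w‖ ^ 4 := by ring
            _ ≤ _ := by gcongr
        have b5 := abs_le.1 b2
        have b6 : 0 ≤ ‖w‖ ^ 4 := by positivity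
        have b7 : 0 ≤ ‖w‖ ^ 6 := by positivity
        have b8 := sq_nonneg w.im
        rw [abs_le]
        simp only [hB]
        constructor <;> nlinarith
      have hQe : Q z.1 z.2.1 n = ‖z.1‖ ^ 2 * B w := if_pos ht
      rw [hQe, norm_mul, Real.norm_of_nonneg (by positivity : 0 ≤ ‖z.1‖ ^ 2), Real.norm_eq_abs]
      calc ‖z.1‖ ^ 2 * |B w| ≤ ‖z.1‖ ^ 2 * (‖w‖ ^ 2 * (1 + 2 * ‖n‖ + 10 * (‖n‖ ^ 2 + ‖n‖ ^ 4))) := by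
            gcongr
        _ = 1 / s * (‖n‖ ^ 2 + 2 * ‖n‖ ^ 3 + 10 * (‖n‖ ^ 4 + ‖n‖ ^ 6)) := by
            rw [hw, hzz]; field_simp
    · have hQe : Q z.1 z.2.1 n = 1 / s * ‖n‖ ^ 2 := if_neg ht
      rw [hQe, Real.norm_of_nonneg (by positivity)]
      gcongr
      have : 0 ≤ 2 * ‖n‖ ^ 3 + 10 * (‖n‖ ^ 4 + ‖n‖ ^ 6) := by positivity
      linarith
  · filter_upwards [hnorm] with x hx h n
    have hs0 : (√s : ℂ) ≠ 0 := by simpa using (Real.sqrt_pos.2 hs).ne'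
    by_cases ht : 1 ≤ s * ‖h‖ ^ 2
    · have h0 : h ≠ 0 := by
        rintro rfl
        simp at ht
        linarith
      have hxx : x * conj x = 1 := by rw [Complex.mul_conj', hx]; simp
      have hu : ζ h * ((√s : ℂ) * h * x + n) = x * (1 + conj x * ζ h * n) := by
        have e1 : ζ h * ((√s : ℂ) * h * x) = x := by simp only [hζ]; field_simp
        have e2 : x * (1 + conj x * ζ h * n) = x + (x * conj x) * (ζ h * n) := by ring
        rw [mul_add, e1, e2, hxx, one_mul]
      have hfe : f ((√s : ℂ) * h * x + n, h) = h * (ζ h * ((√s : ℂ) * h * x + n) *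
          ((3 - ‖ζ h * ((√s : ℂ) * h * x + n)‖ ^ 2) / 2 : ℝ)) := if_pos ht
      have hQe : Q h x n = ‖h‖ ^ 2 * B (conj x * ζ h * n) := if_pos ht
      rw [hfe, hQe, hu]
      set w := conj x * ζ h * n
      have e3 : h * x - h * (x * (1 + w) * ((3 - ‖x * (1 + w)‖ ^ 2) / 2 : ℝ)) =
          h * x * (1 - (1 + w) * ((3 - ‖1 + w‖ ^ 2) / 2 : ℝ)) := by
        rw [norm_mul, hx, one_mul]; ring
      rw [e3, norm_mul, norm_mul, hx, mul_one, mul_pow]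
      gcongr
      exact norm_one_sub_newton_sq_le w
    · have hfe : f ((√s : ℂ) * h * x + n, h) = h * (ζ h * ((√s : ℂ) * h * x + n)) := if_neg ht
      have hQe : Q h x n = 1 / s * ‖n‖ ^ 2 := if_neg ht
      rw [hfe, hQe]
      rcases eq_or_ne h 0 with rfl | h0
      · have : 0 ≤ 1 / s * ‖n‖ ^ 2 := by positivity
        simpa using this
      · have e : h * x - h * (ζ h * ((√s : ℂ) * h * x + n)) = -(n / (√s : ℂ)) := by
          simp only [hζ]; field_simp; ring
        rw [e, norm_neg, norm_div, Complex.norm_real, div_pow, Real.norm_eq_abs, sq_abs,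
          Real.sq_sqrt hs.le]
        apply le_of_eq; ring
  · filter_upwards [hnorm] with x hx
    by_cases ht : 1 ≤ s * ‖h‖ ^ 2
    · have hQe : ∀ n, Q h x n = ‖h‖ ^ 2 * B (conj x * ζ h * n) := fun n => if_pos ht
      simp_rw [hQe]
      rw [integral_const_mul]
      simp only [hB]
      rw [integral_newton_bound]
      have hk2 : ‖conj x * ζ h‖ ^ 2 = (s * ‖h‖ ^ 2)⁻¹ := by
        rw [norm_mul, RCLike.norm_conj, hx, one_mul, hζn]
      have hk4 : ‖conj x * ζ h‖ ^ 4 = (s * ‖h‖ ^ 2)⁻¹ ^ 2 := by rw [← hk2]; ring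
      have hk6 : ‖conj x * ζ h‖ ^ 6 = (s * ‖h‖ ^ 2)⁻¹ ^ 3 := by rw [← hk2]; ring
      rw [hk2, hk4, hk6]
      have hzz : ‖h‖ ^ 2 = s⁻¹ * (s * ‖h‖ ^ 2) := by field_simp
      rw [hzz]
      have hzz' : s * (s⁻¹ * (s * ‖h‖ ^ 2)) = s * ‖h‖ ^ 2 := by field_simp
      rw [hzz']
      generalize s * ‖h‖ ^ 2 = t at ht ⊢
      exact newton_bound_le hs ht hM40 hM60
    · have hQe : ∀ n, Q h x n = 1 / s * ‖n‖ ^ 2 := fun n => if_neg ht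
      simp_rw [hQe]
      rw [integral_const_mul, integral_norm_sq_complexNormal zero_le_one]
      gcongr
      have h0 : 0 ≤ s * ‖h‖ ^ 2 := by positivity
      generalize s * ‖h‖ ^ 2 = t at ht h0 ⊢
      have h1 : 1 / 2 ≤ 1 / (1 + t) := by
        rw [div_le_div_iff₀ two_pos (by linarith)]; linarith [not_le.1 ht]
      have h2 : 0 ≤ (M4 + M6) * (1 / (1 + t)) := by positivity
      linarith

end CircleUpper

/-! ### From two-sided bounds to the stated powers of the signal-to-noise ratio. -/

section Rates

variable {c : ℂ} {σ : ℝ}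

lemma isBigO_one_div_rpow {F : ℝ → ℝ} {R C : ℝ} (h : ∀ s, 1 ≤ s → |F s| ≤ C * s ^ (-R)) :
    F =O[atTop] fun s : ℝ => 1 / s ^ R := by
  refine IsBigO.of_bound C ?_
  filter_upwards [eventually_ge_atTop 1] with s hs
  have h0 : (0 : ℝ) ≤ s := by linarith
  rw [Real.norm_eq_abs, Real.norm_of_nonneg (by positivity), one_div, ← Real.rpow_neg h0]
  exact h s hs

/-- The rate for inputs bounded below by a Cramér-Rao bound with free parameter `m`. -/
lemma isBigO_of_weight_bound (hσ : 0 < σ) {F : ℝ → ℝ} {d : ℝ} (hd : 0 < d)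
    (hup : ∀ s, 0 < s → F s ≤ 1 / (d * s))
    (hlo : ∀ s, 0 < s → ∀ m : ℕ, (2 * ((m : ℝ) + 1) / (2 * (m + 1) + 1)) ^ 2 / (d * s) *
      (1 - gainTransform c σ (2 * s / (m + 1))) ≤ F s)
    {R : ℝ} (hR : R ∈ Set.Ioo (1 : ℝ) (3 / 2)) :
    (fun s => F s - 1 / (d * s)) =O[atTop] fun s : ℝ => 1 / s ^ R := by
  -- The transform is evaluated at an argument of order √s, so its exponent has to be twice R - 1; a
  -- < 1 is then exactly R < 3/2.
  obtain ⟨K, hK0, hK⟩ := gainTransform_le c hσ (a := 2 * (R - 1))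
    ⟨by linarith [hR.1], by linarith [hR.2]⟩
  refine isBigO_one_div_rpow (C := (1 + K) / d) fun s hs => ?_
  have hs0 : 0 < s := by linarith
  have hq1 : 1 ≤ √s := Real.one_le_sqrt.2 hs
  -- Balances the bias 1/(m+1) of the weight against the transform at 2s/(m+1), which is small like
  -- a power close to 1 of m/s. For s ≥ 1 this argument is at least √s.
  set m := ⌊√s⌋₊ with hm
  have hm1 : √s ≤ m + 1 := (Nat.lt_floor_add_one _).le
  have hm2 : (m : ℝ) ≤ √s := Nat.floor_le (Real.sqrt_nonneg s)
  set J := gainTransform c σ (2 * s / (m + 1)) with hJ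
  have hJ0 : 0 ≤ J := gainTransform_nonneg c σ (by positivity)
  have hlow := hlo s hs0 m
  have hsr : √s = s ^ (1 / 2 : ℝ) := Real.sqrt_eq_rpow s
  have h1 : 1 / ((m : ℝ) + 1) ≤ s ^ (-(R - 1)) := by
    calc 1 / ((m : ℝ) + 1) ≤ 1 / √s := by gcongr
      _ = s ^ (-(1 / 2) : ℝ) := by rw [hsr, one_div, Real.rpow_neg hs0.le]
      _ ≤ s ^ (-(R - 1)) := Real.rpow_le_rpow_of_exponent_le hs (by linarith [hR.2])
  have h2 : J ≤ K * s ^ (-(R - 1)) := by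
    refine (hK _ (by positivity)).trans ?_
    gcongr
    have h3 : √s ≤ 2 * s / (m + 1) := by
      rw [le_div_iff₀ (by positivity)]
      have := Real.mul_self_sqrt hs0.le
      nlinarith
    calc (2 * s / ((m : ℝ) + 1)) ^ (-(2 * (R - 1))) ≤ √s ^ (-(2 * (R - 1))) :=
          Real.rpow_le_rpow_of_nonpos (by positivity) h3 (by linarith [hR.1])
      _ = s ^ (-(R - 1)) := by
          rw [hsr, ← Real.rpow_mul hs0.le]
          congr 1
          ring
  have hA : 1 - 1 / ((m : ℝ) + 1) ≤ (2 * ((m : ℝ) + 1) / (2 * (m + 1) + 1)) ^ 2 := by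
    have e : 2 * ((m : ℝ) + 1) / (2 * (m + 1) + 1) = 1 - 1 / (2 * (m + 1) + 1) := by field_simp; ring
    have e2 : 1 / (2 * ((m : ℝ) + 1) + 1) ≤ 1 / (2 * (m + 1)) := by gcongr; linarith
    have e3 : 1 / (2 * ((m : ℝ) + 1)) = 1 / 2 * (1 / (m + 1)) := by field_simp
    rw [e]
    nlinarith [sq_nonneg (1 / (2 * ((m : ℝ) + 1) + 1))]
  have hA0 : (2 * ((m : ℝ) + 1) / (2 * (m + 1) + 1)) ^ 2 ≤ 1 := by
    refine pow_le_one₀ (by positivity) ?_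
    rw [div_le_one (by positivity)]; linarith
  set A := (2 * ((m : ℝ) + 1) / (2 * (m + 1) + 1)) ^ 2
  have h4 : 1 - 1 / ((m : ℝ) + 1) - J ≤ A * (1 - J) := by nlinarith
  have h5 : 1 / (d * s) * (1 - 1 / ((m : ℝ) + 1) - J) ≤ F s := by
    refine le_trans ?_ hlow
    calc _ ≤ 1 / (d * s) * (A * (1 - J)) := by gcongr
      _ = _ := by ring
  have h6 : s ^ (-R) = s ^ (-(R - 1)) / s := by
    rw [show -R = -(R - 1) - 1 by ring, Real.rpow_sub_one hs0.ne']
  rw [abs_of_nonpos (by linarith [hup s hs0])]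
  have h7 : 1 / (d * s) - F s ≤ 1 / (d * s) * (1 / ((m : ℝ) + 1) + J) := by linarith
  calc -(F s - 1 / (d * s)) ≤ 1 / (d * s) * (1 / ((m : ℝ) + 1) + J) := by linarith
    _ ≤ 1 / (d * s) * (s ^ (-(R - 1)) + K * s ^ (-(R - 1))) := by gcongr
    _ = (1 + K) / d * s ^ (-R) := by rw [h6]; field_simp

/-- With no free parameter to balance, the exponent a = R - 1 is used directly and every R < 2 is
reached. -/
lemma isBigO_of_gainTransform_bound (hσ : 0 < σ) {F : ℝ → ℝ} {K : ℝ} (hK0 : 0 ≤ K)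
    (hup : ∀ s, 0 < s → F s ≤ 1 / s * (1 / 2 + K * gainTransform c σ s))
    (hlo : ∀ s, 0 < s → 1 / (2 * s) * (1 - gainTransform c σ (2 * s)) ≤ F s)
    {R : ℝ} (hR : R ∈ Set.Ioo (1 : ℝ) 2) :
    (fun s => F s - 1 / (2 * s)) =O[atTop] fun s : ℝ => 1 / s ^ R := by
  obtain ⟨C, hC0, hC⟩ := gainTransform_le c hσ (a := R - 1)
    ⟨by linarith [hR.1], by linarith [hR.2]⟩
  refine isBigO_one_div_rpow (C := C + K * C) fun s hs => ?_
  have hs0 : 0 < s := by linarith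
  have h6 : s ^ (-R) = s ^ (-(R - 1)) / s := by
    rw [show -R = -(R - 1) - 1 by ring, Real.rpow_sub_one hs0.ne']
  have h1 := hC s hs0
  have h2 : gainTransform c σ (2 * s) ≤ C * s ^ (-(R - 1)) := by
    refine (hC (2 * s) (by positivity)).trans ?_
    gcongr ?_ * ?_
    exact Real.rpow_le_rpow_of_nonpos hs0 (by linarith) (by linarith [hR.1])
  set E := s ^ (-(R - 1)) with hE
  have hE0 : 0 ≤ E := by positivity
  have h3 : 1 / s * (K * gainTransform c σ s) ≤ 1 / s * (K * (C * E)) := by gcongr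
  have h4 : 1 / (2 * s) * gainTransform c σ (2 * s) ≤ 1 / (2 * s) * (C * E) := by gcongr
  have h5 : 1 / (2 * s) * (C * E) ≤ 1 / s * (C * E) := by gcongr; linarith
  have h7 : (C + K * C) * (E / s) = 1 / s * (C * E) + 1 / s * (K * (C * E)) := by field_simp
  have h8 : 0 ≤ 1 / s * (C * E) := by positivity
  have h9 : 0 ≤ 1 / s * (K * (C * E)) := by positivity
  have u := hup s hs0
  have l := hlo s hs0
  have e : 1 / s * (1 / 2 + K * gainTransform c σ s) =
      1 / (2 * s) + 1 / s * (K * gainTransform c σ s) := by field_simp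
  rw [h6, h7, abs_le]
  constructor
  · linarith
  · linarith

end Rates

/-! ### Small-argument expansion of a Stieltjes transform. -/

section StieltjesExpansion

/-- Induction through u^(k+1)/(x+u) = u^k - x·u^k/(x+u). The logarithm of x enters here, once for
each Taylor coefficient of p. -/
lemma integral_pow_div_add {x : ℝ} (hx : 0 < x) (k : ℕ) :
    ∫ u in (0 : ℝ)..1, u ^ k / (x + u) = (-x) ^ k * (Real.log (1 + x) - Real.log x) +
      ∑ j ∈ Finset.range k, (-x) ^ j / ((k : ℝ) - j) := by
  have hcont : ∀ k : ℕ, IntervalIntegrable (fun u : ℝ => u ^ k / (x + u)) volume 0 1 := fun k => by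
    refine ContinuousOn.intervalIntegrable (ContinuousOn.div (by fun_prop) (by fun_prop) ?_)
    intro u hu
    rw [Set.uIcc_of_le zero_le_one] at hu
    linarith [hu.1]
  induction k with
  | zero =>
    have h := integral_inv_of_pos hx (by linarith : 0 < x + 1)
    have h2 := intervalIntegral.integral_comp_add_left (fun u : ℝ => u⁻¹) (a := 0) (b := 1) x
    rw [add_zero] at h2
    simp only [pow_zero, one_div, one_mul, Finset.range_zero, Finset.sum_empty, add_zero]
    rw [h2, h, Real.log_div (by positivity) hx.ne', add_comm]
  | succ k ih =>
    have e : ∫ u in (0 : ℝ)..1, u ^ (k + 1) / (x + u) =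
        ∫ u in (0 : ℝ)..1, (u ^ k - x * (u ^ k / (x + u))) := by
      refine intervalIntegral.integral_congr fun u hu => ?_
      rw [Set.uIcc_of_le zero_le_one] at hu
      have : x + u ≠ 0 := by linarith [hu.1]
      field_simp
      ring
    rw [e, intervalIntegral.integral_sub (by simp) ((hcont k).const_mul x),
      intervalIntegral.integral_const_mul, ih, integral_pow, Finset.sum_range_succ', mul_add,
      Finset.mul_sum]
    have e2 : ∀ j ∈ Finset.range k, (-x) ^ (j + 1) / (((k + 1 : ℕ) : ℝ) - ((j + 1 : ℕ) : ℝ)) =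
        -(x * ((-x) ^ j / ((k : ℝ) - j))) := fun j _ => by
      push_cast
      rw [add_sub_add_right_eq_sub, pow_succ]
      ring
    rw [Finset.sum_congr rfl e2, Finset.sum_neg_distrib]
    push_cast
    ring

/-- The series of log(1+x), multiplied by (-x)^k and reindexed by j = k+i+1, supplies the terms j >
k. The factor 2 bounds 1/(1-x). -/
lemma abs_pow_mul_log_sub_le {x : ℝ} (hx : 0 < x) (hx2 : x ≤ 1 / 2) {k M : ℕ} (hk : k < M) :
    |(-x) ^ k * Real.log (1 + x) - ∑ j ∈ Finset.Ico (k + 1) M, (-x) ^ j / ((k : ℝ) - j)| ≤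
      2 * x ^ M := by
  have h := Real.abs_log_sub_add_sum_range_le (x := -x)
    (by rw [abs_neg, abs_of_pos hx]; linarith) (M - (k + 1))
  rw [sub_neg_eq_add, abs_neg, abs_of_pos hx] at h
  have e : (-x) ^ k * Real.log (1 + x) - ∑ j ∈ Finset.Ico (k + 1) M, (-x) ^ j / ((k : ℝ) - j) =
      (-x) ^ k * (∑ i ∈ Finset.range (M - (k + 1)), (-x) ^ (i + 1) / ((i : ℝ) + 1) +
        Real.log (1 + x)) := by
    rw [Finset.sum_Ico_eq_sum_range, mul_add, Finset.mul_sum, add_comm, sub_eq_add_neg,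
      ← Finset.sum_neg_distrib, add_comm]
    congr 1
    refine Finset.sum_congr rfl fun i _ => ?_
    push_cast
    have : (k : ℝ) - (k + 1 + i) = -(i + 1) := by ring
    rw [this, div_neg, neg_neg, mul_div_assoc', ← pow_add]
    congr 2
    ring
  rw [e, abs_mul, abs_pow, abs_neg, abs_of_pos hx]
  have e2 : x ^ M = x ^ k * x ^ (M - (k + 1) + 1) := by
    rw [← pow_add]; congr 1; omega
  calc _ ≤ x ^ k * (x ^ (M - (k + 1) + 1) / (1 - x)) := by gcongr
    _ ≤ x ^ k * (x ^ (M - (k + 1) + 1) / (1 / 2)) := by gcongr; linarith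
    _ = _ := by rw [e2]; ring

lemma abs_integral_pow_div_add_sub_le {x : ℝ} (hx : 0 < x) (hx2 : x ≤ 1 / 2) {k M : ℕ}
    (hk : k < M) :
    |(∫ u in (0 : ℝ)..1, u ^ k / (x + u)) - ((-x) ^ k * -Real.log x +
      ∑ j ∈ (Finset.range M).erase k, (-x) ^ j / ((k : ℝ) - j))| ≤ 2 * x ^ M := by
  have hsplit : ∑ j ∈ (Finset.range M).erase k, (-x) ^ j / ((k : ℝ) - j) =
      ∑ j ∈ Finset.range k, (-x) ^ j / ((k : ℝ) - j) +
      ∑ j ∈ Finset.Ico (k + 1) M, (-x) ^ j / ((k : ℝ) - j) := by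
    rw [← Finset.sum_union]
    · congr 1
      ext j
      simp only [Finset.mem_erase, Finset.mem_range, Finset.mem_union, Finset.mem_Ico]
      omega
    · rw [Finset.disjoint_left]
      intro j hj
      simp only [Finset.mem_range, Finset.mem_Ico] at hj ⊢
      omega
  rw [integral_pow_div_add hx, hsplit]
  refine le_trans (le_of_eq ?_) (abs_pow_mul_log_sub_le hx hx2 hk)
  congr 1
  ring

/-- The remainder of `p` after subtracting a polynomial on `[0, 1]`. -/
noncomputable def taylorTail (p : ℝ → ℝ) (b : ℕ → ℝ) (M : ℕ) (u : ℝ) : ℝ :=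
  p u - if u ≤ 1 then ∑ k ∈ Finset.range M, b k * u ^ k else 0

/-- The function `p` decays exponentially and has the asymptotic power series `∑ b k u^k` at `0`. -/
structure HasTaylorTail (p : ℝ → ℝ) (b : ℕ → ℝ) (δ : ℝ) : Prop where
  continuous : Continuous p
  pos : 0 < δ
  bound : ∀ M, ∃ C, ∀ u, 0 < u → |taylorTail p b M u| ≤ C * (u ^ M * Real.exp (-δ * u))

variable {p : ℝ → ℝ} {b : ℕ → ℝ} {δ : ℝ}

lemma HasTaylorTail.measurable (h : HasTaylorTail p b δ) (M : ℕ) : Measurable (taylorTail p b M) :=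
  h.continuous.measurable.sub (Measurable.ite measurableSet_Iic (by fun_prop) measurable_const)

/-- A finite geometric expansion in x/u. The negative powers of u are harmless against a tail of
size u^M, and they produce its moments of negative order. -/
lemma inv_add_eq_sum {x u : ℝ} (hx : 0 < x) (hu : 0 < u) (M : ℕ) :
    1 / (x + u) = ∑ j ∈ Finset.range M, (-x) ^ j / u ^ (j + 1) + (-x) ^ M / (u ^ M * (x + u)) := by
  induction M with
  | zero => simp
  | succ M ih =>
    rw [ih, Finset.sum_range_succ, add_assoc]
    congr 1
    have : x + u ≠ 0 := by positivity
    field_simp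
    ring

lemma integrableOn_exp_neg {δ : ℝ} (hδ : 0 < δ) :
    IntegrableOn (fun u : ℝ => Real.exp (-δ * u)) (Set.Ioi 0) :=
  exp_neg_integrableOn_Ioi 0 hδ

lemma integrableOn_pow_mul_exp_neg {δ : ℝ} (hδ : 0 < δ) (n : ℕ) :
    IntegrableOn (fun u : ℝ => u ^ n * Real.exp (-δ * u)) (Set.Ioi 0) := by
  have h := integrableOn_rpow_mul_exp_neg_mul_rpow (s := n) (p := 1) (b := δ)
    (by have : (0 : ℝ) ≤ n := by positivity
        linarith) one_pos hδ
  simpa only [Real.rpow_one, Real.rpow_natCast] using h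

lemma HasTaylorTail.integrableOn_div_pow (h : HasTaylorTail p b δ) {M j : ℕ} (hj : j < M) :
    IntegrableOn (fun u => taylorTail p b M u / u ^ (j + 1)) (Set.Ioi 0) := by
  obtain ⟨C, hC⟩ := h.bound M
  refine ((integrableOn_pow_mul_exp_neg h.pos (M - (j + 1))).const_mul C).mono'
    ((h.measurable M).div (by fun_prop)).aestronglyMeasurable ?_
  filter_upwards [ae_restrict_mem measurableSet_Ioi] with u hu
  have hu0 : (0 : ℝ) < u := hu
  rw [Real.norm_eq_abs, abs_div, abs_of_pos (pow_pos hu0 _), div_le_iff₀ (pow_pos hu0 _)]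
  refine (hC u hu0).trans (le_of_eq ?_)
  have e : u ^ M = u ^ (M - (j + 1)) * u ^ (j + 1) := by
    rw [← pow_add]; congr 1; omega
  rw [e]
  ring

/-- The logarithm of the remainder: near 0 the integral behaves like ∫₀¹ du/(x+u), and beyond 1 the
denominator exceeds 1. -/
lemma integral_exp_neg_div_add_le {δ x : ℝ} (hδ : 0 < δ) (hx : 0 < x) (hx2 : x ≤ 1 / 2) :
    IntegrableOn (fun u : ℝ => Real.exp (-δ * u) / (x + u)) (Set.Ioi 0) ∧
    ∫ u in Set.Ioi (0 : ℝ), Real.exp (-δ * u) / (x + u) ≤ (1 + 1 / δ) * (1 + |Real.log x|) := by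
  have hint : IntegrableOn (fun u : ℝ => Real.exp (-δ * u) / (x + u)) (Set.Ioi 0) := by
    refine ((integrableOn_exp_neg hδ).const_mul (1 / x)).mono'
      (Measurable.aestronglyMeasurable (by fun_prop)) ?_
    filter_upwards [ae_restrict_mem measurableSet_Ioi] with u hu
    have hu0 : (0 : ℝ) < u := hu
    rw [Real.norm_of_nonneg (by positivity), one_div_mul_eq_div]
    gcongr
    linarith
  refine ⟨hint, ?_⟩
  have hIoc : IntegrableOn (fun u : ℝ => u ^ 0 / (x + u)) (Set.Ioc 0 1) := by
    rw [← intervalIntegrable_iff_integrableOn_Ioc_of_le zero_le_one]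
    refine ContinuousOn.intervalIntegrable (ContinuousOn.div (by fun_prop) (by fun_prop) ?_)
    intro u hu
    rw [Set.uIcc_of_le zero_le_one] at hu
    linarith [hu.1]
  have hsub : Set.Ioi (1 : ℝ) ⊆ Set.Ioi 0 := Set.Ioi_subset_Ioi zero_le_one
  rw [← Set.Ioc_union_Ioi_eq_Ioi (zero_le_one' ℝ), setIntegral_union
    (Set.Ioc_disjoint_Ioi_same) measurableSet_Ioi (hint.mono_set Set.Ioc_subset_Ioi_self)
    (hint.mono_set hsub)]
  have h1 : ∫ u in Set.Ioc (0 : ℝ) 1, Real.exp (-δ * u) / (x + u) ≤ 1 + |Real.log x| := by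
    calc _ ≤ ∫ u in Set.Ioc (0 : ℝ) 1, u ^ 0 / (x + u) := by
          refine setIntegral_mono_on (hint.mono_set Set.Ioc_subset_Ioi_self) hIoc measurableSet_Ioc
            fun u hu => ?_
          have hu0 : 0 < u := hu.1
          rw [pow_zero]
          gcongr
          rw [Real.exp_le_one_iff]
          nlinarith
      _ = Real.log (1 + x) - Real.log x := by
          rw [← intervalIntegral.integral_of_le zero_le_one, integral_pow_div_add hx]
          simp
      _ ≤ 1 + |Real.log x| := by
          have := Real.log_le_sub_one_of_pos (by linarith : 0 < 1 + x)
          have := neg_abs_le (Real.log x)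
          linarith
  have h2 : ∫ u in Set.Ioi (1 : ℝ), Real.exp (-δ * u) / (x + u) ≤ 1 / δ := by
    calc _ ≤ ∫ u in Set.Ioi (1 : ℝ), Real.exp (-δ * u) := by
          refine setIntegral_mono_on (hint.mono_set hsub) ((integrableOn_exp_neg hδ).mono_set hsub)
            measurableSet_Ioi fun u hu => ?_
          have hu0 : (1 : ℝ) < u := hu
          exact div_le_self (Real.exp_pos _).le (by linarith)
      _ ≤ ∫ u in Set.Ioi (0 : ℝ), Real.exp (-δ * u) :=
          setIntegral_mono_set (integrableOn_exp_neg hδ) (ae_of_all _ fun u => (Real.exp_pos _).le)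
            hsub.eventuallyLE
      _ = 1 / δ := by
          rw [integral_exp_mul_Ioi (by linarith)]
          simp
  have h3 : 0 ≤ 1 / δ * |Real.log x| := by positivity
  linarith

/-- The finite part of `∫₀^∞ p u / u^(j+1) du`, computed with the tail of order `M`. -/
noncomputable def finitePart (p : ℝ → ℝ) (b : ℕ → ℝ) (M j : ℕ) : ℝ :=
  (∫ u in Set.Ioi (0 : ℝ), taylorTail p b M u / u ^ (j + 1)) +
    ∑ k ∈ (Finset.range M).erase j, b k / ((k : ℝ) - j)

lemma HasTaylorTail.exists_integral_div_pow_mul_add_le (h : HasTaylorTail p b δ) (M : ℕ) :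
    ∃ C, 0 ≤ C ∧ ∀ x : ℝ, 0 < x → x ≤ 1 / 2 →
      IntegrableOn (fun u => taylorTail p b M u / (u ^ M * (x + u))) (Set.Ioi 0) ∧
      |∫ u in Set.Ioi (0 : ℝ), taylorTail p b M u / (u ^ M * (x + u))| ≤
        C * (1 + |Real.log x|) := by
  obtain ⟨C, hC⟩ := h.bound M
  have hC0 : 0 ≤ C := by
    have h1 := (abs_nonneg _).trans (hC 1 one_pos)
    rw [one_pow, one_mul] at h1
    exact nonneg_of_mul_nonneg_left h1 (Real.exp_pos _)
  have hδ := h.pos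
  refine ⟨C * (1 + 1 / δ), by positivity, fun x hx hx2 => ?_⟩
  obtain ⟨hi, hb⟩ := integral_exp_neg_div_add_le h.pos hx hx2
  have hle : ∀ᵐ u ∂(volume.restrict (Set.Ioi (0 : ℝ))),
      ‖taylorTail p b M u / (u ^ M * (x + u))‖ ≤ C * (Real.exp (-δ * u) / (x + u)) := by
    filter_upwards [ae_restrict_mem measurableSet_Ioi] with u hu
    have hu0 : (0 : ℝ) < u := hu
    have hpos : 0 < u ^ M * (x + u) := by positivity
    rw [Real.norm_eq_abs, abs_div, abs_of_pos hpos, div_le_iff₀ hpos]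
    refine (hC u hu0).trans (le_of_eq ?_)
    have : x + u ≠ 0 := by positivity
    field_simp
  have hint : IntegrableOn (fun u => taylorTail p b M u / (u ^ M * (x + u))) (Set.Ioi 0) :=
    (hi.const_mul C).mono' ((h.measurable M).div (by fun_prop)).aestronglyMeasurable hle
  refine ⟨hint, ?_⟩
  calc _ ≤ ∫ u in Set.Ioi (0 : ℝ), C * (Real.exp (-δ * u) / (x + u)) :=
        norm_integral_le_of_norm_le (hi.const_mul C) hle
    _ ≤ C * ((1 + 1 / δ) * (1 + |Real.log x|)) := by
        rw [integral_const_mul]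
        gcongr
    _ = _ := by ring

lemma HasTaylorTail.integral_taylorTail_div_add (h : HasTaylorTail p b δ) (M : ℕ) {x : ℝ}
    (hx : 0 < x) (hx2 : x ≤ 1 / 2) :
    IntegrableOn (fun u => taylorTail p b M u / (x + u)) (Set.Ioi 0) ∧
    ∫ u in Set.Ioi (0 : ℝ), taylorTail p b M u / (x + u) =
      ∑ j ∈ Finset.range M, (-x) ^ j * (∫ u in Set.Ioi (0 : ℝ), taylorTail p b M u / u ^ (j + 1)) +
      (-x) ^ M * ∫ u in Set.Ioi (0 : ℝ), taylorTail p b M u / (u ^ M * (x + u)) := by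
  obtain ⟨C, -, hC⟩ := h.exists_integral_div_pow_mul_add_le M
  have hrem := (hC x hx hx2).1
  have hsum : ∀ j ∈ Finset.range M, Integrable
      (fun u => (-x) ^ j * (taylorTail p b M u / u ^ (j + 1))) (volume.restrict (Set.Ioi 0)) :=
    fun j hj => (h.integrableOn_div_pow (Finset.mem_range.1 hj)).const_mul _
  have hae : (fun u => taylorTail p b M u / (x + u)) =ᵐ[volume.restrict (Set.Ioi 0)]
      fun u => ∑ j ∈ Finset.range M, (-x) ^ j * (taylorTail p b M u / u ^ (j + 1)) +
        (-x) ^ M * (taylorTail p b M u / (u ^ M * (x + u))) := by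
    filter_upwards [ae_restrict_mem measurableSet_Ioi] with u hu
    rw [div_eq_mul_one_div, inv_add_eq_sum hx hu M, mul_add, Finset.mul_sum]
    congr 1
    · exact Finset.sum_congr rfl fun j _ => by ring
    · ring
  have hI := (integrable_finsetSum _ hsum).add (hrem.const_mul ((-x) ^ M))
  refine ⟨hI.congr hae.symm, ?_⟩
  rw [integral_congr_ae hae, integral_add (integrable_finsetSum _ hsum) (hrem.const_mul _),
    integral_finsetSum _ hsum, integral_const_mul]
  simp_rw [integral_const_mul]

/-- The expansion at `x → 0⁺` of the Stieltjes transform of a function with an asymptotic power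
series at `0`. -/
theorem HasTaylorTail.exists_stieltjes_expansion (h : HasTaylorTail p b δ) (M : ℕ) :
    ∃ C, 0 ≤ C ∧ ∀ x : ℝ, 0 < x → x ≤ 1 / 2 →
      |(∫ u in Set.Ioi (0 : ℝ), p u / (x + u)) -
        ∑ j ∈ Finset.range M, (-x) ^ j * (finitePart p b M j - b j * Real.log x)| ≤
      C * x ^ M * (1 + |Real.log x|) := by
  obtain ⟨C, hC0, hC⟩ := h.exists_integral_div_pow_mul_add_le M
  refine ⟨C + ∑ k ∈ Finset.range M, |b k| * 2, by positivity, fun x hx hx2 => ?_⟩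
  obtain ⟨hi, htail⟩ := h.integral_taylorTail_div_add M hx hx2
  have hIoc : ∀ k : ℕ, IntegrableOn (fun u : ℝ => u ^ k / (x + u)) (Set.Ioc 0 1) := fun k => by
    rw [← intervalIntegrable_iff_integrableOn_Ioc_of_le zero_le_one]
    refine ContinuousOn.intervalIntegrable (ContinuousOn.div (by fun_prop) (by fun_prop) ?_)
    intro u hu
    rw [Set.uIcc_of_le zero_le_one] at hu
    linarith [hu.1]
  have hpoly : IntegrableOn (fun u => ∑ k ∈ Finset.range M, b k * (u ^ k / (x + u)))
      (Set.Ioc 0 1) := integrable_finsetSum _ fun k _ => (hIoc k).const_mul _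
  have hpolyI : ∫ u in Set.Ioc (0 : ℝ) 1, ∑ k ∈ Finset.range M, b k * (u ^ k / (x + u)) =
      ∑ k ∈ Finset.range M, b k * ∫ u in (0 : ℝ)..1, u ^ k / (x + u) := by
    rw [integral_finsetSum _ fun k _ => (hIoc k).const_mul _]
    simp_rw [integral_const_mul, intervalIntegral.integral_of_le zero_le_one]
  have hae : (fun u => p u / (x + u)) =ᵐ[volume.restrict (Set.Ioi 0)]
      fun u => taylorTail p b M u / (x + u) + (Set.Ioc (0 : ℝ) 1).indicator
        (fun u => ∑ k ∈ Finset.range M, b k * (u ^ k / (x + u))) u := by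
    filter_upwards [ae_restrict_mem measurableSet_Ioi] with u hu
    have hu0 : (0 : ℝ) < u := hu
    rw [Set.indicator_apply, taylorTail]
    by_cases h1 : u ≤ 1
    · rw [if_pos h1, if_pos ⟨hu0, h1⟩, sub_div, Finset.sum_div]
      simp_rw [mul_div_assoc]
      ring
    · rw [if_neg h1, if_neg fun hh => h1 hh.2]
      ring
  have hmain : ∫ u in Set.Ioi (0 : ℝ), p u / (x + u) =
      (∫ u in Set.Ioi (0 : ℝ), taylorTail p b M u / (x + u)) +
      ∑ k ∈ Finset.range M, b k * ∫ u in (0 : ℝ)..1, u ^ k / (x + u) := by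
    rw [integral_congr_ae hae, integral_add hi, setIntegral_indicator measurableSet_Ioc,
      Set.inter_eq_self_of_subset_right Set.Ioc_subset_Ioi_self, hpolyI]
    rw [integrable_indicator_iff measurableSet_Ioc, IntegrableOn,
      Measure.restrict_restrict measurableSet_Ioc,
      Set.inter_eq_self_of_subset_left Set.Ioc_subset_Ioi_self]
    exact hpoly
  -- The polynomial part contributes, after exchanging the sums, the regularised values 1/(k-j) of
  -- ∫₀¹ u^(k-j-1) du; the excluded diagonal k = j is what became the logarithm.
  have hswap : ∑ j ∈ Finset.range M, (-x) ^ j * ∑ k ∈ (Finset.range M).erase j, b k / ((k : ℝ) - j) =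
      ∑ k ∈ Finset.range M, b k * ∑ j ∈ (Finset.range M).erase k, (-x) ^ j / ((k : ℝ) - j) := by
    simp_rw [Finset.mul_sum]
    rw [Finset.sum_comm' (t' := Finset.range M) (s' := fun k => (Finset.range M).erase k)]
    · exact Finset.sum_congr rfl fun k _ => Finset.sum_congr rfl fun j _ => by ring
    · intro j k
      simp only [Finset.mem_erase, Finset.mem_range]
      tauto
  have hdiff : (∫ u in Set.Ioi (0 : ℝ), p u / (x + u)) -
        ∑ j ∈ Finset.range M, (-x) ^ j * (finitePart p b M j - b j * Real.log x) =
      (-x) ^ M * (∫ u in Set.Ioi (0 : ℝ), taylorTail p b M u / (u ^ M * (x + u))) +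
      ∑ k ∈ Finset.range M, b k * ((∫ u in (0 : ℝ)..1, u ^ k / (x + u)) -
        ((-x) ^ k * -Real.log x + ∑ j ∈ (Finset.range M).erase k, (-x) ^ j / ((k : ℝ) - j))) := by
    rw [hmain, htail]
    simp only [finitePart, mul_sub, mul_add, Finset.sum_add_distrib, Finset.sum_sub_distrib]
    rw [hswap]
    have : ∑ k ∈ Finset.range M, b k * ((-x) ^ k * -Real.log x) =
        -∑ k ∈ Finset.range M, (-x) ^ k * (b k * Real.log x) := by
      rw [← Finset.sum_neg_distrib]
      exact Finset.sum_congr rfl fun k _ => by ring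
    rw [this]
    ring
  rw [hdiff]
  have hL : 1 ≤ 1 + |Real.log x| := by linarith [abs_nonneg (Real.log x)]
  calc _ ≤ x ^ M * (C * (1 + |Real.log x|)) + ∑ k ∈ Finset.range M, |b k| * (2 * x ^ M) := by
        refine (abs_add_le _ _).trans (add_le_add ?_ ?_)
        · rw [abs_mul, abs_pow, abs_neg, abs_of_pos hx]
          exact mul_le_mul_of_nonneg_left (hC x hx hx2).2 (by positivity)
        · refine (Finset.abs_sum_le_sum_abs _ _).trans (Finset.sum_le_sum fun k hk => ?_)
          rw [abs_mul]
          exact mul_le_mul_of_nonneg_left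
            (abs_integral_pow_div_add_sub_le hx hx2 (Finset.mem_range.1 hk)) (abs_nonneg _)
    _ = C * x ^ M * (1 + |Real.log x|) + (∑ k ∈ Finset.range M, |b k| * 2) * x ^ M * 1 := by
        rw [Finset.sum_mul, Finset.sum_mul]
        congr 1
        · ring
        · exact Finset.sum_congr rfl fun k _ => by ring
    _ ≤ C * x ^ M * (1 + |Real.log x|) +
        (∑ k ∈ Finset.range M, |b k| * 2) * x ^ M * (1 + |Real.log x|) := by
        have : 0 ≤ ∑ k ∈ Finset.range M, |b k| * 2 := by positivity
        gcongr
    _ = _ := by ring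

end StieltjesExpansion

/-! ### Continuation of the Mellin transform and its principal parts. -/

section MellinContinuation

/-- The Taylor coefficients at `0` of a function on `[0, ∞)`. -/
noncomputable def rightTaylorCoeff (p : ℝ → ℝ) (k : ℕ) : ℝ :=
  ((k.factorial : ℝ)⁻¹) * iteratedDerivWithin k p (Set.Icc 0 1) 0

/-- Taylor's theorem handles [0,1]; beyond 1 nothing is subtracted, and u^M ≥ 1 makes the decay of p
sufficient. -/
lemma hasTaylorTail_of_contDiff {p : ℝ → ℝ} {δ C : ℝ} (hp : ContDiff ℝ (⊤ : ℕ∞) p) (hδ : 0 < δ)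
    (hC : ∀ u, 0 < u → |p u| ≤ C * Real.exp (-δ * u)) :
    HasTaylorTail p (rightTaylorCoeff p) δ where
  continuous := hp.continuous
  pos := hδ
  bound M := by
    have hC0 : 0 ≤ C := by
      have h1 := (abs_nonneg _).trans (hC 1 one_pos)
      exact nonneg_of_mul_nonneg_left h1 (Real.exp_pos _)
    obtain ⟨K, hK⟩ : ∃ K, ∀ u, 0 < u → u ≤ 1 →
        |p u - ∑ k ∈ Finset.range M, rightTaylorCoeff p k * u ^ k| ≤ K * u ^ M := by
      cases M with
      | zero =>
        refine ⟨C, fun u hu hu1 => ?_⟩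
        rw [Finset.sum_range_zero, sub_zero, pow_zero]
        exact (hC u hu).trans (mul_le_mul_of_nonneg_left (Real.exp_le_one_iff.2 (by nlinarith)) hC0)
      | succ n =>
        obtain ⟨K, hK⟩ := exists_taylor_mean_remainder_bound (n := n) (zero_le_one' ℝ)
          ((hp.of_le (by exact_mod_cast le_top)).contDiffOn)
        refine ⟨K, fun u hu hu1 => ?_⟩
        have h := hK u ⟨hu.le, hu1⟩
        rw [taylor_within_apply, Real.norm_eq_abs, sub_zero] at h
        refine le_trans (le_of_eq ?_) h
        congr 2
        refine Finset.sum_congr rfl fun k _ => ?_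
        rw [rightTaylorCoeff, smul_eq_mul]
        ring
    refine ⟨max C (K * Real.exp δ), fun u hu => ?_⟩
    have hpos : 0 ≤ u ^ M * Real.exp (-δ * u) := by positivity
    rw [taylorTail]
    by_cases h1 : u ≤ 1
    · rw [if_pos h1]
      have hK0 : 0 ≤ K * u ^ M := (abs_nonneg _).trans (hK u hu h1)
      calc _ ≤ K * u ^ M * 1 := by rw [mul_one]; exact hK u hu h1
        _ ≤ K * u ^ M * Real.exp (δ + -δ * u) :=
            mul_le_mul_of_nonneg_left (Real.one_le_exp (by nlinarith)) hK0
        _ = K * Real.exp δ * (u ^ M * Real.exp (-δ * u)) := by rw [Real.exp_add]; ring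
        _ ≤ _ := mul_le_mul_of_nonneg_right (le_max_right _ _) hpos
    · rw [if_neg h1, sub_zero]
      have hu1 : 1 ≤ u ^ M := one_le_pow₀ (le_of_not_ge h1)
      calc _ ≤ C * Real.exp (-δ * u) := hC u hu
        _ ≤ C * (u ^ M * Real.exp (-δ * u)) :=
            mul_le_mul_of_nonneg_left (le_mul_of_one_le_left (Real.exp_pos _).le hu1) hC0
        _ ≤ _ := mul_le_mul_of_nonneg_right (le_max_left _ _) hpos

variable {p : ℝ → ℝ} {b : ℕ → ℝ} {δ : ℝ}

lemma HasTaylorTail.isBigO_atTop (h : HasTaylorTail p b δ) (M : ℕ) :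
    (fun u => (taylorTail p b M u : ℂ)) =O[atTop] fun u => Real.exp (-δ * u) := by
  obtain ⟨C, hC⟩ := h.bound 0
  refine IsBigO.of_bound C ?_
  filter_upwards [eventually_gt_atTop 1] with u hu
  have h1 := hC u (by linarith)
  rw [taylorTail, if_neg hu.not_ge, pow_zero, one_mul] at *
  rwa [Complex.norm_real, Real.norm_eq_abs, Real.norm_of_nonneg (Real.exp_pos _).le]

lemma HasTaylorTail.isBigO_zero (h : HasTaylorTail p b δ) (M : ℕ) :
    (fun u => (taylorTail p b M u : ℂ)) =O[𝓝[>] 0] fun u => u ^ (-(-(M : ℝ))) := by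
  obtain ⟨C, hC⟩ := h.bound M
  refine IsBigO.of_bound C ?_
  filter_upwards [self_mem_nhdsWithin] with u hu
  have hu0 : (0 : ℝ) < u := hu
  have h1 := hC u hu0
  rw [neg_neg, Real.rpow_natCast, Complex.norm_real, Real.norm_eq_abs,
    Real.norm_of_nonneg (by positivity)]
  have hC0 : 0 ≤ C := nonneg_of_mul_nonneg_left ((abs_nonneg _).trans h1) (by positivity)
  refine h1.trans (mul_le_mul_of_nonneg_left ?_ hC0)
  refine mul_le_of_le_one_right (by positivity) (Real.exp_le_one_iff.2 ?_)
  have := h.pos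
  nlinarith

lemma HasTaylorTail.locallyIntegrableOn (h : HasTaylorTail p b δ) (M : ℕ) :
    LocallyIntegrableOn (fun u => (taylorTail p b M u : ℂ)) (Set.Ioi 0) := by
  refine IntegrableOn.locallyIntegrableOn ?_
  obtain ⟨C, hC⟩ := h.bound M
  refine ((integrableOn_pow_mul_exp_neg h.pos M).const_mul C).mono'
    (Complex.measurable_ofReal.comp (h.measurable M)).aestronglyMeasurable ?_
  filter_upwards [ae_restrict_mem measurableSet_Ioi] with u hu
  rw [Complex.norm_real]
  exact hC u hu

lemma HasTaylorTail.mellinConvergent (h : HasTaylorTail p b δ) {M : ℕ} {a : ℂ}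
    (ha : -(M : ℝ) < a.re) : MellinConvergent (fun u => (taylorTail p b M u : ℂ)) a :=
  mellinConvergent_of_isBigO_rpow_exp h.pos (h.locallyIntegrableOn M) (h.isBigO_atTop M)
    (h.isBigO_zero M) ha

lemma HasTaylorTail.differentiableAt_mellin (h : HasTaylorTail p b δ) {M : ℕ} {a : ℂ}
    (ha : -(M : ℝ) < a.re) :
    DifferentiableAt ℂ (mellin fun u => (taylorTail p b M u : ℂ)) a :=
  mellin_differentiableAt_of_isBigO_rpow_exp h.pos (h.locallyIntegrableOn M) (h.isBigO_atTop M)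
    (h.isBigO_zero M) ha

lemma mellin_taylorTail_neg (M j : ℕ) :
    mellin (fun u => (taylorTail p b M u : ℂ)) (-j) =
      ((∫ u in Set.Ioi (0 : ℝ), taylorTail p b M u / u ^ (j + 1) : ℝ) : ℂ) := by
  rw [mellin, ← integral_complex_ofReal]
  refine setIntegral_congr_fun measurableSet_Ioi fun u hu => ?_
  have e : (-(j : ℂ) - 1) = -((j + 1 : ℕ) : ℂ) := by push_cast; ring
  simp only [e, Complex.cpow_neg, Complex.cpow_natCast, smul_eq_mul]
  push_cast
  rw [div_eq_mul_inv, mul_comm]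

/-- Each subtracted monomial on (0,1] has Mellin transform 1/(a+k), which displays the poles. The
remaining transform is analytic for Re a > -M. -/
lemma HasTaylorTail.mellin_eq (h : HasTaylorTail p b δ) (M : ℕ) {a : ℂ} (ha : 0 < a.re) :
    mellin (fun u => (p u : ℂ)) a = mellin (fun u => (taylorTail p b M u : ℂ)) a +
      ∑ k ∈ Finset.range M, (b k : ℂ) / (a + k) := by
  have hk : ∀ k : ℕ, HasMellin (Set.indicator (Set.Ioc 0 1) (fun t => (t : ℂ) ^ (k : ℂ) : ℝ → ℂ))
      a (1 / (a + k)) := fun k => hasMellin_cpow_Ioc (k : ℂ) (by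
    rw [Complex.natCast_re]; positivity)
  have hsum : HasMellin (fun u => ∑ k ∈ Finset.range M, (b k : ℂ) •
      Set.indicator (Set.Ioc 0 1) (fun t => (t : ℂ) ^ (k : ℂ) : ℝ → ℂ) u) a
      (∑ k ∈ Finset.range M, (b k : ℂ) / (a + k)) := by
    induction M with
    | zero => simp [HasMellin, MellinConvergent, mellin]
    | succ M ih =>
      simp_rw [Finset.sum_range_succ]
      have hM := (hk M).1.const_smul (b M : ℂ)
      have h2 := hasMellin_add ih.1 hM
      refine ⟨h2.1, ?_⟩
      rw [h2.2, ih.2, mellin_const_smul, (hk M).2, smul_eq_mul, mul_one_div]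
  have hadd := hasMellin_add (h.mellinConvergent (M := M) (a := a)
    (by have : (0 : ℝ) ≤ M := by positivity
        linarith)) hsum.1
  rw [← hsum.2, ← hadd.2, mellin, mellin]
  refine setIntegral_congr_fun measurableSet_Ioi fun u hu => ?_
  have hu0 : (0 : ℝ) < u := hu
  congr 1
  rw [taylorTail]
  by_cases h1 : u ≤ 1
  · simp [h1, hu0]
  · simp [h1]

lemma Gamma_add_natCast_eq {a : ℂ} {M : ℕ} (ha : ∀ j < M, a + j ≠ 0) :
    Complex.Gamma (a + M) = (∏ j ∈ Finset.range M, (a + j)) * Complex.Gamma a := by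
  induction M with
  | zero => simp
  | succ M ih =>
    rw [Finset.prod_range_succ, Nat.cast_succ, ← add_assoc,
      Complex.Gamma_add_one _ (ha M (Nat.lt_succ_self M)),
      ih fun j hj => ha j (hj.trans (Nat.lt_succ_self M))]
    ring

/-- The meromorphic continuation of the Mellin transform. -/
lemma HasTaylorTail.mellin_continuation (h : HasTaylorTail p b δ) {G : ℂ → ℂ}
    (hG : Differentiable ℂ G)
    (hpG : ∀ a : ℂ, 0 < a.re → mellin (fun u => (p u : ℂ)) a = Complex.Gamma a * G a)
    {M : ℕ} {a : ℂ} (ha : -(M : ℝ) < a.re) (ha0 : ∀ j < M, a + j ≠ 0) :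
    Complex.Gamma a * G a = mellin (fun u => (taylorTail p b M u : ℂ)) a +
      ∑ k ∈ Finset.range M, (b k : ℂ) / (a + k) := by
  set U : Set ℂ := {a | -(M : ℝ) < a.re} with hU
  have hUo : IsOpen U := isOpen_lt continuous_const Complex.continuous_re
  have hUc : IsPreconnected U := (convex_halfSpace_re_gt _).isPreconnected
  -- Both sides are multiplied by ∏(a+j), j < M, to clear the poles. The identity theorem then
  -- applies on the whole half-plane, starting from a neighbourhood of 1.
  set F1 : ℂ → ℂ := fun a => Complex.Gamma (a + M) * G a with hF1
  set F2 : ℂ → ℂ := fun a => (∏ j ∈ Finset.range M, (a + j)) *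
      mellin (fun u => (taylorTail p b M u : ℂ)) a +
      ∑ k ∈ Finset.range M, (b k : ℂ) * ∏ j ∈ (Finset.range M).erase k, (a + j) with hF2
  have hd1 : DifferentiableOn ℂ F1 U := fun a ha => by
    refine DifferentiableAt.differentiableWithinAt (DifferentiableAt.mul ?_ (hG a))
    refine DifferentiableAt.comp a (Complex.differentiableAt_Gamma _ fun m hm => ?_) (by fun_prop)
    have h1 := congrArg Complex.re hm
    simp only [Complex.add_re, Complex.natCast_re, Complex.neg_re] at h1
    have h2 : -(M : ℝ) < a.re := ha
    have : (0 : ℝ) ≤ m := by positivity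
    linarith
  have hd2 : DifferentiableOn ℂ F2 U := fun a ha => by
    refine DifferentiableAt.differentiableWithinAt (DifferentiableAt.add (DifferentiableAt.mul ?_
      (h.differentiableAt_mellin ha)) ?_) <;> fun_prop
  have hprod : ∀ a : ℂ, (∀ j < M, a + j ≠ 0) → ∀ x : ℂ,
      (∏ j ∈ Finset.range M, (a + j)) * (x + ∑ k ∈ Finset.range M, (b k : ℂ) / (a + k)) =
      (∏ j ∈ Finset.range M, (a + j)) * x +
      ∑ k ∈ Finset.range M, (b k : ℂ) * ∏ j ∈ (Finset.range M).erase k, (a + j) := by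
    intro a ha0 x
    rw [mul_add, Finset.mul_sum]
    congr 1
    refine Finset.sum_congr rfl fun k hk => ?_
    rw [← Finset.mul_prod_erase _ _ hk]
    have := ha0 k (Finset.mem_range.1 hk)
    field_simp
  have hpos : ∀ a : ℂ, 0 < a.re → ∀ j < M, a + j ≠ 0 := by
    intro a ha j _ hj
    have h1 := congrArg Complex.re hj
    simp only [Complex.add_re, Complex.natCast_re, Complex.zero_re] at h1
    have : (0 : ℝ) ≤ j := by positivity
    linarith
  have heq : Set.EqOn F1 F2 U := by
    refine AnalyticOnNhd.eqOn_of_preconnected_of_eventuallyEq (hd1.analyticOnNhd hUo)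
      (hd2.analyticOnNhd hUo) hUc (z₀ := 1) ?_ ?_
    · have : (0 : ℝ) ≤ M := by positivity
      simp only [hU, Set.mem_ofPred_eq, Complex.one_re]
      linarith
    · have : {a : ℂ | 0 < a.re} ∈ 𝓝 (1 : ℂ) :=
        (isOpen_lt continuous_const Complex.continuous_re).mem_nhds (by simp)
      filter_upwards [this] with a ha
      simp only [hF1, hF2]
      rw [Gamma_add_natCast_eq (hpos a ha), ← hprod a (hpos a ha), ← h.mellin_eq M ha, hpG a ha]
      ring
  have h1 := heq (show a ∈ U from ha)
  simp only [hF1, hF2] at h1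
  rw [Gamma_add_natCast_eq ha0, ← hprod a ha0, mul_assoc] at h1
  exact mul_left_cancel₀ (Finset.prod_ne_zero_iff.2 fun j hj => ha0 j (Finset.mem_range.1 hj)) h1

/-- The Mellin transform near `a = -m`, without its polar part there. -/
noncomputable def regularPart (p : ℝ → ℝ) (b : ℕ → ℝ) (M m : ℕ) (a : ℂ) : ℂ :=
  mellin (fun u => (taylorTail p b M u : ℂ)) a +
    ∑ k ∈ (Finset.range M).erase m, (b k : ℂ) / (a + k)

/-- The link between the two theories: the constant term of the Mellin transform at its pole -m is
the finite part occurring in the Stieltjes expansion. -/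
lemma regularPart_neg (p : ℝ → ℝ) (b : ℕ → ℝ) (M m : ℕ) :
    regularPart p b M m (-m) = (finitePart p b M m : ℂ) := by
  rw [regularPart, finitePart, mellin_taylorTail_neg]
  push_cast
  simp_rw [neg_add_eq_sub]

/-- The open disc of radius `1` around `-m` contains no other non-positive integer. -/
lemma add_natCast_ne_zero {a : ℂ} {m k : ℕ} (ha : ‖a + m‖ < 1) (hk : k ≠ m) : a + k ≠ 0 := by
  intro h0
  have e : a + m = ((m : ℤ) - (k : ℤ) : ℤ) := by
    push_cast
    linear_combination h0
  rw [e, Complex.norm_intCast] at ha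
  have h1 : |(m : ℤ) - k| < 1 := by exact_mod_cast ha
  rw [Int.abs_lt_one_iff] at h1
  omega

lemma HasTaylorTail.differentiableAt_regularPart (h : HasTaylorTail p b δ) {M m : ℕ} (hm : m < M)
    {a : ℂ} (ha : ‖a + m‖ < 1) : DifferentiableAt ℂ (regularPart p b M m) a := by
  have hre : -(M : ℝ) < a.re := by
    have h1 := (Complex.abs_re_le_norm (a + m)).trans_lt ha
    rw [abs_lt, Complex.add_re, Complex.natCast_re] at h1
    have : (m : ℝ) + 1 ≤ M := by exact_mod_cast hm
    linarith
  refine DifferentiableAt.add (h.differentiableAt_mellin hre) ?_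
  refine DifferentiableAt.fun_sum fun k hk => ?_
  refine DifferentiableAt.div (by fun_prop) (by fun_prop) ?_
  exact add_natCast_ne_zero ha (Finset.ne_of_mem_erase hk)

lemma HasTaylorTail.Gamma_mul_eq (h : HasTaylorTail p b δ) {G : ℂ → ℂ}
    (hG : Differentiable ℂ G)
    (hpG : ∀ a : ℂ, 0 < a.re → mellin (fun u => (p u : ℂ)) a = Complex.Gamma a * G a)
    {M m : ℕ} (hm : m < M) {a : ℂ} (ha : ‖a + m‖ < 1) (ha0 : a + m ≠ 0) :
    Complex.Gamma a * G a = regularPart p b M m a + (b m : ℂ) / (a + m) := by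
  have hre : -(M : ℝ) < a.re := by
    have h1 := (Complex.abs_re_le_norm (a + m)).trans_lt ha
    rw [abs_lt, Complex.add_re, Complex.natCast_re] at h1
    have : (m : ℝ) + 1 ≤ M := by exact_mod_cast hm
    linarith
  rw [h.mellin_continuation hG hpG hre fun j _ => ?_, regularPart, add_assoc,
    Finset.sum_erase_add _ _ (Finset.mem_range.2 hm)]
  by_cases hj : j = m
  · rwa [hj]
  · exact add_natCast_ne_zero ha hj

end MellinContinuation

/-! ### Value and derivative of the extended bracket function. -/

section RemovableSingularity

/-- The function `ε ↦ πε / sin (πε)`, with its removable singularity at `0` removed. -/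
lemma exists_analytic_pi_mul_div_sin : ∃ S : ℂ → ℂ, AnalyticAt ℂ S 0 ∧ S 0 = 1 ∧ deriv S 0 = 0 ∧
    ∀ ε, ε ≠ 0 → S ε = Real.pi * ε / Complex.sin (Real.pi * ε) := by
  set D : ℂ → ℂ := dslope (fun ε : ℂ => Complex.sin (Real.pi * ε)) 0 with hD
  have hpi : (Real.pi : ℂ) ≠ 0 := Complex.ofReal_ne_zero.2 Real.pi_ne_zero
  have hDd : Differentiable ℂ D := by
    rw [← differentiableOn_univ, hD, Complex.differentiableOn_dslope univ_mem, differentiableOn_univ]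
    fun_prop
  have hD0 : D 0 = Real.pi := by
    have h1 : HasDerivAt (fun ε : ℂ => Complex.sin (Real.pi * ε))
        (Complex.cos (Real.pi * 0) * (Real.pi * 1)) 0 :=
      ((hasDerivAt_id (0 : ℂ)).const_mul (Real.pi : ℂ)).csin
    rw [hD, dslope_same, h1.deriv]
    simp
  have hDne : ∀ ε, ε ≠ 0 → D ε = Complex.sin (Real.pi * ε) / ε := fun ε hε => by
    rw [hD, dslope_of_ne _ hε, slope_def_field]
    simp
  have hS : ∀ ε : ℂ, ε ≠ 0 → Real.pi / D ε = Real.pi * ε / Complex.sin (Real.pi * ε) :=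
    fun ε hε => by rw [hDne ε hε, div_div_eq_mul_div]
  have han : AnalyticAt ℂ (fun ε => Real.pi / D ε) 0 :=
    analyticAt_const.div (hDd.analyticAt 0) (by rw [hD0]; exact hpi)
  refine ⟨fun ε => Real.pi / D ε, han, by simp only [hD0, div_self hpi], ?_, hS⟩
  have hd := han.differentiableAt.hasDerivAt
  -- Evenness forces a zero derivative, so the residue of the Mellin transform does not leak into
  -- the derivative of the bracket.
  have heven : (fun ε : ℂ => Real.pi / D (-ε)) = fun ε => Real.pi / D ε := by
    funext ε
    by_cases hε : ε = 0
    · rw [hε, neg_zero]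
    · rw [hS ε hε, hS (-ε) (neg_ne_zero.2 hε), mul_neg, Complex.sin_neg, neg_div_neg_eq]
  have hd2 : HasDerivAt (fun ε : ℂ => Real.pi / D (-ε))
      (deriv (fun ε : ℂ => Real.pi / D ε) 0 * -1) 0 := by
    refine HasDerivAt.comp (0 : ℂ) (h₂ := fun ε : ℂ => Real.pi / D ε) ?_ (hasDerivAt_neg 0)
    rw [neg_zero]
    exact hd
  rw [heven] at hd2
  have := hd2.unique hd
  rw [mul_neg_one] at this
  exact self_eq_neg.1 this.symm

lemma sin_pi_mul_eq (m : ℕ) (z : ℂ) :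
    Complex.sin (Real.pi * z) = (-1) ^ m * Complex.sin (Real.pi * (z - m - 2)) := by
  have e : (Real.pi : ℂ) * z = Real.pi * (z - m - 2) + (m + 2 : ℕ) * Real.pi := by
    push_cast; ring
  rw [e, Complex.sin_antiperiodic.add_nat_mul_eq, pow_add]
  simp

variable {p : ℝ → ℝ} {b : ℕ → ℝ} {δ : ℝ}

/-- Put ε = z - m - 2, so a = 2 - z satisfies a + m = -ε and Γ(a)G(a) = reg(a) - b_m/ε. Also
π/sin(πz) = (-1)^m S(ε)/ε, with S(0) = 1 and S'(0) = 0. Hence the product with ε² is (-1)^m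
S(ε)(ε·reg(a) - b_m). -/
lemma HasTaylorTail.exists_analytic_extension (h : HasTaylorTail p b δ) {G : ℂ → ℂ}
    (hG : Differentiable ℂ G)
    (hpG : ∀ a : ℂ, 0 < a.re → mellin (fun u => (p u : ℂ)) a = Complex.Gamma a * G a)
    {M m : ℕ} (hm : m < M) :
    ∃ E : ℂ → ℂ, AnalyticAt ℂ E (m + 2) ∧ E (m + 2) = -(-1) ^ m * (b m : ℂ) ∧
      deriv E (m + 2) = (-1) ^ m * (finitePart p b M m : ℂ) ∧
      (fun z => (z - m - 2) ^ 2 * (Real.pi * (Complex.Gamma (2 - z) * G (2 - z)) /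
        Complex.sin (Real.pi * z))) =ᶠ[𝓝[≠] ((m : ℂ) + 2)] E := by
  obtain ⟨S, hSa, hS0, hSd, hS⟩ := exists_analytic_pi_mul_div_sin
  have hval : (m : ℂ) + 2 - m - 2 = 0 := by ring
  have hdisc : ∀ z : ℂ, z ∈ Metric.ball ((m : ℂ) + 2) 1 → ‖2 - z + m‖ < 1 := fun z hz => by
    rw [Metric.mem_ball, dist_eq_norm] at hz
    rwa [← norm_neg, show -(2 - z + (m : ℂ)) = z - (m + 2) by ring]
  have hregd : DifferentiableOn ℂ (fun z => regularPart p b M m (2 - z))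
      (Metric.ball ((m : ℂ) + 2) 1) := fun z hz =>
    (DifferentiableAt.comp z (h.differentiableAt_regularPart hm (hdisc z hz))
      (by fun_prop)).differentiableWithinAt
  have hrega := hregd.analyticAt (Metric.ball_mem_nhds _ one_pos)
  have hSa' : AnalyticAt ℂ (fun z : ℂ => S (z - m - 2)) (m + 2) :=
    AnalyticAt.fun_comp (by rw [hval]; exact hSa) (by fun_prop)
  have hSd' : HasDerivAt (fun z : ℂ => S (z - m - 2)) 0 (m + 2) := by
    have h1 : HasDerivAt (fun z : ℂ => z - m - 2) 1 (m + 2) :=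
      ((hasDerivAt_id _).sub_const _).sub_const _
    have h2 : HasDerivAt S 0 ((m : ℂ) + 2 - m - 2) := by
      have h3 := hSa.differentiableAt.hasDerivAt
      rw [hSd] at h3
      rwa [hval]
    exact (HasDerivAt.comp ((m : ℂ) + 2) h2 h1).congr_deriv (zero_mul _)
  have hregv : regularPart p b M m (2 - ((m : ℂ) + 2)) = (finitePart p b M m : ℂ) := by
    rw [← regularPart_neg]
    congr 1
    ring
  refine ⟨fun z => (-1) ^ m * (S (z - m - 2) *
    ((z - m - 2) * regularPart p b M m (2 - z) - b m)), ?_, ?_, ?_, ?_⟩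
  · exact analyticAt_const.mul (hSa'.mul (AnalyticAt.sub (AnalyticAt.mul (by fun_prop) hrega)
      analyticAt_const))
  · simp only [hval, hS0]
    ring
  · have h1 : HasDerivAt (fun z : ℂ => z - m - 2) 1 (m + 2) :=
      ((hasDerivAt_id _).sub_const _).sub_const _
    have h2 := ((hSd'.mul ((h1.mul hrega.differentiableAt.hasDerivAt).sub_const (b m : ℂ))).const_mul
      ((-1 : ℂ) ^ m)).deriv
    refine Eq.trans h2 ?_
    simp only [Pi.mul_apply, hval, hS0, hregv]
    ring
  · have hball : Metric.ball ((m : ℂ) + 2) 1 ∈ 𝓝[≠] ((m : ℂ) + 2) :=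
      mem_nhdsWithin_of_mem_nhds (Metric.ball_mem_nhds _ one_pos)
    filter_upwards [hball, self_mem_nhdsWithin] with z hz hne
    have hε : z - m - 2 ≠ 0 := by
      rw [sub_sub, sub_ne_zero]; exact hne
    have ha : 2 - z + (m : ℂ) = -(z - m - 2) := by ring
    rw [h.Gamma_mul_eq hG hpG hm (hdisc z hz) (by rw [ha]; exact neg_ne_zero.2 hε), ha,
      sin_pi_mul_eq m z, hS _ hε]
    have h1 : ((-1 : ℂ) ^ m) * (-1) ^ m = 1 := by rw [← mul_pow]; simp
    have h2 : ((-1 : ℂ) ^ m)⁻¹ = (-1) ^ m := inv_eq_of_mul_eq_one_left h1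
    rw [div_eq_mul_inv _ ((-1 : ℂ) ^ m * _), mul_inv, h2, div_neg,
      div_eq_mul_inv _ (Complex.sin _)]
    field_simp
    ring

/-- Certifies that the limit chosen in `bracketExt` exists and is the value of the analytic
extension, so derivatives at the point are meaningful. -/
lemma analyticAt_update_limUnder {f E : ℂ → ℂ} {z₀ : ℂ} (hE : AnalyticAt ℂ E z₀)
    (hf : f =ᶠ[𝓝[≠] z₀] E) :
    Function.update f z₀ (limUnder (𝓝[≠] z₀) f) =ᶠ[𝓝 z₀] E := by
  have hlim : limUnder (𝓝[≠] z₀) f = E z₀ :=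
    ((hE.continuousAt.tendsto.mono_left nhdsWithin_le_nhds).congr' hf.symm).limUnder_eq
  rw [hlim]
  rw [EventuallyEq, eventually_nhdsWithin_iff] at hf
  filter_upwards [hf] with z hz
  by_cases h : z = z₀
  · rw [h, Function.update_self]
  · rw [Function.update_of_ne h, hz h]

end RemovableSingularity

/-! ### The density of the squared gain, with its Laplace and Mellin transforms. -/

section GainDensity

/-- The series `∑ xᵏ / (k!)²`, that is, `I₀ (2 √x)`. -/
noncomputable def besselSeries (x : ℝ) : ℝ := ∑' k : ℕ, x ^ k / (k.factorial : ℝ) ^ 2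

lemma contDiff_besselSeries : ContDiff ℝ (⊤ : ℕ∞) besselSeries := by
  set c : ℕ → ℝ := fun k => ((k.factorial : ℝ) ^ 2)⁻¹ with hc
  have hr : (FormalMultilinearSeries.ofScalars ℝ c).radius = ⊤ := by
    refine FormalMultilinearSeries.ofScalars_radius_eq_top_of_tendsto ℝ c
      (Eventually.of_forall fun n => by positivity) ?_
    have h1 : Tendsto (fun n : ℕ => (1 / ((n : ℝ) + 1)) ^ 2) atTop (𝓝 0) := by
      have := (tendsto_one_div_add_atTop_nhds_zero_nat (𝕜 := ℝ)).pow 2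
      rwa [zero_pow two_ne_zero] at this
    refine h1.congr fun n => ?_
    rw [hc, Real.norm_of_nonneg (by positivity), Real.norm_of_nonneg (by positivity)]
    simp only [Nat.succ_eq_add_one, Nat.factorial_succ]
    push_cast
    field_simp
  have hf := (FormalMultilinearSeries.ofScalars ℝ c).hasFPowerSeriesOnBall (by rw [hr]; simp)
  rw [hr] at hf
  have he : besselSeries = (FormalMultilinearSeries.ofScalars ℝ c).sum := by
    funext x
    rw [← FormalMultilinearSeries.ofScalarsSum, FormalMultilinearSeries.ofScalarsSum_eq_tsum]
    refine tsum_congr fun k => ?_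
    rw [hc, smul_eq_mul, div_eq_inv_mul]
  rw [he, contDiff_iff_contDiffAt]
  exact fun x => (hf.analyticAt_of_mem (by simp)).contDiffAt

lemma pow_mul_div_factorial_sq_le {x y : ℝ} (hx : 0 ≤ x) (hy : 0 ≤ y) (k : ℕ) :
    (x * y) ^ k / (k.factorial : ℝ) ^ 2 ≤ x ^ k / k.factorial * Real.exp y := by
  have e : (x * y) ^ k / (k.factorial : ℝ) ^ 2 = x ^ k / k.factorial * (y ^ k / k.factorial) := by
    rw [mul_pow]
    field_simp
  rw [e]
  gcongr
  exact Real.pow_div_factorial_le_exp y hy k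

lemma summable_besselSeries {x : ℝ} (hx : 0 ≤ x) :
    Summable fun k : ℕ => x ^ k / (k.factorial : ℝ) ^ 2 := by
  refine Summable.of_nonneg_of_le (fun k => by positivity) (fun k => ?_)
    ((Real.summable_pow_div_factorial x).mul_right (Real.exp 1))
  simpa using pow_mul_div_factorial_sq_le hx zero_le_one k

lemma besselSeries_nonneg {x : ℝ} (hx : 0 ≤ x) : 0 ≤ besselSeries x :=
  tsum_nonneg fun k => by positivity

/-- Splitting the argument as a product lets a small multiple of u carry the growth, so that half of
the exponential decay of the density survives. -/
lemma besselSeries_mul_le {x y : ℝ} (hx : 0 ≤ x) (hy : 0 ≤ y) :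
    besselSeries (x * y) ≤ Real.exp x * Real.exp y := by
  have h : HasSum (fun k : ℕ => x ^ k / k.factorial * Real.exp y) (Real.exp x * Real.exp y) := by
    rw [Real.exp_eq_exp_ℝ]
    exact (NormedSpace.expSeries_div_hasSum_exp x).mul_right _
  rw [← h.tsum_eq]
  exact (summable_besselSeries (mul_nonneg hx hy)).tsum_le_tsum
    (pow_mul_div_factorial_sq_le hx hy) h.summable

/-- Termwise integration by dominated convergence, with ηu = (r/2·u)(2η/r) in the product bound. The
case a = 1 yields the Laplace transform, general a the Mellin transform. -/
lemma hasSum_integral_cpow_mul_exp_mul_besselSeries {a : ℂ} (ha : 0 < a.re) {r η : ℝ} (hr : 0 < r)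
    (hη : 0 ≤ η) :
    HasSum (fun k : ℕ => ((η ^ k / (k.factorial : ℝ) ^ 2 : ℝ) : ℂ) *
        ((1 / r : ℂ) ^ (a + k) * Complex.Gamma (a + k)))
      (∫ u in Set.Ioi (0 : ℝ), (u : ℂ) ^ (a - 1) *
        ((Real.exp (-(r * u)) * besselSeries (η * u) : ℝ) : ℂ)) := by
  set F : ℕ → ℝ → ℂ := fun k u => (u : ℂ) ^ (a - 1) *
    ((Real.exp (-(r * u)) * ((η * u) ^ k / (k.factorial : ℝ) ^ 2) : ℝ) : ℂ) with hF
  have hFint : ∀ k, ∫ u in Set.Ioi (0 : ℝ), F k u = ((η ^ k / (k.factorial : ℝ) ^ 2 : ℝ) : ℂ) *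
      ((1 / r : ℂ) ^ (a + k) * Complex.Gamma (a + k)) := fun k => by
    rw [← Complex.integral_cpow_mul_exp_neg_mul_Ioi (a := a + k) (by
      rw [Complex.add_re, Complex.natCast_re]; positivity) hr, ← integral_const_mul]
    refine setIntegral_congr_fun measurableSet_Ioi fun u hu => ?_
    have hu0 : (u : ℂ) ≠ 0 := Complex.ofReal_ne_zero.2 (ne_of_gt hu)
    have e : a + k - 1 = (a - 1) + k := by ring
    simp only [hF]
    rw [e, Complex.cpow_add _ _ hu0, Complex.cpow_natCast, mul_pow]
    push_cast
    ring
  simp_rw [← hFint]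
  have hsum : ∀ u : ℝ, 0 < u → Summable fun k : ℕ => (η * u) ^ k / (k.factorial : ℝ) ^ 2 :=
    fun u hu => summable_besselSeries (by positivity)
  have hcont : Continuous besselSeries := contDiff_besselSeries.continuous
  refine hasSum_integral_of_dominated_convergence
    (fun k u => u ^ (a.re - 1) * (Real.exp (-(r * u)) * ((η * u) ^ k / (k.factorial : ℝ) ^ 2)))
    (fun k => Measurable.aestronglyMeasurable (by fun_prop)) (fun k => ?_) ?_ ?_ ?_
  · filter_upwards [ae_restrict_mem measurableSet_Ioi] with u hu
    have hu0 : (0 : ℝ) < u := hu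
    rw [norm_mul, Complex.norm_cpow_eq_rpow_re_of_pos hu0, Complex.norm_real,
      Real.norm_of_nonneg (by positivity), Complex.sub_re, Complex.one_re]
  · filter_upwards [ae_restrict_mem measurableSet_Ioi] with u hu
    exact ((hsum u hu).mul_left _).mul_left _
  · have hdom : IntegrableOn (fun u : ℝ => Real.exp (2 * η / r) *
        (u ^ (a.re - 1) * Real.exp (-(r / 2) * u))) (Set.Ioi 0) := by
      have h1 := (integrableOn_rpow_mul_exp_neg_mul_rpow (s := a.re - 1) (p := 1) (b := r / 2)
        (by linarith) one_pos (by positivity)).const_mul (Real.exp (2 * η / r))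
      simp only [Real.rpow_one] at h1
      exact h1
    have he : ∀ᵐ u ∂(volume.restrict (Set.Ioi (0 : ℝ))), ∑' k : ℕ, u ^ (a.re - 1) *
        (Real.exp (-(r * u)) * ((η * u) ^ k / (k.factorial : ℝ) ^ 2)) =
        u ^ (a.re - 1) * (Real.exp (-(r * u)) * besselSeries (η * u)) := by
      filter_upwards with u
      rw [tsum_mul_left, tsum_mul_left, besselSeries]
    refine Integrable.congr ?_ (EventuallyEq.symm he)
    refine hdom.mono' (Measurable.aestronglyMeasurable ?_) ?_
    · exact (by fun_prop : Measurable fun u : ℝ => u ^ (a.re - 1)).mul ((by fun_prop :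
        Measurable fun u : ℝ => Real.exp (-(r * u))).mul (hcont.measurable.comp (by fun_prop)))
    · filter_upwards [ae_restrict_mem measurableSet_Ioi] with u hu
      have hu0 : (0 : ℝ) < u := hu
      have hB := besselSeries_mul_le (x := r / 2 * u) (y := 2 * η / r) (by positivity)
        (by positivity)
      have e : r / 2 * u * (2 * η / r) = η * u := by field_simp
      rw [e] at hB
      have h0 := besselSeries_nonneg (x := η * u) (by positivity)
      rw [Real.norm_of_nonneg (by positivity)]
      calc _ ≤ u ^ (a.re - 1) * (Real.exp (-(r * u)) * (Real.exp (r / 2 * u) *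
            Real.exp (2 * η / r))) := by gcongr
        _ = _ := by
          have e2 : Real.exp (-(r / 2) * u) = Real.exp (-(r * u)) * Real.exp (r / 2 * u) := by
            rw [← Real.exp_add]; congr 1; ring
          rw [e2]
          ring
  · filter_upwards [ae_restrict_mem measurableSet_Ioi] with u hu
    exact (Complex.hasSum_ofReal.2 ((hsum u hu).hasSum.mul_left _)).mul_left _

/-- The Laplace transform of `I₀ (2 √(ηu))`. -/
lemma integral_exp_neg_mul_besselSeries {r η : ℝ} (hr : 0 < r) (hη : 0 ≤ η) :
    ∫ u in Set.Ioi (0 : ℝ), Real.exp (-(r * u)) * besselSeries (η * u) =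
      1 / r * Real.exp (η / r) := by
  have h := hasSum_integral_cpow_mul_exp_mul_besselSeries (a := 1) (by simp) hr hη
  simp only [sub_self, Complex.cpow_zero, one_mul] at h
  rw [integral_complex_ofReal] at h
  have h2 : HasSum (fun k : ℕ => 1 / r * ((η / r) ^ k / k.factorial)) (1 / r * Real.exp (η / r)) := by
    rw [Real.exp_eq_exp_ℝ]
    exact (NormedSpace.expSeries_div_hasSum_exp (η / r)).mul_left _
  have h3 := Complex.hasSum_ofReal.2 h2
  have e : ∀ k : ℕ, ((η ^ k / (k.factorial : ℝ) ^ 2 : ℝ) : ℂ) *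
      ((1 / r : ℂ) ^ (1 + k : ℂ) * Complex.Gamma (1 + k)) =
      ((1 / r * ((η / r) ^ k / k.factorial) : ℝ) : ℂ) := fun k => by
    have hf : (k.factorial : ℂ) ≠ 0 := Nat.cast_ne_zero.2 k.factorial_ne_zero
    have hr' : (r : ℂ) ≠ 0 := Complex.ofReal_ne_zero.2 hr.ne'
    rw [add_comm (1 : ℂ), Complex.Gamma_nat_eq_factorial, ← Nat.cast_succ, Complex.cpow_natCast]
    push_cast
    rw [Nat.succ_eq_add_one, pow_succ, div_pow, div_pow, one_pow]
    field_simp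
    ring
  simp_rw [e] at h
  exact_mod_cast h.unique h3

/-- Against the two factorials in ₁F₁(a;1;z) this leaves an exponential series, uniformly for
bounded a; hence ₁F₁ is entire in its first parameter. -/
lemma norm_ascPochhammer_eval_le {a : ℂ} {K : ℝ} (ha : ‖a‖ ≤ K) (n : ℕ) :
    ‖(ascPochhammer ℂ n).eval a‖ ≤ (K + 1) ^ n * n.factorial := by
  have hK : 0 ≤ K := (norm_nonneg a).trans ha
  induction n with
  | zero => simp
  | succ n ih =>
    rw [ascPochhammer_succ_eval, norm_mul, pow_succ, Nat.factorial_succ]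
    have h1 : ‖a + n‖ ≤ (K + 1) * (n + 1) := by
      refine (norm_add_le _ _).trans ?_
      rw [Complex.norm_natCast]
      have : 0 ≤ K * n := by positivity
      nlinarith
    calc _ ≤ (K + 1) ^ n * n.factorial * ((K + 1) * (n + 1)) := by gcongr
      _ = _ := by push_cast; ring

lemma hypergeometric₁F₁_one (a z : ℂ) : hypergeometric₁F₁ a 1 z =
    ∑' n : ℕ, (ascPochhammer ℂ n).eval a * z ^ n / (n.factorial : ℂ) ^ 2 := by
  refine tsum_congr fun n => ?_
  rw [ascPochhammer_eval_one]
  ring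

lemma differentiable_hypergeometric₁F₁ (z : ℂ) :
    Differentiable ℂ fun a => hypergeometric₁F₁ a 1 z := by
  simp_rw [hypergeometric₁F₁_one]
  intro a
  have h : DifferentiableOn ℂ (fun a => ∑' n : ℕ, (ascPochhammer ℂ n).eval a * z ^ n /
      (n.factorial : ℂ) ^ 2) (Metric.ball 0 (‖a‖ + 1)) := by
    refine Complex.differentiableOn_tsum_of_summable_norm
      (Real.summable_pow_div_factorial ((‖a‖ + 1 + 1) * ‖z‖)) (fun n => ?_) Metric.isOpen_ball
      fun n a' ha' => ?_
    · exact (((ascPochhammer ℂ n).differentiable.mul_const _).div_const _).differentiableOn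
    · rw [norm_div, norm_mul, norm_pow, norm_pow, Complex.norm_natCast]
      have h1 := norm_ascPochhammer_eval_le (mem_ball_zero_iff.1 ha').le n
      calc _ ≤ (‖a‖ + 1 + 1) ^ n * n.factorial * ‖z‖ ^ n / (n.factorial : ℝ) ^ 2 := by gcongr
        _ = _ := by
          rw [mul_pow]
          field_simp
  exact h.differentiableAt (Metric.isOpen_ball.mem_nhds (by simp))

/-- The density of `|h|²` for a Gaussian gain `h` of variance `β` and squared mean `w β`. -/
noncomputable def gainDensity (β w u : ℝ) : ℝ :=
  Real.exp (-w) / β * (Real.exp (-(1 / β * u)) * besselSeries (w / β * u))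

variable {β w : ℝ}

lemma hasTaylorTail_gainDensity (hβ : 0 < β) (hw : 0 ≤ w) :
    HasTaylorTail (gainDensity β w) (rightTaylorCoeff (gainDensity β w)) (1 / (2 * β)) := by
  refine hasTaylorTail_of_contDiff (C := Real.exp (-w) / β * Real.exp (2 * w)) ?_ (by positivity)
    fun u hu => ?_
  · have := contDiff_besselSeries
    unfold gainDensity
    fun_prop
  · have h0 := besselSeries_nonneg (x := w / β * u) (by positivity)
    have hB := besselSeries_mul_le (x := 1 / (2 * β) * u) (y := 2 * w) (by positivity)
        (by positivity)
    have e : 1 / (2 * β) * u * (2 * w) = w / β * u := by field_simp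
    rw [e] at hB
    rw [gainDensity, abs_of_nonneg (by positivity)]
    calc _ ≤ Real.exp (-w) / β * (Real.exp (-(1 / β * u)) *
          (Real.exp (1 / (2 * β) * u) * Real.exp (2 * w))) := by gcongr
      _ = _ := by
        have e2 : Real.exp (-(1 / (2 * β)) * u) =
            Real.exp (-(1 / β * u)) * Real.exp (1 / (2 * β) * u) := by
          rw [← Real.exp_add]; congr 1; field_simp; ring
        rw [e2]
        ring

lemma integral_gainDensity_mul_exp (hβ : 0 < β) (hw : 0 ≤ w) {l : ℝ} (hl : 0 ≤ l) :
    ∫ u in Set.Ioi (0 : ℝ), gainDensity β w u * Real.exp (-l * u) =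
      (1 + l * β)⁻¹ * Real.exp (-l * (w * β) / (1 + l * β)) := by
  have e : ∀ u : ℝ, gainDensity β w u * Real.exp (-l * u) =
      Real.exp (-w) / β * (Real.exp (-((1 / β + l) * u)) * besselSeries (w / β * u)) := fun u => by
    have e2 : Real.exp (-((1 / β + l) * u)) = Real.exp (-(1 / β * u)) * Real.exp (-l * u) := by
      rw [← Real.exp_add]; congr 1; ring
    rw [gainDensity, e2]
    ring
  simp_rw [e]
  rw [integral_const_mul, integral_exp_neg_mul_besselSeries (by positivity) (by positivity)]
  have hd : 0 < 1 + l * β := by positivity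
  have e3 : Real.exp (-l * (w * β) / (1 + l * β)) =
      Real.exp (-w) * Real.exp (w / β / (1 / β + l)) := by
    rw [← Real.exp_add]
    congr 1
    field_simp
    ring
  rw [e3]
  field_simp

/-- Both sides are written as Laplace integrals of Laplace transforms, and these transforms agree.
This avoids proving that `gainDensity` is the density of |h|². -/
lemma gainTransform_eq_stieltjes (c : ℂ) {σ : ℝ} (hσ : 0 < σ) {s : ℝ} (hs : 0 < s) :
    gainTransform c σ s = 1 / s * ∫ u in Set.Ioi (0 : ℝ),
      gainDensity (2 * σ ^ 2) (‖c‖ ^ 2 / (2 * σ ^ 2)) u / (1 / s + u) := by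
  set β := 2 * σ ^ 2 with hβ
  have hβ0 : 0 < β := by positivity
  set w := ‖c‖ ^ 2 / β with hw
  have hw0 : 0 ≤ w := by positivity
  have hwβ : w * β = ‖c‖ ^ 2 := by rw [hw]; field_simp
  have hint : IntegrableOn (gainDensity β w) (Set.Ioi 0) := by
    have h := hasTaylorTail_gainDensity hβ0 hw0
    have h2 := h.bound 0
    obtain ⟨C, hC⟩ := h2
    refine ((integrableOn_exp_neg h.pos).const_mul C).mono' h.continuous.aestronglyMeasurable ?_
    filter_upwards [ae_restrict_mem measurableSet_Ioi] with u hu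
    simpa [taylorTail] using hC u hu
  -- The absolute value meets the requirement of nonnegativity on all of ℝ and disappears on the
  -- half-line.
  have h := integral_div_one_add_mul (ν := volume.restrict (Set.Ioi (0 : ℝ)))
    (f := fun u : ℝ => |u|) (by fun_prop) (fun u => abs_nonneg u) hint hs.le
  have h1 : ∫ u in Set.Ioi (0 : ℝ), gainDensity β w u / (1 + s * |u|) =
      1 / s * ∫ u in Set.Ioi (0 : ℝ), gainDensity β w u / (1 / s + u) := by
    rw [← integral_const_mul]
    refine setIntegral_congr_fun measurableSet_Ioi fun u hu => ?_
    have hu0 : (0 : ℝ) < u := hu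
    simp only [abs_of_pos hu0]
    field_simp
  rw [← h1, h, gainTransform_eq c hσ hs.le]
  refine setIntegral_congr_fun measurableSet_Ioi fun y hy => ?_
  have hy0 : (0 : ℝ) < y := hy
  have h2 : ∫ u in Set.Ioi (0 : ℝ), gainDensity β w u * Real.exp (-(s * y) * |u|) =
      ∫ u in Set.Ioi (0 : ℝ), gainDensity β w u * Real.exp (-(s * y) * u) := by
    refine setIntegral_congr_fun measurableSet_Ioi fun u hu => ?_
    simp only [abs_of_pos (show (0 : ℝ) < u from hu)]
  simp only [h2]
  rw [integral_gainDensity_mul_exp hβ0 hw0 (by positivity), hwβ]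

/-- The function whose product with `Γ` is the Mellin transform of `gainDensity`. -/
noncomputable def mellinFactor (β w : ℝ) (a : ℂ) : ℂ :=
  Complex.exp (-(w : ℝ)) * (β : ℂ) ^ (a - 1) * hypergeometric₁F₁ a 1 (w : ℂ)

lemma differentiable_mellinFactor (hβ : 0 < β) : Differentiable ℂ (mellinFactor β w) := by
  have hβ' : (β : ℂ) ≠ 0 := Complex.ofReal_ne_zero.2 hβ.ne'
  refine Differentiable.mul (Differentiable.const_mul (fun a => ?_) _)
    (differentiable_hypergeometric₁F₁ _)
  exact DifferentiableAt.const_cpow (by fun_prop) (Or.inl hβ')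

/-- The k-th term of the series carries Γ(a+k) = Γ(a)·(a)_k, which assembles into ₁F₁(a;1;w). -/
lemma mellin_gainDensity (hβ : 0 < β) (hw : 0 ≤ w) {a : ℂ} (ha : 0 < a.re) :
    mellin (fun u => (gainDensity β w u : ℂ)) a = Complex.Gamma a * mellinFactor β w a := by
  have hβ' : (β : ℂ) ≠ 0 := Complex.ofReal_ne_zero.2 hβ.ne'
  have h := hasSum_integral_cpow_mul_exp_mul_besselSeries ha (r := 1 / β) (η := w / β)
    (by positivity) (by positivity)
  have hne : ∀ k : ℕ, a ≠ -k := fun k hk => by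
    have h1 := congrArg Complex.re hk
    simp only [Complex.neg_re, Complex.natCast_re] at h1
    have : (0 : ℝ) ≤ k := by positivity
    linarith
  have hΓ : Complex.Gamma a ≠ 0 := Complex.Gamma_ne_zero hne
  have e1 : mellin (fun u => (gainDensity β w u : ℂ)) a = ((Real.exp (-w) / β : ℝ) : ℂ) *
      ∫ u in Set.Ioi (0 : ℝ), (u : ℂ) ^ (a - 1) *
        ((Real.exp (-(1 / β * u)) * besselSeries (w / β * u) : ℝ) : ℂ) := by
    rw [mellin, ← integral_const_mul]
    refine setIntegral_congr_fun measurableSet_Ioi fun u _ => ?_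
    simp only [gainDensity, smul_eq_mul]
    push_cast
    ring
  rw [e1, ← h.tsum_eq, mellinFactor, hypergeometric₁F₁_one]
  rw [← tsum_mul_left, ← tsum_mul_left, ← tsum_mul_left]
  refine tsum_congr fun k => ?_
  rw [← Complex.Gamma_add_nat_div_Gamma_eq a hne]
  have e2 : (1 / ((1 / β : ℝ) : ℂ)) ^ (a + k) = (β : ℂ) ^ (a - 1) * β * β ^ k := by
    have : (1 / ((1 / β : ℝ) : ℂ)) = β := by push_cast; rw [one_div_one_div]
    rw [this, Complex.cpow_add _ _ hβ', Complex.cpow_natCast]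
    congr 1
    rw [Complex.cpow_sub _ _ hβ', Complex.cpow_one]
    field_simp
  rw [e2]
  push_cast
  rw [div_pow]
  field_simp

end GainDensity

/-! ### The full asymptotic expansion for a Gaussian input. -/

section GaussianExpansion

/-- The Taylor coefficients at `0` of the density of the squared gain. -/
noncomputable def gainCoeff (c : ℂ) (σ : ℝ) : ℕ → ℝ :=
  rightTaylorCoeff (gainDensity (2 * σ ^ 2) (‖c‖ ^ 2 / (2 * σ ^ 2)))

/-- The finite part of `∫₀^∞ p u / u^(m+1) du`, for `p` the density of the squared gain. -/
noncomputable def gainFinitePart (c : ℂ) (σ : ℝ) (m : ℕ) : ℝ :=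
  finitePart (gainDensity (2 * σ ^ 2) (‖c‖ ^ 2 / (2 * σ ^ 2))) (gainCoeff c σ) (m + 1) m

variable {σ : ℝ}

lemma exists_bracketExt_eventuallyEq (c : ℂ) (hσ : 0 < σ) {M m : ℕ} (hm : m < M) :
    ∃ E : ℂ → ℂ, AnalyticAt ℂ E (m + 2) ∧ E (m + 2) = -(-1) ^ m * (gainCoeff c σ m : ℂ) ∧
      deriv E (m + 2) = (-1) ^ m * (finitePart (gainDensity (2 * σ ^ 2) (‖c‖ ^ 2 / (2 * σ ^ 2)))
        (gainCoeff c σ) M m : ℂ) ∧ bracketExt c σ m =ᶠ[𝓝 ((m : ℂ) + 2)] E := by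
  have hβ : 0 < 2 * σ ^ 2 := by positivity
  have hw : 0 ≤ ‖c‖ ^ 2 / (2 * σ ^ 2) := by positivity
  obtain ⟨E, hE, hE0, hE1, hEq⟩ := (hasTaylorTail_gainDensity hβ hw).exists_analytic_extension
    (differentiable_mellinFactor hβ) (fun a ha => mellin_gainDensity hβ hw ha) hm
  refine ⟨E, hE, hE0, hE1, analyticAt_update_limUnder hE (EventuallyEq.trans ?_ hEq)⟩
  refine Eventually.of_forall fun z => ?_
  simp only [bracket, mellinFactor]
  rw [show 2 - z - 1 = 1 - z by ring]
  push_cast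
  ring

/-- The finite part does not depend on the truncation order: for every M > m it is, up to sign, the
derivative of `bracketExt` at m + 2, whose definition does not involve M. -/
lemma finitePart_gainDensity (c : ℂ) (hσ : 0 < σ) {M m : ℕ} (hm : m < M) :
    finitePart (gainDensity (2 * σ ^ 2) (‖c‖ ^ 2 / (2 * σ ^ 2))) (gainCoeff c σ) M m =
      gainFinitePart c σ m := by
  obtain ⟨E, -, -, hE, h⟩ := exists_bracketExt_eventuallyEq c hσ hm
  obtain ⟨E', -, -, hE', h'⟩ := exists_bracketExt_eventuallyEq c hσ (Nat.lt_succ_self m)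
  rw [← h.deriv_eq] at hE
  rw [← h'.deriv_eq, hE] at hE'
  exact_mod_cast mul_left_cancel₀ (pow_ne_zero m (neg_ne_zero.2 one_ne_zero)) hE'

lemma analyticAt_bracketExt (c : ℂ) (hσ : 0 < σ) (m : ℕ) :
    AnalyticAt ℂ (bracketExt c σ m) (m + 2) := by
  obtain ⟨E, hE, -, -, h⟩ := exists_bracketExt_eventuallyEq c hσ (Nat.lt_succ_self m)
  exact hE.congr h.symm

lemma bracketExt_eq (c : ℂ) (hσ : 0 < σ) (m : ℕ) :
    bracketExt c σ m (m + 2) = -(-1) ^ m * (gainCoeff c σ m : ℂ) := by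
  obtain ⟨E, -, hE, -, h⟩ := exists_bracketExt_eventuallyEq c hσ (Nat.lt_succ_self m)
  rw [h.eq_of_nhds, hE]

lemma deriv_bracketExt (c : ℂ) (hσ : 0 < σ) (m : ℕ) :
    deriv (bracketExt c σ m) (m + 2) = (-1) ^ m * (gainFinitePart c σ m : ℂ) := by
  obtain ⟨E, -, -, hE, h⟩ := exists_bracketExt_eventuallyEq c hσ (Nat.lt_succ_self m)
  rw [h.deriv_eq, hE]
  rfl

/-- The terms of order `s^(-m-2)`, up to logarithms, of the expansion for a Gaussian input. -/
noncomputable def gaussTerm (c : ℂ) (σ : ℝ) (m : ℕ) (s : ℝ) : ℝ :=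
  -(-1) ^ m * (gainFinitePart c σ m + gainCoeff c σ m * Real.log s) / s ^ (m + 2)

/-- The Stieltjes expansion at x = 1/s, entering with the factor -1/s². Since log x = -log s, the
logarithmic terms change sign. -/
lemma isBigO_sub_gaussTerm (c : ℂ) (hσ : 0 < σ) {F : ℝ → ℝ}
    (hF : ∀ s, 0 < s → F s = 1 / s * (1 - gainTransform c σ s)) (M : ℕ) :
    (fun s => F s - (1 / s + ∑ m ∈ Finset.range M, gaussTerm c σ m s)) =O[atTop]
      fun s => Real.log s / s ^ (M + 2) := by
  have hβ : 0 < 2 * σ ^ 2 := by positivity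
  have hw : 0 ≤ ‖c‖ ^ 2 / (2 * σ ^ 2) := by positivity
  obtain ⟨C, hC0, hC⟩ := (hasTaylorTail_gainDensity hβ hw).exists_stieltjes_expansion M
  refine IsBigO.of_bound (2 * C) ?_
  -- s ≥ 2 gives x ≤ 1/2; s ≥ e gives 1 + log s ≤ 2 log s, hence the constant 2C.
  filter_upwards [eventually_ge_atTop (2 : ℝ), eventually_ge_atTop (Real.exp 1)] with s hs hse
  have hs0 : 0 < s := by linarith
  have hlog : 1 ≤ Real.log s := by rwa [Real.le_log_iff_exp_le hs0]
  have h := hC (1 / s) (by positivity) (one_div_le_one_div_of_le two_pos hs)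
  have hl : Real.log (1 / s) = -Real.log s := by rw [one_div, Real.log_inv]
  rw [hl, abs_neg, abs_of_pos (by linarith : 0 < Real.log s)] at h
  have hsum : ∑ j ∈ Finset.range M, (-(1 / s)) ^ j *
      (finitePart (gainDensity (2 * σ ^ 2) (‖c‖ ^ 2 / (2 * σ ^ 2)))
        (rightTaylorCoeff (gainDensity (2 * σ ^ 2) (‖c‖ ^ 2 / (2 * σ ^ 2)))) M j -
      rightTaylorCoeff (gainDensity (2 * σ ^ 2) (‖c‖ ^ 2 / (2 * σ ^ 2))) j * -Real.log s) =
      -(s ^ 2 * ∑ m ∈ Finset.range M, gaussTerm c σ m s) := by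
    rw [Finset.mul_sum, ← Finset.sum_neg_distrib]
    refine Finset.sum_congr rfl fun j hj => ?_
    have h1 := finitePart_gainDensity c hσ (Finset.mem_range.1 hj)
    rw [gainCoeff] at h1
    rw [h1, gaussTerm, gainCoeff, neg_pow, div_pow, one_pow, pow_add]
    field_simp
    ring
  rw [hsum] at h
  have hpos : 0 < s ^ (M + 2) := by positivity
  rw [hF s hs0, gainTransform_eq_stieltjes c hσ hs0, Real.norm_eq_abs,
    Real.norm_of_nonneg (by positivity)]
  set I := ∫ u in Set.Ioi (0 : ℝ),
      gainDensity (2 * σ ^ 2) (‖c‖ ^ 2 / (2 * σ ^ 2)) u / (1 / s + u)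
  set T := ∑ m ∈ Finset.range M, gaussTerm c σ m s
  have e : 1 / s * (1 - 1 / s * I) - (1 / s + T) = -(1 / s ^ 2 * (I - -(s ^ 2 * T))) := by
    field_simp
    ring
  rw [e, abs_neg, abs_mul, abs_of_pos (by positivity : 0 < 1 / s ^ 2)]
  calc _ ≤ 1 / s ^ 2 * (C * (1 / s) ^ M * (1 + Real.log s)) := by gcongr
    _ ≤ 1 / s ^ 2 * (C * (1 / s) ^ M * (2 * Real.log s)) := by
        gcongr
        linarith
    _ = _ := by
        rw [div_pow, one_pow, pow_add]
        field_simp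

lemma gaussScale_odd (q : ℕ) (s : ℝ) : gaussScale (2 * q + 1) s = Real.log s / s ^ (q + 2) := by
  simp [gaussScale]

lemma gaussScale_even (q : ℕ) (s : ℝ) : gaussScale (2 * q + 2) s = 1 / s ^ (q + 2) := by
  have h1 : (2 * q + 1) / 2 = q := by omega
  have h2 : (2 * q + 1) % 2 = 1 := by omega
  simp [gaussScale, h1, h2]

lemma gaussCoeffSeq_odd (c : ℂ) (hσ : 0 < σ) (q : ℕ) :
    gaussCoeffSeq c σ (2 * q + 1) = ((-(-1) ^ q * gainCoeff c σ q : ℝ) : ℂ) := by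
  simp [gaussCoeffSeq, gaussCoeff, bracketExt_eq c hσ]

lemma gaussCoeffSeq_even (c : ℂ) (hσ : 0 < σ) (q : ℕ) :
    gaussCoeffSeq c σ (2 * q + 2) = ((-(-1) ^ q * gainFinitePart c σ q : ℝ) : ℂ) := by
  have h1 : (2 * q + 1) / 2 = q := by omega
  have h2 : (2 * q + 1) % 2 = 1 := by omega
  simp [gaussCoeffSeq, gaussCoeff, h1, h2, deriv_bracketExt c hσ]

lemma sum_gaussCoeffSeq_odd (c : ℂ) (hσ : 0 < σ) (q : ℕ) (s : ℝ) :
    ∑ n ∈ Finset.range (2 * q + 1), gaussCoeffSeq c σ n * (gaussScale n s : ℂ) =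
      ((1 / s + ∑ m ∈ Finset.range q, gaussTerm c σ m s : ℝ) : ℂ) := by
  induction q with
  | zero => simp [gaussCoeffSeq, gaussScale]
  | succ q ih =>
    rw [show 2 * (q + 1) + 1 = 2 * q + 1 + 1 + 1 by ring, Finset.sum_range_succ,
      Finset.sum_range_succ, ih, gaussCoeffSeq_odd c hσ, gaussCoeffSeq_even c hσ, gaussScale_odd,
      gaussScale_even, Finset.sum_range_succ, gaussTerm]
    push_cast
    ring

lemma continuousOn_gaussScale (n : ℕ) : ContinuousOn (gaussScale n) (Set.Ioi 0) := by
  have hne : ∀ s ∈ Set.Ioi (0 : ℝ), s ≠ 0 := fun s hs => ne_of_gt hs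
  have hlog : ContinuousOn Real.log (Set.Ioi 0) := Real.continuousOn_log.mono hne
  cases n with
  | zero => exact continuousOn_const.div continuousOn_id hne
  | succ n =>
    exact (hlog.pow _).div (continuousOn_id.pow _) fun s hs => pow_ne_zero _ (hne s hs)

lemma log_div_pow_isLittleO (q : ℕ) :
    (fun s => Real.log s / s ^ (q + 1)) =o[atTop] fun s : ℝ => 1 / s ^ q := by
  have h := Real.isLittleO_log_id_atTop.mul_isBigO
    (isBigO_refl (fun s : ℝ => 1 / s ^ (q + 1)) atTop)
  refine (h.congr' (Eventually.of_forall fun s => ?_) ?_)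
  · exact mul_one_div _ _
  · filter_upwards [eventually_gt_atTop 0] with s hs
    rw [id, pow_succ]
    field_simp

lemma gaussScale_isLittleO (n : ℕ) : gaussScale (n + 1) =o[atTop] gaussScale n := by
  cases n with
  | zero =>
    refine (log_div_pow_isLittleO 1).congr (fun s => ?_) fun s => ?_
    · rw [gaussScale_odd 0]
    · rw [pow_one, gaussScale]
  | succ n =>
    obtain ⟨q, hq | hq⟩ := Nat.even_or_odd' n
    · rw [hq]
      have h : (fun _ : ℝ => (1 : ℝ)) =o[atTop] Real.log :=
        Real.isLittleO_const_log_atTop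
      refine (h.mul_isBigO (isBigO_refl (fun s : ℝ => 1 / s ^ (q + 2)) atTop)).congr
        (fun s => ?_) fun s => ?_
      · rw [gaussScale_even, one_mul]
      · rw [gaussScale_odd, mul_one_div]
    · rw [hq]
      refine (log_div_pow_isLittleO (q + 2)).congr (fun s => ?_) fun s => ?_
      · rw [show 2 * q + 1 + 1 + 1 = 2 * (q + 1) + 1 by ring, gaussScale_odd]
      · rw [gaussScale_even]

/-- A partial sum that stops between blocks is the grouped estimate. One that stops after a
logarithmic term is the grouped estimate with one more block, plus the omitted multiple of s^(-q-2),
which dominates the error. -/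
lemma isAsymptoticExpansion_gaussian (c : ℂ) (hσ : 0 < σ) {F : ℝ → ℝ}
    (hF : ∀ s, 0 < s → F s = 1 / s * (1 - gainTransform c σ s)) :
    IsAsymptoticExpansion (fun s => (F s : ℂ)) (gaussCoeffSeq c σ) gaussScale := by
  refine ⟨continuousOn_gaussScale, gaussScale_isLittleO, fun n => ?_⟩
  obtain ⟨q, hq | hq⟩ := Nat.even_or_odd' n
  · rw [hq]
    simp_rw [sum_gaussCoeffSeq_odd c hσ, ← Complex.ofReal_sub]
    rw [Complex.isBigO_ofReal_left, show gaussScale (2 * q + 1) = _ from funext (gaussScale_odd q)]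
    exact isBigO_sub_gaussTerm c hσ hF q
  · rw [hq]
    have hval : ∀ s, (F s : ℂ) - ∑ n ∈ Finset.range (2 * q + 1 + 1),
        gaussCoeffSeq c σ n * (gaussScale n s : ℂ) =
        ((F s - (1 / s + ∑ m ∈ Finset.range (q + 1), gaussTerm c σ m s) +
          (-(-1) ^ q * gainFinitePart c σ q) * (1 / s ^ (q + 2)) : ℝ) : ℂ) := fun s => by
      rw [Finset.sum_range_succ, sum_gaussCoeffSeq_odd c hσ, gaussCoeffSeq_odd c hσ,
        gaussScale_odd, Finset.sum_range_succ, gaussTerm]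
      push_cast
      ring
    simp_rw [hval]
    rw [Complex.isBigO_ofReal_left, show gaussScale (2 * q + 2) = _ from funext (gaussScale_even q)]
    exact ((isBigO_sub_gaussTerm c hσ hF (q + 1)).trans (log_div_pow_isLittleO (q + 2)).isBigO).add
      ((isBigO_refl _ _).const_mul_left _)

lemma isBigO_sub_bracketExt (c : ℂ) (hσ : 0 < σ) {F : ℝ → ℝ}
    (hF : ∀ s, 0 < s → F s = 1 / s * (1 - gainTransform c σ s)) (M : ℕ) :
    (fun s : ℝ => (F s : ℂ) - (1 / (s : ℂ) + 1 / (s : ℂ) ^ 2 * ∑ m ∈ Finset.range M,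
      -(1 / (s : ℂ) ^ m) * ∑ j ∈ Finset.range 2,
        (-(Real.log s : ℂ)) ^ j / ((j.factorial : ℂ) * ((1 - j).factorial : ℂ)) *
          iteratedDeriv (1 - j) (bracketExt c σ m) (m + 2))) =O[atTop]
      fun s : ℝ => Real.log s / s ^ (M + 2) := by
  refine (Complex.isBigO_ofReal_left.2 (isBigO_sub_gaussTerm c hσ hF M)).congr_left
    fun s => ?_
  push_cast
  congr 2
  rw [Finset.mul_sum]
  refine Finset.sum_congr rfl fun m _ => ?_
  rw [Finset.sum_range_succ, Finset.sum_range_one, gaussTerm]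
  simp only [tsub_zero, tsub_self, iteratedDeriv_one, iteratedDeriv_zero, bracketExt_eq c hσ,
    deriv_bracketExt c hσ, Nat.factorial_zero, Nat.factorial_one]
  push_cast
  rw [pow_add, ← div_div, div_eq_mul_inv _ ((s : ℂ) ^ 2), div_eq_mul_inv _ ((s : ℂ) ^ m)]
  ring

end GaussianExpansion

end FadingMMSE

/-! ### Assembly of the four cases. -/

theorem mainTheorem12 {Ω : Type*} [MeasurableSpace Ω] (P : Measure Ω) [IsProbabilityMeasure P]
    (X H N : Ω → ℂ) (c : ℂ) (σ : ℝ) (hσ : 0 < σ)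
    (hch : FadingMMSE.IsRayleighRiceChannel P X H N c σ) :
    (P.map X = FadingMMSE.inftyPSK → ∀ R ∈ Set.Ioo (1 : ℝ) 2,
      (fun s : ℝ => FadingMMSE.avgMMSE P X H N s - 1 / (2 * s)) =O[atTop]
        fun s : ℝ => 1 / s ^ R) ∧
    (P.map X = FadingMMSE.inftyPAM → ∀ R ∈ Set.Ioo (1 : ℝ) (3 / 2),
      (fun s : ℝ => FadingMMSE.avgMMSE P X H N s - 1 / (2 * s)) =O[atTop]
        fun s : ℝ => 1 / s ^ R) ∧
    (P.map X = FadingMMSE.inftyQAM → ∀ R ∈ Set.Ioo (1 : ℝ) (3 / 2),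
      (fun s : ℝ => FadingMMSE.avgMMSE P X H N s - 1 / s) =O[atTop]
        fun s : ℝ => 1 / s ^ R) ∧
    (P.map X = FadingMMSE.complexNormal 0 1 →
      -- the functions that are differentiated at `m + 2` are analytic there
      (∀ m : ℕ, AnalyticAt ℂ (FadingMMSE.bracketExt c σ m) (m + 2)) ∧
      -- the expansion, one power of `log snr` at a time
      FadingMMSE.IsAsymptoticExpansion (fun s => (FadingMMSE.avgMMSE P X H N s : ℂ))
        (FadingMMSE.gaussCoeffSeq c σ) FadingMMSE.gaussScale ∧
      -- the same expansion, with the two terms of order `snr^(-m-2)` grouped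
      ∀ M : ℕ,
        (fun s : ℝ => (FadingMMSE.avgMMSE P X H N s : ℂ) -
          (1 / (s : ℂ) + 1 / (s : ℂ) ^ 2 * ∑ m ∈ Finset.range M, -(1 / (s : ℂ) ^ m) *
            ∑ j ∈ Finset.range 2,
              (-(Real.log s : ℂ)) ^ j / ((j.factorial : ℂ) * ((1 - j).factorial : ℂ)) *
                iteratedDeriv (1 - j) (FadingMMSE.bracketExt c σ m) (m + 2))) =O[atTop]
          fun s : ℝ => Real.log s / s ^ (M + 2)) := by
  refine ⟨fun hlaw R hR => ?_, fun hlaw R hR => ?_, fun hlaw R hR => ?_, fun hlaw => ?_⟩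
  · obtain ⟨K, hK0, hK⟩ := hch.exists_avgMMSE_le_inftyPSK hlaw
    exact FadingMMSE.isBigO_of_gainTransform_bound hσ hK0 hK
      (fun s hs => hch.le_avgMMSE_inftyPSK hlaw hs) hR
  · exact FadingMMSE.isBigO_of_weight_bound hσ two_pos
      (fun s hs => hch.avgMMSE_le_inftyPAM hlaw hs)
      (fun s hs m => hch.le_avgMMSE_inftyPAM hlaw hs m) hR
  · have hL : 0 < √(3 / 2 : ℝ) := by positivity
    have := FadingMMSE.isProbabilityMeasure_uniformLaw hL
    have hX : MemLp (fun x : ℂ => x) 2 (P.map X) := by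
      rw [hlaw, FadingMMSE.inftyQAM_eq]
      exact FadingMMSE.memLp_id_squareLaw (FadingMMSE.memLp_uniformLaw hL continuous_id)
    have h := FadingMMSE.isBigO_of_weight_bound (F := FadingMMSE.avgMMSE P X H N) (d := 1) hσ one_pos
      (fun s hs => by simpa only [one_mul] using hch.avgMMSE_le_one_div hX hs)
      (fun s hs m => by simpa only [one_mul] using hch.le_avgMMSE_inftyQAM hlaw hs m) hR
    simpa only [one_mul] using h
  · have hF : ∀ s, 0 < s → FadingMMSE.avgMMSE P X H N s =
        1 / s * (1 - FadingMMSE.gainTransform c σ s) := fun s hs =>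
      le_antisymm (hch.avgMMSE_le_gaussian hlaw hs) (hch.le_avgMMSE_gaussian hlaw hs)
    exact ⟨FadingMMSE.analyticAt_bracketExt c hσ,
      FadingMMSE.isAsymptoticExpansion_gaussian c hσ hF, FadingMMSE.isBigO_sub_bracketExt c hσ hF⟩
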